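/- Let $-\infty\le a<b\le\infty$, let $J\in\mathbb C^{n\times n}$ be invertible and skew-Hermitian, and let $q,w$ be $n\times n$-matrices whose entries are distributions of order $0$ on $(a,b)$ (distributional derivatives of functions of locally bounded variation), with $q$ Hermitian and $w$ non-negative. Let $Q,W$ be left-continuous antiderivatives of $q,w$, and assume that $a$ and $b$ are regular, i.e. $Q$ and $W$ are of bounded variation on $(a,c)$ and on $(c',b)$ for some $c,c'\in(a,b)$. Put $\Delta_q=Q^+-Q^-$, $\Delta_w=W^+-W^-$, $B_\pm(x,\mu)=J\pm\frac12(\Delta_q(x)-\mu\Delta_w(x))$ and $\Xi_\mu=\{x\in(a,b):\det B_+(x,\mu)\det B_-(x,\mu)=0\}$. Let $N\ge1$ and $a=x_0<x_1<\dots<x_N<x_{N+1}=b$ be such that $\Xi_0\subset\{x_1,\dots,x_N\}$, and let $\lambda\in\mathbb C$ be such that $\Xi_\lambda\subset\{x_1,\dots,x_N\}$. Solutions are understood to be balanced ($u=\frac12(u^++u^-)$) functions of locally bounded variation on the interval in question, and the equation is an equality of distributions of order $0$. Then, for $j=0,\dots,N$, there is on $(x_j,x_{j+1})$ an $n\times n$-matrix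 $U_j(\cdot,\overline\lambda)$ whose columns are solutions of $Ju'+(q-\overline\lambda w)u=0$ there and which satisfies $\lim_{x\downarrow x_j}U_j(x,\overline\lambda)=1$. For any such $U_j$ put $U_{j-1}(x_j,\overline\lambda)=\lim_{x\uparrow x_j}U_{j-1}(x,\overline\lambda)$, and let $\mathbb B(\overline\lambda)\in\mathbb C^{nN\times n(N+1)}$ be the block matrix whose $j$-th block row, $j=1,\dots,N$, has the block $-B_-(x_j,\overline\lambda)U_{j-1}(x_j,\overline\lambda)$ in block column $j-1$, the block $B_+(x_j,\overline\lambda)$ in block column $j$, and zeros elsewhere (block columns are numbered $0,\dots,N$). Let $\mathbb B_m(\overline\lambda)$ be $\mathbb B(\overline\lambda)$ without its first and last $n$ columns (for $N=1$ it has no columns and $\ker\mathbb B_m(\overline\lambda)^*=\mathbb C^n$). Then: 1. If $u$ is a solution of $Ju'+(q-\lambda w)u=0$ on $(a,b)$, then $\hat u=(u(x_1),\dots,u(x_N))\in\ker\mathbb B_m(\overline\lambda)^*$. If, in addition, $u^+(a)=u^-(b)=0$, then $\hat u\in\ker\mathbb B(\overline\lambda)^*$, a subspace of $\ker\mathbb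 B_m(\overline\lambda)^*$. 2. Conversely, for every $v\in\ker\mathbb B_m(\overline\lambda)^*$ the equation $Ju'+(q-\lambda w)u=0$ has a unique solution $u$ on $(a,b)$ such that $\hat u=v$; if $v\in\ker\mathbb B(\overline\lambda)^*$, then $u^+(a)=u^-(b)=0$. 3. A solution $u$ of $Ju'+(q-\lambda w)u=0$ on $(a,b)$ satisfies $u^+(a)=u^-(b)=0$ if and only if its support is a compact subset of $(a,b)$, and in this case $u$ vanishes outside $[x_1,x_N]$. -/

import Mathlib

open MeasureTheory Filter Topology

namespace FirstOrderSystem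

noncomputable section

/-- The points of the real line strictly between two extended real numbers, i.e. the (bounded or
unbounded) open interval `(c, d)`. -/
def openInterval (c d : EReal) : Set ℝ := {t | c < (t : EReal) ∧ (t : EReal) < d}

/-- The filter of real `t` with `t ↓ c`; for `c = -∞` this is `t → -∞`. -/
def downTo (c : EReal) : Filter ℝ := comap Real.toEReal (𝓝[>] c)

/-- The filter of real `t` with `t ↑ d`; for `d = ∞` this is `t → ∞`. -/
def upTo (d : EReal) : Filter ℝ := comap Real.toEReal (𝓝[<] d)

open Classical in
/-- The complex Stieltjes measure `df` of a function `f` of bounded variation on `[s, t]`. It is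
formed from the extension of `f` which is constant to the left of `s` and to the right of `t`, and it
is meant to be evaluated on Borel subsets of `(s, t)` only; there it does not depend on the choice
of `s` and `t`. For instance, it has mass `f(d⁺) - f(c⁺)` on `(c, d]` when `s < c ≤ d < t`. -/
def stieltjes (f : ℝ → ℂ) (s t : ℝ) : VectorMeasure ℝ ℂ :=
  if h : BoundedVariationOn (fun r => f (max s (min t r))) Set.univ then h.vectorMeasure else 0

/-- `∫_E g df` for a Borel set `E ⊆ (s, t)`. -/
def stieltjesIntegral (g f : ℝ → ℂ) (s t : ℝ) (E : Set ℝ) : ℂ :=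
  ((stieltjes f s t).restrict E).integral g (ContinuousLinearMap.mul ℝ ℂ)

variable {n N : ℕ}

/-- `F` is a left-continuous, matrix-valued function of locally bounded variation on `(a, b)`. Up to
an additive constant these functions correspond to the matrices `F'` whose entries are distributions
of order `0` on `(a, b)`. -/
structure IsAntiderivative (a b : EReal) (F : ℝ → Matrix (Fin n) (Fin n) ℂ) : Prop where
  locallyBoundedVariation : ∀ i j,
    LocallyBoundedVariationOn (fun t => F t i j) (openInterval a b)
  leftContinuous : ∀ i j, ∀ t ∈ openInterval a b,
    ContinuousWithinAt (fun r => F r i j) (Set.Iic t) t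

/-- The distribution `F'` is Hermitian. -/
def HermitianDeriv (a b : EReal) (F : ℝ → Matrix (Fin n) (Fin n) ℂ) : Prop :=
  ∀ s ∈ openInterval a b, ∀ t ∈ openInterval a b, (F t - F s).IsHermitian

open scoped ComplexOrder in
/-- The distribution `F'` is non-negative: `dF([s, t)) = F t - F s` is positive semidefinite. -/
def NonnegDeriv (a b : EReal) (F : ℝ → Matrix (Fin n) (Fin n) ℂ) : Prop :=
  ∀ s ∈ openInterval a b, ∀ t ∈ openInterval a b, s ≤ t → (F t - F s).PosSemidef

/-- The left endpoint `a` is regular. -/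
def RegularLeft (a b : EReal) (Q W : ℝ → Matrix (Fin n) (Fin n) ℂ) : Prop :=
  ∃ c ∈ openInterval a b, ∀ i j,
    BoundedVariationOn (fun t => Q t i j) (openInterval a (c : EReal)) ∧
    BoundedVariationOn (fun t => W t i j) (openInterval a (c : EReal))

/-- The right endpoint `b` is regular. -/
def RegularRight (a b : EReal) (Q W : ℝ → Matrix (Fin n) (Fin n) ℂ) : Prop :=
  ∃ c ∈ openInterval a b, ∀ i j,
    BoundedVariationOn (fun t => Q t i j) (openInterval (c : EReal) b) ∧
    BoundedVariationOn (fun t => W t i j) (openInterval (c : EReal) b)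

/-- The jump `F⁺(t) - F⁻(t)`, i.e. the matrix `dF({t})`. -/
def jump (F : ℝ → Matrix (Fin n) (Fin n) ℂ) (t : ℝ) : Matrix (Fin n) (Fin n) ℂ :=
  Matrix.of fun i j =>
    Function.rightLim (fun r => F r i j) t - Function.leftLim (fun r => F r i j) t

/-- `B₊(t, μ) = J + (Δ_q(t) - μ Δ_w(t)) / 2`, where `q = Q'` and `w = W'`. -/
def Bplus (J : Matrix (Fin n) (Fin n) ℂ) (Q W : ℝ → Matrix (Fin n) (Fin n) ℂ)
    (t : ℝ) (μ : ℂ) : Matrix (Fin n) (Fin n) ℂ :=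
  J + (1 / 2 : ℂ) • (jump Q t - μ • jump W t)

/-- `B₋(t, μ) = J - (Δ_q(t) - μ Δ_w(t)) / 2`, where `q = Q'` and `w = W'`. -/
def Bminus (J : Matrix (Fin n) (Fin n) ℂ) (Q W : ℝ → Matrix (Fin n) (Fin n) ℂ)
    (t : ℝ) (μ : ℂ) : Matrix (Fin n) (Fin n) ℂ :=
  J - (1 / 2 : ℂ) • (jump Q t - μ • jump W t)

/-- `Ξ_μ`, the set of the points of `(a, b)` where `B₊(·, μ)` or `B₋(·, μ)` fails to be
invertible. -/
def badPoints (J : Matrix (Fin n) (Fin n) ℂ) (Q W : ℝ → Matrix (Fin n) (Fin n) ℂ)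
    (a b : EReal) (μ : ℂ) : Set ℝ :=
  {t ∈ openInterval a b | (Bplus J Q W t μ).det * (Bminus J Q W t μ).det = 0}

/-- `u` is a solution of `J u' + (q - μ w) u = 0` on `(c, d)`, where `q = Q'` and `w = W'`: it is a
balanced function of locally bounded variation on `(c, d)`, and the two sides of the equation, which
are distributions of order `0`, i.e. complex measures on compact subintervals of `(c, d)`, agree on
all Borel sets with compact closure in `(c, d)`. Values of `u` outside `(c, d)` are irrelevant. -/
structure IsSolution (J : Matrix (Fin n) (Fin n) ℂ) (Q W : ℝ → Matrix (Fin n) (Fin n) ℂ) (μ : ℂ)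
    (c d : EReal) (u : ℝ → Fin n → ℂ) : Prop where
  locallyBoundedVariation : ∀ i, LocallyBoundedVariationOn (fun t => u t i) (openInterval c d)
  balanced : ∀ t ∈ openInterval c d, ∀ i,
    u t i = (Function.rightLim (fun r => u r i) t + Function.leftLim (fun r => u r i) t) / 2
  equation : ∀ s ∈ openInterval c d, ∀ t ∈ openInterval c d,
    ∀ E : Set ℝ, MeasurableSet E → E ⊆ Set.Ioo s t → ∀ i,
      ∑ j, J i j * stieltjes (fun r => u r j) s t E
        + ∑ j, (stieltjesIntegral (fun r => u r j) (fun r => Q r i j) s t E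
            - μ * stieltjesIntegral (fun r => u r j) (fun r => W r i j) s t E) = 0

/-- For a partition `a = x₀ < x₁ < ⋯ < x_N < x_{N+1} = b` (with `x₁, …, x_N` listed by `x`), the
left endpoints `x₀, …, x_N` of the subintervals. -/
def leftEnd (a : EReal) (x : Fin N → ℝ) : Fin (N + 1) → EReal :=
  Fin.cons (α := fun _ => EReal) a fun j => (x j : EReal)

/-- The right endpoints `x₁, …, x_{N+1}` of the subintervals of the partition. -/
def rightEnd (b : EReal) (x : Fin N → ℝ) : Fin (N + 1) → EReal :=
  Fin.snoc (α := fun _ => EReal) (fun j => (x j : EReal)) b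

/-- `U₀, …, U_N` are the fundamental matrices of balanced solutions on the subintervals
`(x_k, x_{k+1})`, normalized by `U_k(t) → 1` as `t ↓ x_k`. -/
def IsFundamentalSystem (J : Matrix (Fin n) (Fin n) ℂ) (Q W : ℝ → Matrix (Fin n) (Fin n) ℂ) (μ : ℂ)
    (a b : EReal) (x : Fin N → ℝ) (U : Fin (N + 1) → ℝ → Matrix (Fin n) (Fin n) ℂ) : Prop :=
  ∀ k, (∀ l, IsSolution J Q W μ (leftEnd a x k) (rightEnd b x k) fun t i => U k t i l) ∧
    Tendsto (U k) (downTo (leftEnd a x k)) (𝓝 1)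

/-- For `j = 1, …, N`, the matrix `U_{j-1}(x_j) = lim_{t ↑ x_j} U_{j-1}(t)`. -/
def transfer (x : Fin N → ℝ) (U : Fin (N + 1) → ℝ → Matrix (Fin n) (Fin n) ℂ) (j : Fin N) :
    Matrix (Fin n) (Fin n) ℂ :=
  Matrix.of fun i l => Function.leftLim (fun t => U j.castSucc t i l) (x j)

/-- The `nN × n(N+1)` matrix `𝔹(μ)` with the `N × (N+1)` blocks `-B₋(x_j, μ) U_{j-1}(x_j)` in
position `(j, j-1)` and `B₊(x_j, μ)` in position `(j, j)`, and zero blocks elsewhere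
(`j = 1, …, N`, block columns numbered `0, …, N`). -/
def blockB (J : Matrix (Fin n) (Fin n) ℂ) (Q W : ℝ → Matrix (Fin n) (Fin n) ℂ) (μ : ℂ)
    (x : Fin N → ℝ) (U : Fin (N + 1) → ℝ → Matrix (Fin n) (Fin n) ℂ) :
    Matrix (Fin N × Fin n) (Fin (N + 1) × Fin n) ℂ :=
  Matrix.of fun p c =>
    if c.1 = p.1.castSucc then (-(Bminus J Q W (x p.1) μ * transfer x U p.1)) p.2 c.2
    else if c.1 = p.1.succ then Bplus J Q W (x p.1) μ p.2 c.2
    else 0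

/-- The matrix `𝔹_m(μ)`, obtained from `𝔹(μ)` by deleting the first and the last `n` columns. -/
def blockBm (J : Matrix (Fin n) (Fin n) ℂ) (Q W : ℝ → Matrix (Fin n) (Fin n) ℂ) (μ : ℂ)
    (x : Fin N → ℝ) (U : Fin (N + 1) → ℝ → Matrix (Fin n) (Fin n) ℂ) :
    Matrix (Fin N × Fin n) ({k : Fin (N + 1) // k ≠ 0 ∧ k ≠ Fin.last N} × Fin n) ℂ :=
  (blockB J Q W μ x U).submatrix id fun c => (c.1.1, c.2)

/-- `ker A*`. -/
def kerAdjoint {α β : Type*} [Fintype α] (A : Matrix α β ℂ) : Submodule ℂ (α → ℂ) :=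
  LinearMap.ker A.conjTranspose.mulVecLin

/-- `û = (u(x₁), …, u(x_N))` as a vector in `ℂ^{nN}`. -/
def hat (x : Fin N → ℝ) (u : ℝ → Fin n → ℂ) : Fin N × Fin n → ℂ := fun p => u (x p.1) p.2

/-- `u⁺(a) = u⁻(b) = 0`. -/
def VanishesAtEnds (a b : EReal) (u : ℝ → Fin n → ℂ) : Prop :=
  Tendsto u (downTo a) (𝓝 0) ∧ Tendsto u (upTo b) (𝓝 0)

/-- The restriction of `u` to `(a, b)` has compact support in `(a, b)`. -/
def CompactlySupported (a b : EReal) (u : ℝ → Fin n → ℂ) : Prop :=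
  ∃ K : Set ℝ, IsCompact K ∧ K ⊆ openInterval a b ∧ ∀ t ∈ openInterval a b, t ∉ K → u t = 0

end

end FirstOrderSystem

namespace FirstOrderSystem

open Set Function

/-! ### Open intervals with extended real ends, and the filters at the ends -/

section Intervals

/-! Regularity of both ends makes all entries of `Q` and `W` of bounded variation on the whole of
(a, b). They therefore have integrable densities `ρQ`, `ρW` with respect to one finite measure ν,
and these can be chosen Hermitian at every point. With A = -J⁻¹(ρQ - μ ρW) the equation becomes du =
A u dν, to be read with balanced values. At a point this says J u⁻ = B₊ u and J u⁺ = B₋ u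
(`bplus_mulVec`, `bminus_mulVec`), so the value u(x_j) alone fixes both one-sided limits at x_j,
even where B₊ or B₋ is singular.

On an interval without bad points, u is recovered from u⁻, and u⁻ solves a linear Volterra equation
with finite total mass. Its Neumann series converges (`exists_volterra_solution`), which yields
solutions with a prescribed limit at the left end and with a limit at the right end
(`exists_isSolution`).

The second tool is Lagrange's identity: if y solves the equation for the conjugate of λ and u solves
it for λ, then y* J u, formed with left limits, is constant (`dotProduct_leftVal_eq`). Paired with a
solution matrix Z for λ it gives U_k* J Z = J, so U_k is invertible. Hence the bracket U_k* J u is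
one constant vector on each interval of the partition, it determines u there, and it can be
evaluated at either end. From x_k on the left it is B₋(x_k, λ) u(x_k) (`bracket_eq_incoming`), from
x_{k+1} on the right it is U_k(x_{k+1})* B₊(x_{k+1}, λ) u(x_{k+1}) (`bracket_eq_outgoing`).

Since B_±(x, λ̄)* = -B_∓(x, λ), the k-th block of 𝔹(λ̄)* û is precisely the difference of these two
expressions. For the inner intervals its vanishing is the consistency of u(x_k) and u(x_{k+1}). In
the blocks of the first and the last interval one of the two expressions is absent, and vanishing of
the other means that u is zero on that interval, which is the condition u⁺(a) = 0 or u⁻(b) = 0 and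
also the statement about supports. Conversely, given v in the kernel, one solves on each interval
from the left limit dictated by v; the kernel condition makes the right limits fit, and the pieces
glue (`isSolution_glue`). -/

theorem isOpen_openInterval (c d : EReal) : IsOpen (openInterval c d) :=
  isOpen_Ioo.preimage continuous_coe_real_ereal

theorem measurableSet_openInterval (c d : EReal) : MeasurableSet (openInterval c d) :=
  (isOpen_openInterval c d).measurableSet

theorem ordConnected_openInterval (c d : EReal) : (openInterval c d).OrdConnected := by
  refine ⟨fun s hs t ht r hr => ⟨hs.1.trans_le ?_, lt_of_le_of_lt ?_ ht.2⟩⟩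
  · exact_mod_cast hr.1
  · exact_mod_cast hr.2

theorem Icc_subset_openInterval {c d : EReal} {s t : ℝ} (hs : s ∈ openInterval c d)
    (ht : t ∈ openInterval c d) : Icc s t ⊆ openInterval c d :=
  (ordConnected_openInterval c d).out hs ht

theorem exists_lt_mem_openInterval {c d : EReal} {t : ℝ} (ht : t ∈ openInterval c d) :
    ∃ s ∈ openInterval c d, s < t := by
  obtain ⟨s, hs, hst⟩ := EReal.lt_iff_exists_real_btwn.1 ht.1
  exact ⟨s, ⟨hs, hst.trans ht.2⟩, by exact_mod_cast hst⟩

theorem exists_gt_mem_openInterval {c d : EReal} {t : ℝ} (ht : t ∈ openInterval c d) :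
    ∃ s ∈ openInterval c d, t < s := by
  obtain ⟨s, hs, hst⟩ := EReal.lt_iff_exists_real_btwn.1 ht.2
  exact ⟨s, ⟨ht.1.trans hs, hst⟩, by exact_mod_cast hs⟩

theorem openInterval_subset_openInterval {c d c' d' : EReal} (hc : c' ≤ c) (hd : d ≤ d') :
    openInterval c d ⊆ openInterval c' d' :=
  fun _ ht => ⟨hc.trans_lt ht.1, ht.2.trans_le hd⟩

theorem openInterval_nonempty {c d : EReal} (h : c < d) : (openInterval c d).Nonempty :=
  let ⟨s, hs, hs'⟩ := EReal.lt_iff_exists_real_btwn.1 h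
  ⟨s, hs, hs'⟩

theorem eventually_downTo {c d : EReal} (h : c < d) {P : ℝ → Prop} :
    (∀ᶠ t in downTo c, P t) ↔ ∃ e ∈ openInterval c d, ∀ t ∈ openInterval c e, P t := by
  rw [downTo, eventually_comap]
  have hb := nhdsGT_basis_of_exists_gt (a := c) ⟨d, h⟩
  rw [hb.eventually_iff]
  constructor
  · rintro ⟨e, he, H⟩
    obtain ⟨r, hr, hr'⟩ := EReal.lt_iff_exists_real_btwn.1 (lt_min he h)
    exact ⟨r, ⟨hr, hr'.trans_le (min_le_right _ _)⟩, fun t ht =>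
      H ⟨ht.1, ht.2.trans (hr'.trans_le (min_le_left _ _))⟩ t rfl⟩
  · rintro ⟨e, he, H⟩
    refine ⟨e, he.1, ?_⟩
    rintro _ hx t rfl
    exact H t hx

theorem eventually_upTo {c d : EReal} (h : c < d) {P : ℝ → Prop} :
    (∀ᶠ t in upTo d, P t) ↔ ∃ e ∈ openInterval c d, ∀ t ∈ openInterval e d, P t := by
  rw [upTo, eventually_comap]
  have hb := nhdsLT_basis_of_exists_lt (a := d) ⟨c, h⟩
  rw [hb.eventually_iff]
  constructor
  · rintro ⟨e, he, H⟩
    obtain ⟨r, hr, hr'⟩ := EReal.lt_iff_exists_real_btwn.1 (max_lt he h)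
    exact ⟨r, ⟨(le_max_right _ _).trans_lt hr, hr'⟩, fun t ht =>
      H ⟨((le_max_left _ _).trans_lt hr).trans ht.1, ht.2⟩ t rfl⟩
  · rintro ⟨e, he, H⟩
    refine ⟨e, he.2, ?_⟩
    rintro _ hx t rfl
    exact H t hx

theorem eventually_mem_downTo {c d : EReal} (h : c < d) : ∀ᶠ t in downTo c, t ∈ openInterval c d :=
  (eventually_downTo h).2
    ((openInterval_nonempty h).imp fun _ he => ⟨he, openInterval_subset_openInterval le_rfl he.2.le⟩)

theorem eventually_mem_upTo {c d : EReal} (h : c < d) : ∀ᶠ t in upTo d, t ∈ openInterval c d :=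
  (eventually_upTo h).2
    ((openInterval_nonempty h).imp fun _ he => ⟨he, openInterval_subset_openInterval he.1.le le_rfl⟩)

theorem downTo_neBot {c d : EReal} (h : c < d) : (downTo c).NeBot := by
  refine ⟨fun hbot => ?_⟩
  have : ∀ᶠ t in downTo c, False := by rw [hbot]; exact eventually_bot
  obtain ⟨e, he, H⟩ := (eventually_downTo h).1 this
  obtain ⟨t, ht⟩ := openInterval_nonempty he.1
  exact H t ht

theorem upTo_neBot {c d : EReal} (h : c < d) : (upTo d).NeBot := by
  refine ⟨fun hbot => ?_⟩
  have : ∀ᶠ t in upTo d, False := by rw [hbot]; exact eventually_bot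
  obtain ⟨e, he, H⟩ := (eventually_upTo h).1 this
  obtain ⟨t, ht⟩ := openInterval_nonempty he.2
  exact H t ht

instance (c : EReal) : (downTo c).IsCountablyGenerated := by unfold downTo; infer_instance

instance (c : EReal) : (upTo c).IsCountablyGenerated := by unfold upTo; infer_instance

theorem downTo_coe (t : ℝ) : downTo t = 𝓝[>] t := by
  have h := EReal.isOpenEmbedding_coe
  rw [downTo, nhdsWithin, comap_inf, comap_principal, ← h.isInducing.nhds_eq_comap, nhdsWithin]
  congr 2
  ext r
  simp

theorem upTo_coe (t : ℝ) : upTo t = 𝓝[<] t := by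
  have h := EReal.isOpenEmbedding_coe
  rw [upTo, nhdsWithin, comap_inf, comap_principal, ← h.isInducing.nhds_eq_comap, nhdsWithin]
  congr 2
  ext r
  simp

end Intervals

/-! ### One-sided limits of functions of bounded variation -/

section OneSidedLimits

variable {E : Type*} [TopologicalSpace E] [T2Space E]

/-- Existence of the limit has to be assumed: without it `leftLim` is the value at t, which f and g
need not share. -/
theorem leftLim_congr {f g : ℝ → E} {t : ℝ} (hf : Tendsto f (𝓝[<] t) (𝓝 (leftLim f t)))
    (h : f =ᶠ[𝓝[<] t] g) : leftLim g t = leftLim f t :=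
  leftLim_eq_of_tendsto (hf.congr' h)

theorem rightLim_congr {f g : ℝ → E} {t : ℝ} (hf : Tendsto f (𝓝[>] t) (𝓝 (rightLim f t)))
    (h : f =ᶠ[𝓝[>] t] g) : rightLim g t = rightLim f t :=
  rightLim_eq_of_tendsto (hf.congr' h)

variable {f : ℝ → ℂ}

theorem _root_.BoundedVariationOn.tendsto_leftLim_of_mem {s t r : ℝ}
    (hf : BoundedVariationOn f (Icc s t)) (hr : r ∈ Ioc s t) :
    Tendsto f (𝓝[<] r) (𝓝 (leftLim f r)) := by
  apply tendsto_leftLim_of_tendsto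
  obtain ⟨l, hl⟩ := hf.exists_tendsto_left r
  refine ⟨l, hl.mono_left (nhdsWithin_le_iff.2 ?_)⟩
  filter_upwards [Ioo_mem_nhdsLT hr.1] with x hx using ⟨⟨hx.1.le, hx.2.le.trans hr.2⟩, hx.2⟩

theorem _root_.BoundedVariationOn.tendsto_rightLim_of_mem {s t r : ℝ}
    (hf : BoundedVariationOn f (Icc s t)) (hr : r ∈ Ico s t) :
    Tendsto f (𝓝[>] r) (𝓝 (rightLim f r)) := by
  apply tendsto_rightLim_of_tendsto
  obtain ⟨l, hl⟩ := hf.exists_tendsto_right r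
  refine ⟨l, hl.mono_left (nhdsWithin_le_iff.2 ?_)⟩
  filter_upwards [Ioo_mem_nhdsGT hr.2] with x hx using ⟨⟨hr.1.trans hx.1.le, hx.2.le⟩, hx.1⟩

theorem _root_.LocallyBoundedVariationOn.boundedVariationOn_Icc {c d : EReal} {s t : ℝ}
    (hf : LocallyBoundedVariationOn f (openInterval c d)) (hs : s ∈ openInterval c d)
    (ht : t ∈ openInterval c d) : BoundedVariationOn f (Icc s t) := by
  have := hf s t hs ht
  rwa [inter_eq_self_of_subset_right (Icc_subset_openInterval hs ht)] at this

theorem _root_.LocallyBoundedVariationOn.tendsto_leftLim {c d : EReal} {t : ℝ}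
    (hf : LocallyBoundedVariationOn f (openInterval c d)) (ht : t ∈ openInterval c d) :
    Tendsto f (𝓝[<] t) (𝓝 (leftLim f t)) := by
  obtain ⟨s, hs, hst⟩ := exists_lt_mem_openInterval ht
  exact (hf.boundedVariationOn_Icc hs ht).tendsto_leftLim_of_mem ⟨hst, le_rfl⟩

theorem _root_.LocallyBoundedVariationOn.tendsto_rightLim {c d : EReal} {t : ℝ}
    (hf : LocallyBoundedVariationOn f (openInterval c d)) (ht : t ∈ openInterval c d) :
    Tendsto f (𝓝[>] t) (𝓝 (rightLim f t)) := by
  obtain ⟨s, hs, hst⟩ := exists_gt_mem_openInterval ht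
  exact (hf.boundedVariationOn_Icc ht hs).tendsto_rightLim_of_mem ⟨le_rfl, hst⟩

end OneSidedLimits

/-! ### Stieltjes measures on a compact interval -/

section Stieltjes

variable {f : ℝ → ℂ} {s t : ℝ}

theorem boundedVariationOn_clamp (hst : s ≤ t) (hf : BoundedVariationOn f (Icc s t)) :
    BoundedVariationOn (fun r => f (max s (min t r))) univ := by
  refine ne_top_of_le_ne_top hf
    (eVariationOn.comp_le_of_monotoneOn f (fun r => max s (min t r)) ?_ ?_)
  · intro x _ y _ hxy
    exact max_le_max le_rfl (min_le_min le_rfl hxy)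
  · intro x _
    exact ⟨le_max_left _ _, max_le hst (min_le_left _ _)⟩

theorem leftLim_clamp (hf : BoundedVariationOn f (Icc s t)) {r : ℝ} (hr : r ∈ Ioc s t) :
    leftLim (fun r => f (max s (min t r))) r = leftLim f r := by
  refine leftLim_congr (hf.tendsto_leftLim_of_mem hr) ?_
  filter_upwards [Ioo_mem_nhdsLT hr.1] with x hx
  rw [min_eq_right (hx.2.le.trans hr.2), max_eq_right hx.1.le]

theorem rightLim_clamp (hf : BoundedVariationOn f (Icc s t)) {r : ℝ} (hr : r ∈ Ico s t) :
    rightLim (fun r => f (max s (min t r))) r = rightLim f r := by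
  refine rightLim_congr (hf.tendsto_rightLim_of_mem hr) ?_
  filter_upwards [Ioo_mem_nhdsGT hr.2] with x hx
  rw [min_eq_right hx.2.le, max_eq_right (hr.1.trans hx.1.le)]

theorem stieltjes_Ioo (hf : BoundedVariationOn f (Icc s t)) {α β : ℝ} (hα : s ≤ α) (hαβ : α < β)
    (hβ : β ≤ t) : stieltjes f s t (Ioo α β) = leftLim f β - rightLim f α := by
  have h := boundedVariationOn_clamp (hα.trans (hαβ.le.trans hβ)) hf
  rw [stieltjes, dif_pos h, h.vectorMeasure_Ioo hαβ, leftLim_clamp hf ⟨hα.trans_lt hαβ, hβ⟩,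
    rightLim_clamp hf ⟨hα, hαβ.trans_le hβ⟩]

theorem stieltjes_Ico (hf : BoundedVariationOn f (Icc s t)) {α β : ℝ} (hα : s < α) (hαβ : α ≤ β)
    (hβ : β ≤ t) : stieltjes f s t (Ico α β) = leftLim f β - leftLim f α := by
  have h := boundedVariationOn_clamp (hα.le.trans (hαβ.trans hβ)) hf
  rw [stieltjes, dif_pos h, h.vectorMeasure_Ico hαβ, leftLim_clamp hf ⟨hα.trans_le hαβ, hβ⟩,
    leftLim_clamp hf ⟨hα, hαβ.trans hβ⟩]

theorem stieltjes_singleton (hf : BoundedVariationOn f (Icc s t)) {r : ℝ} (hr : r ∈ Ioo s t) :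
    stieltjes f s t {r} = rightLim f r - leftLim f r := by
  have h := boundedVariationOn_clamp (hr.1.le.trans hr.2.le) hf
  rw [stieltjes, dif_pos h, h.vectorMeasure_singleton, leftLim_clamp hf ⟨hr.1, hr.2.le⟩,
    rightLim_clamp hf ⟨hr.1.le, hr.2⟩]

/-- Both sides are complex measures on (s, t), and `H` says that they agree on the traces of the
half-lines `Iio β`, a π-system that generates the Borel sets. -/
theorem stieltjes_eq_setIntegral {ν : Measure ℝ} {h : ℝ → ℂ}
    (hf : BoundedVariationOn f (Icc s t)) (hh : IntegrableOn h (Ioo s t) ν)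
    (H : ∀ β ∈ Ioc s t, leftLim f β - rightLim f s = ∫ x in Ioo s β, h x ∂ν)
    {E : Set ℝ} (hE : MeasurableSet E) (hEst : E ⊆ Ioo s t) :
    stieltjes f s t E = ∫ x in E, h x ∂ν := by
  rcases le_or_gt t s with hts | hst
  · have : E = ∅ := by
      rw [Ioo_eq_empty hts.not_gt] at hEst
      exact subset_empty_iff.1 hEst
    simp [this]
  have key : (stieltjes f s t).restrict (Ioo s t) = (ν.restrict (Ioo s t)).withDensityᵥ h := by
    have hIoo : ∀ β, ((stieltjes f s t).restrict (Ioo s t)) (Iio β)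
        = ((ν.restrict (Ioo s t)).withDensityᵥ h) (Iio β) := by
      intro β
      rw [VectorMeasure.restrict_apply _ measurableSet_Ioo measurableSet_Iio,
        withDensityᵥ_apply hh measurableSet_Iio, Measure.restrict_restrict measurableSet_Iio]
      have hset : Iio β ∩ Ioo s t = Ioo s (min t β) := by
        ext r; simp only [mem_inter_iff, mem_Iio, mem_Ioo, lt_min_iff]; tauto
      rw [hset]
      rcases le_or_gt β s with hβ | hβ
      · rw [Ioo_eq_empty (by simp [hβ])]; simp
      · rw [stieltjes_Ioo hf le_rfl (lt_min hst hβ) (min_le_left _ _),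
          H _ ⟨lt_min hst hβ, min_le_left _ _⟩]
    refine VectorMeasure.ext_of_generateFrom (range Iio) (forall_mem_range.2 hIoo) ?_
      isPiSystem_Iio ?_
    · rw [BorelSpace.measurable_eq (α := ℝ)]
      exact borel_eq_generateFrom_Iio ℝ
    -- The π-system argument also needs equal total masses; β = t supplies this because (s, t) lies
    -- in `Iio t`.
    · have h1 := hIoo t
      rw [VectorMeasure.restrict_apply _ measurableSet_Ioo measurableSet_Iio,
        withDensityᵥ_apply hh measurableSet_Iio, Measure.restrict_restrict measurableSet_Iio] at h1
      rw [VectorMeasure.restrict_apply _ measurableSet_Ioo MeasurableSet.univ,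
        withDensityᵥ_apply hh MeasurableSet.univ, Measure.restrict_univ, univ_inter]
      rwa [inter_eq_self_of_subset_right Ioo_subset_Iio_self] at h1
  have h1 := congrArg (fun m : VectorMeasure ℝ ℂ => m E) key
  beta_reduce at h1
  rwa [VectorMeasure.restrict_apply _ measurableSet_Ioo hE, withDensityᵥ_apply hh hE,
    Measure.restrict_restrict hE, inter_eq_self_of_subset_left hEst] at h1

end Stieltjes

/-! ### Integration against a complex measure with a density -/

section DensityIntegral

variable {ν : Measure ℝ} {ρ g : ℝ → ℂ}

/-- The vector integral is continuous in the L¹ norm of the variation |ρ|ν. Writing ρ = σ|ρ| with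
|σ| ≤ 1 shows that the right side is continuous in the same norm, so that it suffices to compare
both sides on indicator functions. -/
theorem integral_withDensityᵥ_mul (hρ : Integrable ρ ν) (hρm : Measurable ρ)
    (hg : Integrable g (ν.withDensityᵥ ρ).variation) :
    (ν.withDensityᵥ ρ).integral g (ContinuousLinearMap.mul ℝ ℂ) = ∫ x, g x * ρ x ∂ν := by
  -- The phase of ρ; the convention 0⁻¹ = 0 makes it zero where ρ vanishes.
  set σ : ℝ → ℂ := fun x => (‖ρ x‖⁻¹ : ℝ) * ρ x with hσ
  have hσm : Measurable σ := by fun_prop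
  have hσb : ∀ x, ‖σ x‖ ≤ 1 := by
    intro x
    simp only [hσ, norm_mul, Complex.norm_real, norm_inv, norm_norm]
    exact inv_mul_le_one
  set m := (ν.withDensityᵥ ρ).variation with hm
  have hm' : m = ν.withDensity (fun x => (‖ρ x‖₊ : ENNReal)) := Measure.variation_withDensityᵥ hρ
  have hint : ∀ {h : ℝ → ℂ}, Integrable h m → Integrable (fun x => h x * σ x) m := fun hh =>
    hh.mul_bdd (c := 1) hσm.aestronglyMeasurable (Eventually.of_forall hσb)
  have conv : ∀ h : ℝ → ℂ, ∫ x, h x * ρ x ∂ν = ∫ x, h x * σ x ∂m := by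
    intro h
    rw [hm', integral_withDensity_eq_integral_smul₀ hρm.nnnorm.aemeasurable]
    refine integral_congr_ae (Eventually.of_forall fun x => ?_)
    simp only [hσ, NNReal.smul_def, coe_nnnorm, Complex.real_smul]
    rcases eq_or_ne (ρ x) 0 with h0 | h0
    · simp [h0]
    · have : (‖ρ x‖ : ℂ) ≠ 0 := by simpa using h0
      push_cast
      field_simp
  rw [conv]
  refine Integrable.induction (P := fun g => (ν.withDensityᵥ ρ).integral g
    (ContinuousLinearMap.mul ℝ ℂ) = ∫ x, g x * σ x ∂m) ?_ ?_ ?_ ?_ hg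
  · intro c s hs hs'
    have : IsFiniteMeasure ((ν.withDensityᵥ ρ).variation.restrict s) :=
      ⟨by rwa [Measure.restrict_apply_univ]⟩
    rw [← conv, VectorMeasure.integral_indicator_const _ hs, withDensityᵥ_apply hρ hs,
      ContinuousLinearMap.mul_apply', ← integral_const_mul, ← integral_indicator hs]
    refine integral_congr_ae (Eventually.of_forall fun x => ?_)
    by_cases hx : x ∈ s <;> simp [hx]
  · intro f h _ hf hh ihf ihh
    rw [VectorMeasure.integral_add hf hh]
    simp only [Pi.add_apply, add_mul]
    rw [integral_add (hint hf) (hint hh), ihf, ihh]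
  · refine isClosed_eq VectorMeasure.continuous_integral ?_
    refine (LipschitzWith.of_dist_le_mul (K := 1) fun f h => ?_).continuous
    have hf := hint (L1.integrable_coeFn f)
    have hh := hint (L1.integrable_coeFn h)
    rw [dist_eq_norm, ← integral_sub hf hh, NNReal.coe_one, one_mul, dist_eq_norm,
      L1.norm_eq_integral_norm]
    refine norm_integral_le_of_norm_le (L1.integrable_coeFn (f - h)).norm ?_
    filter_upwards [Lp.coeFn_sub f h] with x hx
    rw [hx, Pi.sub_apply, ← sub_mul, norm_mul]
    exact mul_le_of_le_one_right (norm_nonneg _) (hσb x)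
  · intro f h hfh hf ih
    rw [← VectorMeasure.integral_congr_ae hfh, ih]
    refine integral_congr_ae ?_
    filter_upwards [hfh] with x hx
    rw [hx]

theorem integrable_variation_withDensityᵥ (hρ : Integrable ρ ν) (hρm : Measurable ρ) {C : ℝ}
    (hg : AEStronglyMeasurable g ν) (hgC : ∀ᵐ x ∂ν, ‖g x‖ ≤ C) :
    Integrable g (ν.withDensityᵥ ρ).variation := by
  rw [Measure.variation_withDensityᵥ hρ]
  refine (integrable_withDensity_iff_integrable_smul₀ hρm.nnnorm.aemeasurable).2 ?_
  exact hρ.norm.smul_bdd C hg hgC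

theorem stieltjesIntegral_eq {f : ℝ → ℂ} {s t C : ℝ} {E : Set ℝ}
    (hf : BoundedVariationOn f (Icc s t)) (hρ : Integrable ρ ν) (hρm : Measurable ρ)
    (H : ∀ β ∈ Ioc s t, leftLim f β - rightLim f s = ∫ x in Ioo s β, ρ x ∂ν)
    (hE : MeasurableSet E) (hEst : E ⊆ Ioo s t)
    (hg : AEStronglyMeasurable g (ν.restrict E)) (hgC : ∀ x ∈ E, ‖g x‖ ≤ C) :
    stieltjesIntegral g f s t E = ∫ x in E, g x * ρ x ∂ν := by
  have hm : (stieltjes f s t).restrict E = (ν.restrict E).withDensityᵥ ρ := by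
    ext A hA : 1
    rw [VectorMeasure.restrict_apply _ hE hA, withDensityᵥ_apply hρ.integrableOn hA,
      Measure.restrict_restrict hA]
    exact stieltjes_eq_setIntegral hf hρ.integrableOn H (hA.inter hE)
      (inter_subset_right.trans hEst)
  rw [stieltjesIntegral, hm]
  refine integral_withDensityᵥ_mul hρ.integrableOn hρm
    (integrable_variation_withDensityᵥ (C := C) hρ.integrableOn hρm hg ?_)
  filter_upwards [ae_restrict_mem hE] with x hx using hgC x hx

end DensityIntegral

/-! ### Measurability and boundedness of functions of bounded variation -/

section Measurability

variable {f : ℝ → ℂ} {s t : ℝ}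

/-- Real and imaginary part are differences of monotone functions. -/
theorem _root_.BoundedVariationOn.measurable (hf : BoundedVariationOn f univ) : Measurable f := by
  have key : ∀ L : ℂ →L[ℝ] ℝ, Measurable (fun x => L (f x)) := by
    intro L
    have h1 : BoundedVariationOn (L ∘ f) univ := L.lipschitz.comp_boundedVariationOn hf
    obtain ⟨p, q, hp, hq, hpq⟩ :=
      h1.locallyBoundedVariationOn.exists_monotoneOn_sub_monotoneOn
    have : (fun x => L (f x)) = p - q := hpq
    rw [this]
    exact (monotoneOn_univ.1 hp).measurable.sub (monotoneOn_univ.1 hq).measurable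
  have h2 := (Complex.measurable_ofReal.comp (key Complex.reCLM)).add
    ((Complex.measurable_ofReal.comp (key Complex.imCLM)).mul_const Complex.I)
  convert h2 using 1
  ext x
  simp

theorem _root_.BoundedVariationOn.aestronglyMeasurable (ν : Measure ℝ)
    (hf : BoundedVariationOn f (Icc s t)) : AEStronglyMeasurable f (ν.restrict (Icc s t)) := by
  rcases le_or_gt s t with hst | hst
  · refine ⟨_, (boundedVariationOn_clamp hst hf).measurable.stronglyMeasurable, ?_⟩
    filter_upwards [ae_restrict_mem measurableSet_Icc] with x hx
    rw [min_eq_right hx.2, max_eq_right hx.1]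
  · simp [Icc_eq_empty hst.not_ge]

theorem _root_.BoundedVariationOn.exists_norm_le (hf : BoundedVariationOn f (Icc s t)) :
    ∃ C, ∀ x ∈ Icc s t, ‖f x‖ ≤ C := by
  refine ⟨‖f s‖ + (eVariationOn f (Icc s t)).toReal, fun x hx => ?_⟩
  have := hf.dist_le hx (left_mem_Icc.2 (hx.1.trans hx.2))
  rw [dist_eq_norm] at this
  calc ‖f x‖ = ‖f s + (f x - f s)‖ := by congr 1; ring
    _ ≤ _ := (norm_add_le _ _).trans (by gcongr)

end Measurability

/-! ### A common finite measure and Hermitian densities for the coefficients -/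

section Density

/-- `ρ` is a density of the Stieltjes measure `df` on the open interval `I` with respect to `ν`. -/
structure IsDensity (ν : Measure ℝ) (I : Set ℝ) (f ρ : ℝ → ℂ) : Prop where
  boundedVariation : BoundedVariationOn f I
  measurable : Measurable ρ
  integrable : Integrable ρ ν
  increment : ∀ α ∈ I, ∀ β ∈ I, α < β → leftLim f β - rightLim f α = ∫ x in Ioo α β, ρ x ∂ν

/-- Bounded variation forces limits at c and d, finite or not, and f is extended by these constants.
The extension is the pointwise limit of r ↦ f(max p (min q r)) as p ↓ c and q ↑ d. Each of these has
at most the variation of f, and the variation is lower semicontinuous. The point is to have one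
finite Stieltjes measure for the whole interval. -/
theorem exists_boundedVariationOn_extension {c d : EReal} (hcd : c < d) {f : ℝ → ℂ}
    (hf : BoundedVariationOn f (openInterval c d)) :
    ∃ g : ℝ → ℂ, EqOn g f (openInterval c d) ∧ BoundedVariationOn g univ := by
  have hne := openInterval_nonempty hcd
  obtain ⟨l, hl⟩ := hf.exists_tendsto_left_of_filter (upTo d) (fun y hy => by
    filter_upwards [eventually_mem_upTo hcd, (eventually_upTo hcd).2 ⟨y, hy, fun t ht => ht⟩]
      with t ht ht'
    refine ⟨ht, ?_⟩
    exact_mod_cast ht'.1.le) hne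
  -- The limit at the lower end is the limit at the upper end for the reversed order.
  obtain ⟨k, hk⟩ := BoundedVariationOn.exists_tendsto_left_of_filter (α := ℝᵒᵈ)
      (f := f ∘ OrderDual.ofDual) (s := OrderDual.ofDual ⁻¹' openInterval c d) hf.ofDual (downTo c)
      (fun y hy => by
    filter_upwards [eventually_mem_downTo hcd, (eventually_downTo hcd).2 ⟨y, hy, fun t ht => ht⟩]
      with t ht ht'
    have hty : @LE.le ℝ _ t y := EReal.coe_le_coe_iff.1 ht'.2.le
    exact ⟨ht, hty⟩) hne
  replace hk : Tendsto f (downTo c) (𝓝 k) := hk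
  classical
  let g : ℝ → ℂ := fun r => if r ∈ openInterval c d then f r else if (r : EReal) ≤ c then k else l
  have hgf : EqOn g f (openInterval c d) := fun r hr => if_pos hr
  refine ⟨g, hgf, ?_⟩
  have hmem : ∀ᶠ p : ℝ × ℝ in downTo c ×ˢ upTo d,
      p.1 ∈ openInterval c d ∧ p.2 ∈ openInterval c d ∧ p.1 ≤ p.2 := by
    obtain ⟨e, he⟩ := hne
    have h1 := (eventually_downTo hcd).2 ⟨e, he, fun t ht => ht⟩
    have h2 := (eventually_upTo hcd).2 ⟨e, he, fun t ht => ht⟩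
    filter_upwards [h1.prod_mk h2] with p hp
    refine ⟨⟨hp.1.1, hp.1.2.trans he.2⟩, ⟨he.1.trans hp.2.1, hp.2.2⟩, ?_⟩
    exact_mod_cast (hp.1.2.trans hp.2.1).le
  have hlim : ∀ r ∈ (univ : Set ℝ), Tendsto (fun p : ℝ × ℝ => f (max p.1 (min p.2 r)))
      (downTo c ×ˢ upTo d) (𝓝 (g r)) := by
    intro r _
    by_cases hr : r ∈ openInterval c d
    · rw [hgf hr]
      have h1 := (eventually_downTo hcd).2 ⟨r, hr, fun t ht => ht⟩
      have h2 := (eventually_upTo hcd).2 ⟨r, hr, fun t ht => ht⟩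
      refine tendsto_const_nhds.congr' ?_
      filter_upwards [h1.prod_mk h2] with p hp
      have hp1 : p.1 < r := by exact_mod_cast hp.1.2
      have hp2 : r < p.2 := by exact_mod_cast hp.2.1
      rw [min_eq_right hp2.le, max_eq_right hp1.le]
    · by_cases hrc : (r : EReal) ≤ c
      · have hg : g r = k := by simp [g, hr, hrc]
        rw [hg]
        refine (hk.comp tendsto_fst).congr' ?_
        filter_upwards [hmem] with p hp
        have : r ≤ p.1 := by exact_mod_cast hrc.trans hp.1.1.le
        simp [max_eq_left ((min_le_right p.2 r).trans this)]
      · have hg : g r = l := by simp [g, hr, hrc]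
        rw [hg]
        refine (hl.comp tendsto_snd).congr' ?_
        filter_upwards [hmem] with p hp
        have hrd : d ≤ r := not_lt.1 fun h => hr ⟨not_le.1 hrc, h⟩
        have : p.2 ≤ r := by exact_mod_cast hp.2.1.2.le.trans hrd
        simp [min_eq_left this, max_eq_right hp.2.2]
  have : (downTo c).NeBot := downTo_neBot hcd
  have : (upTo d).NeBot := upTo_neBot hcd
  have hle : eVariationOn g univ ≤ eVariationOn f (openInterval c d) := by
    refine le_of_forall_lt fun v hv => ?_
    obtain ⟨p, hp, hp'⟩ := ((eVariationOn.lowerSemicontinuous_aux hlim hv).and hmem).exists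
    refine hp.trans_le (eVariationOn.comp_le_of_monotoneOn f (fun r => max p.1 (min p.2 r)) ?_ ?_)
    · intro x _ y _ hxy
      exact max_le_max le_rfl (min_le_min le_rfl hxy)
    · intro x _
      exact Icc_subset_openInterval hp'.1 hp'.2.1
        ⟨le_max_left _ _, max_le hp'.2.2 (min_le_left _ _)⟩
  exact ne_top_of_le_ne_top hf hle

/-- The Radon–Nikodym theorem for signed measures, applied to the real and the imaginary part. -/
theorem exists_rnDeriv (m : ComplexMeasure ℝ) (ν : Measure ℝ) [IsFiniteMeasure ν]
    (h : ∀ E, MeasurableSet E → ν E = 0 → m E = 0) :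
    ∃ ρ : ℝ → ℂ, Measurable ρ ∧ Integrable ρ ν ∧ ∀ E, MeasurableSet E → m E = ∫ x in E, ρ x ∂ν := by
  have key : ∀ s : SignedMeasure ℝ, (∀ E, MeasurableSet E → ν E = 0 → s E = 0) →
      ∀ E, MeasurableSet E → s E = ∫ x in E, s.rnDeriv ν x ∂ν := by
    intro s hs E hE
    have hac : s ≪ᵥ ν.toENNRealVectorMeasure := by
      refine VectorMeasure.AbsolutelyContinuous.mk fun A hA hA' => hs A hA ?_
      rwa [Measure.toENNRealVectorMeasure_apply_measurable hA] at hA'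
    have := (SignedMeasure.absolutelyContinuous_iff_withDensityᵥ_rnDeriv_eq s ν).1 hac
    conv_lhs => rw [← this]
    rw [withDensityᵥ_apply (SignedMeasure.integrable_rnDeriv s ν) hE]
  have hre := key (ComplexMeasure.re m) fun E hE hE' => by
    simp [ComplexMeasure.re, VectorMeasure.mapRangeₗ, h E hE hE']
  have him := key (ComplexMeasure.im m) fun E hE hE' => by
    simp [ComplexMeasure.im, VectorMeasure.mapRangeₗ, h E hE hE']
  have hrei := SignedMeasure.integrable_rnDeriv (ComplexMeasure.re m) ν
  have himi := SignedMeasure.integrable_rnDeriv (ComplexMeasure.im m) ν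
  refine ⟨fun x => ((ComplexMeasure.re m).rnDeriv ν x : ℂ)
    + (((ComplexMeasure.im m).rnDeriv ν x : ℝ) : ℂ) * Complex.I, ?_, ?_, ?_⟩
  · exact (Complex.measurable_ofReal.comp (SignedMeasure.measurable_rnDeriv _ _)).add
      ((Complex.measurable_ofReal.comp (SignedMeasure.measurable_rnDeriv _ _)).mul_const _)
  · exact hrei.ofReal.add (himi.ofReal.mul_const _)
  · intro E hE
    rw [integral_add hrei.integrableOn.ofReal (himi.integrableOn.ofReal.mul_const _),
      integral_mul_const, integral_complex_ofReal, integral_complex_ofReal, ← hre E hE,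
      ← him E hE]
    simp [ComplexMeasure.re, ComplexMeasure.im, VectorMeasure.mapRangeₗ]

/-- The sum of the total variations of the real and imaginary parts dominates all the Stieltjes
measures at once. -/
theorem exists_isDensity {ι : Type*} [Fintype ι] {c d : EReal} (hcd : c < d) (f : ι → ℝ → ℂ)
    (hf : ∀ k, BoundedVariationOn (f k) (openInterval c d)) :
    ∃ ν : Measure ℝ, IsFiniteMeasure ν ∧
      ∃ ρ : ι → ℝ → ℂ, ∀ k, IsDensity ν (openInterval c d) (f k) (ρ k) := by
  choose g hgf hg using fun k => exists_boundedVariationOn_extension hcd (hf k)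
  let m : ι → ComplexMeasure ℝ := fun k => (hg k).vectorMeasure
  let ν : Measure ℝ := ∑ k, ((ComplexMeasure.re (m k)).totalVariation
    + (ComplexMeasure.im (m k)).totalVariation)
  have hν : IsFiniteMeasure ν := by
    dsimp only [ν]
    infer_instance
  have hac : ∀ k E, MeasurableSet E → ν E = 0 → m k E = 0 := by
    intro k E hE h0
    have h1 : ∀ k, ((ComplexMeasure.re (m k)).totalVariation
      + (ComplexMeasure.im (m k)).totalVariation) E = 0 := by
      simpa [ν, Finset.sum_eq_zero_iff] using h0
    have h2 := h1 k
    rw [Measure.add_apply, add_eq_zero] at h2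
    have hr := SignedMeasure.enorm_le_totalVariation (ComplexMeasure.re (m k)) E
    have hi := SignedMeasure.enorm_le_totalVariation (ComplexMeasure.im (m k)) E
    rw [h2.1, nonpos_iff_eq_zero, enorm_eq_zero] at hr
    rw [h2.2, nonpos_iff_eq_zero, enorm_eq_zero] at hi
    exact Complex.ext hr hi
  choose ρ hρm hρi hρ using fun k => exists_rnDeriv (m k) ν (hac k)
  refine ⟨ν.restrict (openInterval c d), inferInstance, ρ,
    fun k => ⟨hf k, hρm k, (hρi k).restrict, ?_⟩⟩
  · intro α hα β hβ hαβ
    have hsub : Ioo α β ⊆ openInterval c d :=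
      Ioo_subset_Icc_self.trans (Icc_subset_openInterval hα hβ)
    rw [Measure.restrict_restrict measurableSet_Ioo, inter_eq_self_of_subset_left hsub,
      ← hρ k _ measurableSet_Ioo]
    have hI : ∀ t ∈ openInterval c d, f k =ᶠ[𝓝 t] g k := fun t ht => by
      filter_upwards [(isOpen_openInterval c d).mem_nhds ht] with x hx using (hgf k hx).symm
    have hloc := (hf k).locallyBoundedVariationOn
    rw [(hg k).vectorMeasure_Ioo hαβ,
      leftLim_congr (hloc.tendsto_leftLim hβ) ((hI β hβ).filter_mono nhdsWithin_le_nhds),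
      rightLim_congr (hloc.tendsto_rightLim hα) ((hI α hα).filter_mono nhdsWithin_le_nhds)]

/-- Variation is additive over adjacent pieces. The cuts p < c and q > e put the outer pieces inside
the two regular ends and leave a compact piece between them. -/
theorem boundedVariationOn_of_regular {a b : EReal} {f : ℝ → ℂ}
    (hf : LocallyBoundedVariationOn f (openInterval a b)) {c e : ℝ} (hc : c ∈ openInterval a b)
    (he : e ∈ openInterval a b) (hcf : BoundedVariationOn f (openInterval a c))
    (hef : BoundedVariationOn f (openInterval e b)) :
    BoundedVariationOn f (openInterval a b) := by
  obtain ⟨p, hp, hpc⟩ := exists_lt_mem_openInterval hc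
  obtain ⟨q, hq, hqe⟩ : ∃ q ∈ openInterval a b, max p e < q :=
    exists_gt_mem_openInterval (by rcases max_choice p e with h | h <;> rw [h] <;> assumption)
  rw [max_lt_iff] at hqe
  have hunion : openInterval a b = (openInterval a b ∩ Iic p) ∪ ((Icc p q) ∪
      (openInterval a b ∩ Ici q)) := by
    ext t
    constructor
    · intro ht
      rcases le_total t p with h | h
      · exact Or.inl ⟨ht, h⟩
      · rcases le_total t q with h' | h'
        · exact Or.inr (Or.inl ⟨h, h'⟩)
        · exact Or.inr (Or.inr ⟨ht, h'⟩)
    · rintro (h | h | h)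
      · exact h.1
      · exact Icc_subset_openInterval hp hq h
      · exact h.1
  have h1 : BoundedVariationOn f (openInterval a b ∩ Iic p) := hcf.mono fun t ht =>
    ⟨ht.1.1, by exact_mod_cast lt_of_le_of_lt ht.2 hpc⟩
  have h2 : BoundedVariationOn f (openInterval a b ∩ Ici q) := hef.mono fun t ht =>
    ⟨by exact_mod_cast lt_of_lt_of_le hqe.2 ht.2, ht.1.2⟩
  have h3 := hf.boundedVariationOn_Icc hp hq
  have e2 := eVariationOn.union f (isGreatest_Icc hqe.1.le)
    (t := openInterval a b ∩ Ici q) (x := q) ⟨⟨hq, mem_Ici.2 le_rfl⟩, fun t ht => ht.2⟩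
  have e1 := eVariationOn.union f (s := openInterval a b ∩ Iic p)
    (t := (Icc p q) ∪ (openInterval a b ∩ Ici q)) (x := p)
    ⟨⟨hp, mem_Iic.2 le_rfl⟩, fun t ht => ht.2⟩ ⟨Or.inl ⟨le_rfl, hqe.1.le⟩, fun t ht => by
      rcases ht with ht | ht
      · exact ht.1
      · exact hqe.1.le.trans ht.2⟩
  rw [BoundedVariationOn, hunion, e1, e2]
  exact ENNReal.add_ne_top.2 ⟨h1, ENNReal.add_ne_top.2 ⟨h3, h2⟩⟩

variable {n : ℕ}

/-- `ρ` is a Hermitian density of the matrix-valued Stieltjes measure `dF`. -/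
structure IsHermitianDensity (ν : Measure ℝ) (I : Set ℝ) (F ρ : ℝ → Matrix (Fin n) (Fin n) ℂ) :
    Prop where
  isDensity : ∀ i j, IsDensity ν I (fun t => F t i j) fun t => ρ t i j
  isHermitian : ∀ t, (ρ t).IsHermitian

open scoped ComplexOrder in
theorem NonnegDeriv.hermitianDeriv {a b : EReal} {F : ℝ → Matrix (Fin n) (Fin n) ℂ}
    (h : NonnegDeriv a b F) : HermitianDeriv a b F := by
  intro s hs t ht
  rcases le_total s t with hst | hst
  · exact (h s hs t ht hst).isHermitian
  · rw [← neg_sub]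
    exact (h t ht s hs hst).isHermitian.neg

/-- The density ½(ρ + ρ*) is Hermitian at every point, not only almost everywhere, and it has the
same integrals as ρ because the increments of F are Hermitian. Pointwise symmetry lets the adjoint
relations below hold without exceptional sets. -/
theorem HermitianDeriv.exists_isHermitianDensity {a b : EReal} {ν : Measure ℝ}
    {F ρ : ℝ → Matrix (Fin n) (Fin n) ℂ} (hF : HermitianDeriv a b F)
    (hρ : ∀ i j, IsDensity ν (openInterval a b) (fun t => F t i j) fun t => ρ t i j) :
    ∃ ρ' : ℝ → Matrix (Fin n) (Fin n) ℂ, IsHermitianDensity ν (openInterval a b) F ρ' := by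
  refine ⟨fun t => (1 / 2 : ℂ) • (ρ t + (ρ t).conjTranspose), fun i j => ⟨?_, ?_, ?_, ?_⟩,
    fun t => ?_⟩
  · exact (hρ i j).boundedVariation
  · have h1 := (hρ i j).measurable
    have h2 := Complex.continuous_conj.measurable.comp (hρ j i).measurable
    simpa using (h1.add h2).const_mul (1 / 2 : ℂ)
  · have h1 := (hρ i j).integrable
    have h2 := Complex.conjCLE.toContinuousLinearMap.integrable_comp (hρ j i).integrable
    simpa using (h1.add h2).const_mul (1 / 2 : ℂ)
  · intro α hα β hβ hαβ
    have h1 := (hρ i j).increment α hα β hβ hαβ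
    have h2 := (hρ j i).increment α hα β hβ hαβ
    -- The hypothesis concerns values of F; the product filter carries its symmetry over to the
    -- one-sided limits.
    have lim : ∀ k l, Tendsto (fun p : ℝ × ℝ => F p.1 k l - F p.2 k l) (𝓝[<] β ×ˢ 𝓝[>] α)
        (𝓝 (leftLim (fun t => F t k l) β - rightLim (fun t => F t k l) α)) := fun k l =>
      (((hρ k l).boundedVariation.locallyBoundedVariationOn.tendsto_leftLim hβ).comp
        tendsto_fst).sub
      (((hρ k l).boundedVariation.locallyBoundedVariationOn.tendsto_rightLim hα).comp tendsto_snd)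
    have heq : leftLim (fun t => F t i j) β - rightLim (fun t => F t i j) α
        = star (leftLim (fun t => F t j i) β - rightLim (fun t => F t j i) α) := by
      refine tendsto_nhds_unique (lim i j) (((lim j i).star).congr' ?_)
      have hβ' := mem_nhdsWithin_of_mem_nhds (t := Iio β) ((isOpen_openInterval a b).mem_nhds hβ)
      have hα' := mem_nhdsWithin_of_mem_nhds (t := Ioi α) ((isOpen_openInterval a b).mem_nhds hα)
      filter_upwards [prod_mem_prod hβ' hα'] with p hp
      exact (hF p.2 hp.2 p.1 hp.1).apply i j
    have h3 : star (∫ x in Ioo α β, ρ x j i ∂ν) = ∫ x in Ioo α β, star (ρ x j i) ∂ν :=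
      integral_conj.symm
    have h4 : IntegrableOn (fun x => star (ρ x j i)) (Ioo α β) ν :=
      (Complex.conjCLE.toContinuousLinearMap.integrable_comp (hρ j i).integrable).integrableOn
    simp only [Matrix.smul_apply, Matrix.add_apply, Matrix.conjTranspose_apply, smul_eq_mul]
    rw [integral_const_mul, integral_add (hρ i j).integrable.integrableOn h4, ← h3, ← h1, ← h2,
      ← heq]
    ring
  · rw [Matrix.IsHermitian, Matrix.conjTranspose_smul, Matrix.conjTranspose_add,
      Matrix.conjTranspose_conjTranspose, add_comm]
    simp

/-- Hermitian densities of the two coefficients with respect to a common finite measure. -/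
structure IsCoefficientDensity (a b : EReal) (Q W : ℝ → Matrix (Fin n) (Fin n) ℂ) (ν : Measure ℝ)
    (ρQ ρW : ℝ → Matrix (Fin n) (Fin n) ℂ) : Prop where
  finite : IsFiniteMeasure ν
  left : IsHermitianDensity ν (openInterval a b) Q ρQ
  right : IsHermitianDensity ν (openInterval a b) W ρW

theorem exists_isCoefficientDensity {a b : EReal} (hab : a < b)
    {Q W : ℝ → Matrix (Fin n) (Fin n) ℂ} (hQ : IsAntiderivative a b Q)
    (hW : IsAntiderivative a b W) (hQherm : HermitianDeriv a b Q) (hWherm : HermitianDeriv a b W)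
    (ha : RegularLeft a b Q W) (hb : RegularRight a b Q W) :
    ∃ ν ρQ ρW, IsCoefficientDensity a b Q W ν ρQ ρW := by
  obtain ⟨c, hc, hca⟩ := ha
  obtain ⟨e, he, heb⟩ := hb
  have hbv : ∀ k : (Fin n × Fin n) ⊕ (Fin n × Fin n), BoundedVariationOn
      (Sum.elim (fun p t => Q t p.1 p.2) (fun p t => W t p.1 p.2) k : ℝ → ℂ)
      (openInterval a b) := by
    rintro (⟨i, j⟩ | ⟨i, j⟩)
    · exact boundedVariationOn_of_regular (hQ.locallyBoundedVariation i j) hc he (hca i j).1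
        (heb i j).1
    · exact boundedVariationOn_of_regular (hW.locallyBoundedVariation i j) hc he (hca i j).2
        (heb i j).2
  obtain ⟨ν, hν, ρ, hρ⟩ := exists_isDensity hab _ hbv
  obtain ⟨ρQ, hρQ⟩ := hQherm.exists_isHermitianDensity (ν := ν)
    (ρ := fun t => Matrix.of fun i j => ρ (Sum.inl (i, j)) t) fun i j => hρ (Sum.inl (i, j))
  obtain ⟨ρW, hρW⟩ := hWherm.exists_isHermitianDensity (ν := ν)
    (ρ := fun t => Matrix.of fun i j => ρ (Sum.inr (i, j)) t) fun i j => hρ (Sum.inr (i, j))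
  exact ⟨ν, ρQ, ρW, hν, hρQ, hρW⟩

end Density

/-! ### One-sided limits and variation of indefinite integrals -/

section Primitive

variable {m : Measure ℝ} {φ : ℝ → ℂ}

/-- Dominated convergence: at almost every point the indicators are eventually stationary. All
one-sided limits of primitives, also at infinite ends, are instances. -/
theorem tendsto_setIntegral_of_eventually_mem_iff (hφ : Integrable φ m) {l : Filter ℝ}
    [l.IsCountablyGenerated] {T : ℝ → Set ℝ} {S : Set ℝ} (hT : ∀ r, MeasurableSet (T r))
    (hS : MeasurableSet S) (h : ∀ᵐ x ∂m, ∀ᶠ r in l, (x ∈ T r ↔ x ∈ S)) :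
    Tendsto (fun r => ∫ x in T r, φ x ∂m) l (𝓝 (∫ x in S, φ x ∂m)) := by
  simp_rw [← integral_indicator (hT _), ← integral_indicator hS]
  refine tendsto_integral_filter_of_dominated_convergence (fun x => ‖φ x‖)
    (Eventually.of_forall fun r => hφ.aestronglyMeasurable.indicator (hT r))
    (Eventually.of_forall fun r => Eventually.of_forall fun x => norm_indicator_le_norm_self _ _)
    hφ.norm ?_
  filter_upwards [h] with x hx
  refine tendsto_const_nhds.congr' ?_
  filter_upwards [hx] with r hr
  by_cases hxS : x ∈ S
  · simp [hxS, hr.2 hxS]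
  · simp [hxS, mt hr.1 hxS]

theorem tendsto_setIntegral_Iio_left (hφ : Integrable φ m) (t : ℝ) :
    Tendsto (fun r => ∫ x in Iio r, φ x ∂m) (𝓝[<] t) (𝓝 (∫ x in Iio t, φ x ∂m)) := by
  refine tendsto_setIntegral_of_eventually_mem_iff hφ (fun _ => measurableSet_Iio)
    measurableSet_Iio (Eventually.of_forall fun x => ?_)
  rcases lt_or_ge x t with hx | hx
  · filter_upwards [Ioo_mem_nhdsLT hx] with r hr
    simp [hr.1, hx]
  · filter_upwards [self_mem_nhdsWithin] with r (hr : r < t)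
    simp only [mem_Iio]
    constructor <;> intro h <;> linarith

theorem tendsto_setIntegral_Iic_left (hφ : Integrable φ m) (t : ℝ) :
    Tendsto (fun r => ∫ x in Iic r, φ x ∂m) (𝓝[<] t) (𝓝 (∫ x in Iio t, φ x ∂m)) := by
  refine tendsto_setIntegral_of_eventually_mem_iff hφ (fun _ => measurableSet_Iic)
    measurableSet_Iio (Eventually.of_forall fun x => ?_)
  rcases lt_or_ge x t with hx | hx
  · filter_upwards [Ioo_mem_nhdsLT hx] with r hr
    simp [hr.1.le, hx]
  · filter_upwards [self_mem_nhdsWithin] with r (hr : r < t)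
    simp only [mem_Iio, mem_Iic]
    constructor <;> intro h <;> linarith

theorem tendsto_setIntegral_Iio_right (hφ : Integrable φ m) (t : ℝ) :
    Tendsto (fun r => ∫ x in Iio r, φ x ∂m) (𝓝[>] t) (𝓝 (∫ x in Iic t, φ x ∂m)) := by
  refine tendsto_setIntegral_of_eventually_mem_iff hφ (fun _ => measurableSet_Iio)
    measurableSet_Iic (Eventually.of_forall fun x => ?_)
  rcases le_or_gt x t with hx | hx
  · filter_upwards [self_mem_nhdsWithin] with r (hr : t < r)
    simp [hx, hx.trans_lt hr]
  · filter_upwards [Ioo_mem_nhdsGT hx] with r hr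
    simp only [mem_Iio, mem_Iic]
    constructor <;> intro h <;> linarith [hr.2]

theorem tendsto_setIntegral_Iic_right (hφ : Integrable φ m) (t : ℝ) :
    Tendsto (fun r => ∫ x in Iic r, φ x ∂m) (𝓝[>] t) (𝓝 (∫ x in Iic t, φ x ∂m)) := by
  refine tendsto_setIntegral_of_eventually_mem_iff hφ (fun _ => measurableSet_Iic)
    measurableSet_Iic (Eventually.of_forall fun x => ?_)
  rcases le_or_gt x t with hx | hx
  · filter_upwards [self_mem_nhdsWithin] with r (hr : t < r)
    simp [hx, hx.trans hr.le]
  · filter_upwards [Ioo_mem_nhdsGT hx] with r hr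
    simp only [mem_Iic]
    constructor <;> intro h <;> linarith [hr.2]

theorem tendsto_setIntegral_downTo {c d : EReal} (hcd : c < d)
    (hφ : IntegrableOn φ (openInterval c d) m) {T : ℝ → Set ℝ} (hT : ∀ r, MeasurableSet (T r))
    (hT' : ∀ r, T r ⊆ Iic r) :
    Tendsto (fun r => ∫ x in T r, φ x ∂m.restrict (openInterval c d)) (downTo c) (𝓝 0) := by
  have := tendsto_setIntegral_of_eventually_mem_iff hφ (l := downTo c) hT MeasurableSet.empty ?_
  · simpa using this
  · filter_upwards [ae_restrict_mem (measurableSet_openInterval c d)] with x hx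
    refine (eventually_downTo hcd).2 ⟨x, hx, fun r hr => ?_⟩
    have hr' : r < x := by exact_mod_cast hr.2
    simpa using fun h => (hT' r h).not_gt hr'

theorem tendsto_setIntegral_upTo {c d : EReal} (hcd : c < d)
    (hφ : IntegrableOn φ (openInterval c d) m) {T : ℝ → Set ℝ} (hT : ∀ r, MeasurableSet (T r))
    (hT' : ∀ r, Iio r ⊆ T r) :
    Tendsto (fun r => ∫ x in T r, φ x ∂m.restrict (openInterval c d)) (upTo d)
      (𝓝 (∫ x in openInterval c d, φ x ∂m)) := by
  have := tendsto_setIntegral_of_eventually_mem_iff hφ (l := upTo d) hT MeasurableSet.univ ?_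
  · simpa using this
  · filter_upwards [ae_restrict_mem (measurableSet_openInterval c d)] with x hx
    refine (eventually_upTo hcd).2 ⟨x, hx, fun r hr => ?_⟩
    have hr' : x < r := by exact_mod_cast hr.1
    simpa using hT' r hr'

theorem boundedVariationOn_of_norm_sub_le {f : ℝ → ℂ} {M : ℝ → ℝ} {C : ℝ} (hM : Monotone M)
    (hC : ∀ x, |M x| ≤ C) (h : ∀ x y, x ≤ y → ‖f y - f x‖ ≤ M y - M x) :
    BoundedVariationOn f univ := by
  refine ne_top_of_le_ne_top ((hM.monotoneOn univ).boundedVariationOn fun x _ => hC x) ?_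
  refine iSup_le fun ⟨k, u, hu, hu'⟩ => le_trans (Finset.sum_le_sum fun i _ => ?_)
    (eVariationOn.sum_le hu hu' (n := k))
  have hui := hu (Nat.le_succ i)
  rw [edist_dist, edist_dist, dist_eq_norm, Real.dist_eq, abs_of_nonneg (sub_nonneg.2 (hM hui))]
  exact ENNReal.ofReal_le_ofReal (h _ _ hui)

theorem boundedVariationOn_setIntegral (hφ : Integrable φ m) (p : ℂ) :
    BoundedVariationOn
      (fun t => p + (1 / 2) * ((∫ x in Iio t, φ x ∂m) + ∫ x in Iic t, φ x ∂m)) univ := by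
  have mono : ∀ {A B : Set ℝ}, A ⊆ B → MeasurableSet A →
      ‖(∫ x in B, φ x ∂m) - ∫ x in A, φ x ∂m‖ ≤ (∫ x in B, ‖φ x‖ ∂m) - ∫ x in A, ‖φ x‖ ∂m := by
    intro A B hAB hA
    rw [← setIntegral_sdiff hA hφ.integrableOn hAB, ← setIntegral_sdiff hA hφ.norm.integrableOn hAB]
    exact norm_integral_le_integral_norm _
  have hmono : ∀ {A B : Set ℝ}, A ⊆ B → (∫ x in A, ‖φ x‖ ∂m) ≤ ∫ x in B, ‖φ x‖ ∂m := by
    intro A B hAB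
    exact setIntegral_mono_set hφ.norm.integrableOn (Eventually.of_forall fun _ => norm_nonneg _)
      (LE.le.eventuallyLE hAB)
  -- The increments are dominated by those of the corresponding primitive of ‖φ‖. The factor ½ is
  -- not needed in the majorant, which is a sum of two integrals, each at most ∫ ‖φ‖.
  refine boundedVariationOn_of_norm_sub_le (C := 2 * ∫ x, ‖φ x‖ ∂m)
    (M := fun t => (∫ x in Iio t, ‖φ x‖ ∂m) + ∫ x in Iic t, ‖φ x‖ ∂m) ?_ ?_ ?_
  · intro x y hxy
    exact add_le_add (hmono (Iio_subset_Iio hxy)) (hmono (Iic_subset_Iic.2 hxy))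
  · intro x
    have h1 : 0 ≤ ∫ x in Iio x, ‖φ x‖ ∂m := integral_nonneg fun _ => norm_nonneg _
    have h2 : 0 ≤ ∫ x in Iic x, ‖φ x‖ ∂m := integral_nonneg fun _ => norm_nonneg _
    have h3 := hmono (subset_univ (Iio x))
    have h4 := hmono (subset_univ (Iic x))
    rw [setIntegral_univ] at h3 h4
    rw [abs_of_nonneg (add_nonneg h1 h2)]
    linarith
  · intro x y hxy
    have h1 := mono (Iio_subset_Iio hxy) measurableSet_Iio
    have h2 := mono (Iic_subset_Iic.2 hxy) measurableSet_Iic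
    set a := (∫ r in Iio y, φ r ∂m) - ∫ r in Iio x, φ r ∂m
    set b := (∫ r in Iic y, φ r ∂m) - ∫ r in Iic x, φ r ∂m
    have : p + 1 / 2 * ((∫ r in Iio y, φ r ∂m) + ∫ r in Iic y, φ r ∂m)
        - (p + 1 / 2 * ((∫ r in Iio x, φ r ∂m) + ∫ r in Iic x, φ r ∂m)) = 1 / 2 * (a + b) := by
      simp only [a, b]; ring
    rw [this, norm_mul]
    have h3 := norm_add_le a b
    have h4 : ‖(1 / 2 : ℂ)‖ ≤ 1 := by norm_num
    have h5 := mul_le_of_le_one_left (norm_nonneg (a + b)) h4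
    linarith

end Primitive

/-! ### The differential equation in terms of densities -/

section DensityForm

variable {n : ℕ}

/-- The vector of the left limits of the components of `u`. -/
noncomputable def leftVal (u : ℝ → Fin n → ℂ) (t : ℝ) : Fin n → ℂ :=
  fun i => leftLim (fun r => u r i) t

/-- The vector of the right limits of the components of `u`. -/
noncomputable def rightVal (u : ℝ → Fin n → ℂ) (t : ℝ) : Fin n → ℂ :=
  fun i => rightLim (fun r => u r i) t

/-- In terms of densities, the equation `J u' + (q - μ w) u = 0` reads
`u' = generator J ρQ ρW μ u`. -/
noncomputable def generator (J : Matrix (Fin n) (Fin n) ℂ)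
    (ρQ ρW : ℝ → Matrix (Fin n) (Fin n) ℂ) (μ : ℂ) (t : ℝ) : Matrix (Fin n) (Fin n) ℂ := -(J⁻¹ * (ρQ t - μ • ρW t))

variable {a b c d : EReal} {J : Matrix (Fin n) (Fin n) ℂ} {Q W : ℝ → Matrix (Fin n) (Fin n) ℂ}
  {ν : Measure ℝ} {ρQ ρW : ℝ → Matrix (Fin n) (Fin n) ℂ} {μ : ℂ} {u : ℝ → Fin n → ℂ}

theorem mul_generator (hJ : IsUnit J) (t : ℝ) :
    J * generator J ρQ ρW μ t = -(ρQ t - μ • ρW t) := by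
  rw [generator, mul_neg,
    Matrix.mul_nonsing_inv_cancel_left _ _ ((Matrix.isUnit_iff_isUnit_det J).1 hJ)]

theorem IsSolution.mono {c' d' : EReal} (hu : IsSolution J Q W μ c d u) (hc : c ≤ c')
    (hd : d' ≤ d) : IsSolution J Q W μ c' d' u := by
  have hsub := openInterval_subset_openInterval hc hd
  exact ⟨fun i => fun s t hs ht =>
      (hu.locallyBoundedVariation i s t (hsub hs) (hsub ht)).mono (inter_subset_inter_left _ hsub),
    fun t ht => hu.balanced t (hsub ht),
    fun s hs t ht => hu.equation s (hsub hs) t (hsub ht)⟩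

theorem IsSolution.tendsto_leftVal (hu : IsSolution J Q W μ c d u) {t : ℝ}
    (ht : t ∈ openInterval c d) : Tendsto u (𝓝[<] t) (𝓝 (leftVal u t)) :=
  tendsto_pi_nhds.2 fun i => (hu.locallyBoundedVariation i).tendsto_leftLim ht

theorem IsSolution.tendsto_rightVal (hu : IsSolution J Q W μ c d u) {t : ℝ}
    (ht : t ∈ openInterval c d) : Tendsto u (𝓝[>] t) (𝓝 (rightVal u t)) :=
  tendsto_pi_nhds.2 fun i => (hu.locallyBoundedVariation i).tendsto_rightLim ht

theorem IsSolution.eq_half_smul (hu : IsSolution J Q W μ c d u) {t : ℝ}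
    (ht : t ∈ openInterval c d) : u t = (1 / 2 : ℂ) • (rightVal u t + leftVal u t) := by
  ext i
  rw [hu.balanced t ht i]
  simp only [rightVal, leftVal, Pi.smul_apply, Pi.add_apply, smul_eq_mul]
  ring

namespace IsCoefficientDensity

theorem increment_left (h : IsCoefficientDensity a b Q W ν ρQ ρW) (i j : Fin n) {s t : ℝ}
    (hs : s ∈ openInterval a b) (ht : t ∈ openInterval a b) :
    ∀ β ∈ Ioc s t, leftLim (fun r => Q r i j) β - rightLim (fun r => Q r i j) s
      = ∫ x in Ioo s β, ρQ x i j ∂ν := fun β hβ =>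
  (h.left.isDensity i j).increment s hs β (Icc_subset_openInterval hs ht ⟨hβ.1.le, hβ.2⟩) hβ.1

theorem increment_right (h : IsCoefficientDensity a b Q W ν ρQ ρW) (i j : Fin n) {s t : ℝ}
    (hs : s ∈ openInterval a b) (ht : t ∈ openInterval a b) :
    ∀ β ∈ Ioc s t, leftLim (fun r => W r i j) β - rightLim (fun r => W r i j) s
      = ∫ x in Ioo s β, ρW x i j ∂ν := fun β hβ =>
  (h.right.isDensity i j).increment s hs β (Icc_subset_openInterval hs ht ⟨hβ.1.le, hβ.2⟩) hβ.1

theorem jump_left (h : IsCoefficientDensity a b Q W ν ρQ ρW) {t : ℝ} (ht : t ∈ openInterval a b) :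
    jump Q t = (ν.real {t} : ℂ) • ρQ t := by
  obtain ⟨r, hr, hrt⟩ := exists_lt_mem_openInterval ht
  obtain ⟨s, hs, hts⟩ := exists_gt_mem_openInterval ht
  ext i j
  have hd := h.left.isDensity i j
  have hbv := hd.boundedVariation.mono (Icc_subset_openInterval hr hs)
  rw [jump, Matrix.of_apply, ← stieltjes_singleton hbv ⟨hrt, hts⟩,
    stieltjes_eq_setIntegral hbv hd.integrable.integrableOn (h.increment_left i j hr hs)
      (measurableSet_singleton t) (singleton_subset_iff.2 ⟨hrt, hts⟩), integral_singleton]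
  simp

theorem jump_right (h : IsCoefficientDensity a b Q W ν ρQ ρW) {t : ℝ} (ht : t ∈ openInterval a b) :
    jump W t = (ν.real {t} : ℂ) • ρW t := by
  obtain ⟨r, hr, hrt⟩ := exists_lt_mem_openInterval ht
  obtain ⟨s, hs, hts⟩ := exists_gt_mem_openInterval ht
  ext i j
  have hd := h.right.isDensity i j
  have hbv := hd.boundedVariation.mono (Icc_subset_openInterval hr hs)
  rw [jump, Matrix.of_apply, ← stieltjes_singleton hbv ⟨hrt, hts⟩,
    stieltjes_eq_setIntegral hbv hd.integrable.integrableOn (h.increment_right i j hr hs)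
      (measurableSet_singleton t) (singleton_subset_iff.2 ⟨hrt, hts⟩), integral_singleton]
  simp

/-- The jump of a coefficient at t is its density times the atom ν{t}. Thus B₊ = J(1 - ½ν{t}A), and
invertibility of B₊ is solvability of u = u⁻ + ½ν{t}A u for u. -/
theorem bplus_eq (h : IsCoefficientDensity a b Q W ν ρQ ρW) (hJ : IsUnit J) {t : ℝ}
    (ht : t ∈ openInterval a b) (μ : ℂ) :
    Bplus J Q W t μ = J - ((1 / 2 : ℂ) * ν.real {t}) • (J * generator J ρQ ρW μ t) := by
  rw [Bplus, h.jump_left ht, h.jump_right ht, mul_generator hJ, mul_smul, smul_comm μ, ← smul_sub]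
  rw [smul_neg, smul_neg, sub_neg_eq_add]

theorem bminus_eq (h : IsCoefficientDensity a b Q W ν ρQ ρW) (hJ : IsUnit J) {t : ℝ}
    (ht : t ∈ openInterval a b) (μ : ℂ) :
    Bminus J Q W t μ = J + ((1 / 2 : ℂ) * ν.real {t}) • (J * generator J ρQ ρW μ t) := by
  rw [Bminus, h.jump_left ht, h.jump_right ht, mul_generator hJ, mul_smul, smul_comm μ, ← smul_sub]
  rw [smul_neg, smul_neg, ← sub_eq_add_neg]

variable (h : IsCoefficientDensity a b Q W ν ρQ ρW)
include h

theorem measurable_generator (i j : Fin n) : Measurable fun t => generator J ρQ ρW μ t i j := by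
  have h1 := fun i j => (h.left.isDensity i j).measurable
  have h2 := fun i j => (h.right.isDensity i j).measurable
  simp only [generator, Matrix.neg_apply, Matrix.mul_apply, Matrix.sub_apply, Matrix.smul_apply,
    smul_eq_mul]
  exact (Finset.measurable_fun_sum _ fun k _ =>
    ((h1 k j).sub ((h2 k j).const_mul μ)).const_mul _).neg

theorem integrable_generator (i j : Fin n) :
    Integrable (fun t => generator J ρQ ρW μ t i j) ν := by
  have h1 := fun i j => (h.left.isDensity i j).integrable
  have h2 := fun i j => (h.right.isDensity i j).integrable
  simp only [generator, Matrix.neg_apply, Matrix.mul_apply, Matrix.sub_apply, Matrix.smul_apply,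
    smul_eq_mul]
  exact (integrable_finsetSum _ fun k _ =>
    ((h1 k j).sub ((h2 k j).const_mul μ)).const_mul _).neg

theorem integrableOn_generator_mulVec {E : Set ℝ} (hE : MeasurableSet E) {C : ℝ}
    (hu : ∀ j, AEStronglyMeasurable (fun t => u t j) (ν.restrict E))
    (huC : ∀ j, ∀ t ∈ E, ‖u t j‖ ≤ C) (i : Fin n) :
    IntegrableOn (fun t => (generator J ρQ ρW μ t).mulVec (u t) i) E ν := by
  simp only [Matrix.mulVec, dotProduct]
  exact integrable_finsetSum _ fun j _ => (h.integrable_generator i j).integrableOn.mul_bdd (hu j)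
    (by filter_upwards [ae_restrict_mem hE] with t ht using huC j t ht)

/-- All Stieltjes integrals become integrals against ν, so the system on E reads J D + P = 0 with D
= du(E) and P = ∫_E (ρQ - μ ρW) u dν. Multiplication by J⁻¹ gives D = ∫_E A u dν. -/
theorem equation_iff (hJ : IsUnit J) {s t : ℝ} (hs : s ∈ openInterval a b)
    (ht : t ∈ openInterval a b) (hu : ∀ i, BoundedVariationOn (fun r => u r i) (Icc s t))
    {E : Set ℝ} (hE : MeasurableSet E) (hEst : E ⊆ Ioo s t) :
    (∀ i, ∑ j, J i j * stieltjes (fun r => u r j) s t E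
        + ∑ j, (stieltjesIntegral (fun r => u r j) (fun r => Q r i j) s t E
            - μ * stieltjesIntegral (fun r => u r j) (fun r => W r i j) s t E) = 0) ↔
      ∀ i, stieltjes (fun r => u r i) s t E
        = ∫ r in E, (generator J ρQ ρW μ r).mulVec (u r) i ∂ν := by
  have hEI : E ⊆ Icc s t := hEst.trans Ioo_subset_Icc_self
  choose C hC using fun i => (hu i).exists_norm_le
  have hm : ∀ j, AEStronglyMeasurable (fun r => u r j) (ν.restrict E) := fun j =>
    ((hu j).aestronglyMeasurable ν).mono_measure (Measure.restrict_mono hEI le_rfl)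
  have hQ : ∀ i j, stieltjesIntegral (fun r => u r j) (fun r => Q r i j) s t E
      = ∫ x in E, u x j * ρQ x i j ∂ν := fun i j =>
    stieltjesIntegral_eq ((h.left.isDensity i j).boundedVariation.mono (Icc_subset_openInterval hs ht))
      (h.left.isDensity i j).integrable (h.left.isDensity i j).measurable (h.increment_left i j hs ht)
      hE hEst (hm j) fun x hx => hC j x (hEI hx)
  have hW : ∀ i j, stieltjesIntegral (fun r => u r j) (fun r => W r i j) s t E
      = ∫ x in E, u x j * ρW x i j ∂ν := fun i j =>
    stieltjesIntegral_eq ((h.right.isDensity i j).boundedVariation.mono (Icc_subset_openInterval hs ht))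
      (h.right.isDensity i j).integrable (h.right.isDensity i j).measurable (h.increment_right i j hs ht)
      hE hEst (hm j) fun x hx => hC j x (hEI hx)
  have hb : ∀ j, ∀ᵐ x ∂ν.restrict E, ‖u x j‖ ≤ C j := fun j => by
    filter_upwards [ae_restrict_mem hE] with x hx using hC j x (hEI hx)
  have hQi : ∀ i j, IntegrableOn (fun x => u x j * ρQ x i j) E ν := fun i j =>
    (h.left.isDensity i j).integrable.integrableOn.bdd_mul (hm j) (hb j)
  have hWi : ∀ i j, IntegrableOn (fun x => u x j * ρW x i j) E ν := fun i j =>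
    (h.right.isDensity i j).integrable.integrableOn.bdd_mul (hm j) (hb j)
  set D : Fin n → ℂ := fun i => stieltjes (fun r => u r i) s t E with hD
  set P : Fin n → ℂ := fun i => ∫ r in E, (ρQ r - μ • ρW r).mulVec (u r) i ∂ν with hP
  have hPi : ∀ i, IntegrableOn (fun r => (ρQ r - μ • ρW r).mulVec (u r) i) E ν := fun i => by
    simp only [Matrix.mulVec, dotProduct, Matrix.sub_apply, Matrix.smul_apply, smul_eq_mul]
    refine integrable_finsetSum _ fun j _ => ?_
    have := (hQi i j).sub ((hWi i j).const_mul μ)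
    refine this.congr (Eventually.of_forall fun x => ?_)
    simp only [Pi.sub_apply]
    ring
  have hPeq : ∀ i, P i = ∑ j, (stieltjesIntegral (fun r => u r j) (fun r => Q r i j) s t E
            - μ * stieltjesIntegral (fun r => u r j) (fun r => W r i j) s t E) := by
    intro i
    have : P i = ∫ r in E, ∑ j, (u r j * ρQ r i j - μ * (u r j * ρW r i j)) ∂ν := by
      refine integral_congr_ae (Eventually.of_forall fun x => ?_)
      simp only [Matrix.mulVec, dotProduct, Matrix.sub_apply, Matrix.smul_apply, smul_eq_mul]
      exact Finset.sum_congr rfl fun j _ => by ring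
    rw [this, integral_finsetSum (f := fun j r => u r j * ρQ r i j - μ * (u r j * ρW r i j)) _
      fun j _ => (hQi i j).sub ((hWi i j).const_mul μ)]
    refine Finset.sum_congr rfl fun j _ => ?_
    rw [integral_sub (hQi i j) ((hWi i j).const_mul μ), integral_const_mul, hQ, hW]
  have hgen : ∀ i, ∫ r in E, (generator J ρQ ρW μ r).mulVec (u r) i ∂ν = -(J⁻¹.mulVec P) i := by
    intro i
    have : ∀ r, (generator J ρQ ρW μ r).mulVec (u r) i
        = -∑ k, J⁻¹ i k * (ρQ r - μ • ρW r).mulVec (u r) k := fun r => by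
      rw [generator, Matrix.neg_mulVec, ← Matrix.mulVec_mulVec]
      rfl
    simp_rw [this]
    rw [integral_neg, integral_finsetSum _ fun k _ => (hPi k).const_mul _]
    simp_rw [integral_const_mul]
    rfl
  have hdet := (Matrix.isUnit_iff_isUnit_det J).1 hJ
  have hiff : J.mulVec D + P = 0 ↔ D = -J⁻¹.mulVec P := by
    constructor
    · intro h0
      have := congrArg J⁻¹.mulVec h0
      rw [Matrix.mulVec_add, Matrix.mulVec_mulVec, Matrix.nonsing_inv_mul _ hdet,
        Matrix.one_mulVec, Matrix.mulVec_zero] at this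
      exact eq_neg_of_add_eq_zero_left this
    · intro h0
      rw [h0, Matrix.mulVec_neg, Matrix.mulVec_mulVec, Matrix.mul_nonsing_inv _ hdet,
        Matrix.one_mulVec, neg_add_cancel]
  calc _ ↔ J.mulVec D + P = 0 := by
        rw [funext_iff]
        refine forall_congr' fun i => ?_
        rw [← hPeq]
        rfl
    _ ↔ _ := by
        rw [hiff, funext_iff]
        refine forall_congr' fun i => ?_
        rw [hgen]
        rfl

theorem stieltjes_eq (hJ : IsUnit J) (hac : a ≤ c) (hdb : d ≤ b) (hu : IsSolution J Q W μ c d u)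
    {s t : ℝ} (hs : s ∈ openInterval c d) (ht : t ∈ openInterval c d) {E : Set ℝ}
    (hE : MeasurableSet E) (hEst : E ⊆ Ioo s t) (i : Fin n) :
    stieltjes (fun r => u r i) s t E
      = ∫ r in E, (generator J ρQ ρW μ r).mulVec (u r) i ∂ν :=
  have hsub := openInterval_subset_openInterval hac hdb
  (h.equation_iff hJ (hsub hs) (hsub ht)
    (fun i => (hu.locallyBoundedVariation i).boundedVariationOn_Icc hs ht) hE hEst).1
    (hu.equation s hs t ht E hE hEst) i

theorem integrableOn_Icc (hu : IsSolution J Q W μ c d u) {s t : ℝ} (hs : s ∈ openInterval c d)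
    (ht : t ∈ openInterval c d) (i : Fin n) :
    IntegrableOn (fun r => (generator J ρQ ρW μ r).mulVec (u r) i) (Icc s t) ν := by
  have hbv := fun i => (hu.locallyBoundedVariation i).boundedVariationOn_Icc hs ht
  choose C hC using fun i => (hbv i).exists_norm_le
  refine h.integrableOn_generator_mulVec measurableSet_Icc (C := ∑ j, |C j|)
    (fun j => (hbv j).aestronglyMeasurable ν) (fun j r hr => (hC j r hr).trans ?_) i
  exact (le_abs_self _).trans
    (Finset.single_le_sum (f := fun j => |C j|) (fun _ _ => abs_nonneg _) (Finset.mem_univ j))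

theorem leftVal_eq_add (hJ : IsUnit J) (hac : a ≤ c) (hdb : d ≤ b)
    (hu : IsSolution J Q W μ c d u) {s t : ℝ} (hs : s ∈ openInterval c d)
    (ht : t ∈ openInterval c d) (hst : s ≤ t) (i : Fin n) :
    leftVal u t i = leftVal u s i
      + ∫ r in Ico s t, (generator J ρQ ρW μ r).mulVec (u r) i ∂ν := by
  obtain ⟨r, hr, hrs⟩ := exists_lt_mem_openInterval hs
  rw [← h.stieltjes_eq hJ hac hdb hu hr ht measurableSet_Ico
    (fun x hx => ⟨hrs.trans_le hx.1, hx.2⟩) i,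
    stieltjes_Ico ((hu.locallyBoundedVariation i).boundedVariationOn_Icc hr ht) hrs hst le_rfl]
  simp [leftVal]

theorem rightVal_eq_add (hJ : IsUnit J) (hac : a ≤ c) (hdb : d ≤ b)
    (hu : IsSolution J Q W μ c d u) {t : ℝ} (ht : t ∈ openInterval c d) :
    rightVal u t = leftVal u t + (ν.real {t} : ℂ) • (generator J ρQ ρW μ t).mulVec (u t) := by
  obtain ⟨r, hr, hrt⟩ := exists_lt_mem_openInterval ht
  obtain ⟨s, hs, hts⟩ := exists_gt_mem_openInterval ht
  ext i
  have h1 := h.stieltjes_eq hJ hac hdb hu hr hs (measurableSet_singleton t)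
    (singleton_subset_iff.2 ⟨hrt, hts⟩) i
  rw [stieltjes_singleton ((hu.locallyBoundedVariation i).boundedVariationOn_Icc hr hs)
    ⟨hrt, hts⟩, integral_singleton] at h1
  simp only [rightVal, leftVal, Pi.add_apply, Pi.smul_apply, smul_eq_mul]
  rw [sub_eq_iff_eq_add'] at h1
  simpa using h1

theorem eq_leftVal_add (hJ : IsUnit J) (hac : a ≤ c) (hdb : d ≤ b)
    (hu : IsSolution J Q W μ c d u) {t : ℝ} (ht : t ∈ openInterval c d) :
    u t = leftVal u t
      + ((1 / 2 : ℂ) * ν.real {t}) • (generator J ρQ ρW μ t).mulVec (u t) := by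
  conv_lhs => rw [hu.eq_half_smul ht, h.rightVal_eq_add hJ hac hdb hu ht]
  rw [mul_smul]
  module

/-- The jump of u at t is ν{t}A u(t), and balance places u(t) halfway. Hence u⁻ = (1 - ½ν{t}A) u,
whose image under J is B₊ u. No invertibility of B₊ enters, so this holds at bad points as well. -/
theorem bplus_mulVec (hJ : IsUnit J) (hac : a ≤ c) (hdb : d ≤ b)
    (hu : IsSolution J Q W μ c d u) {t : ℝ} (ht : t ∈ openInterval c d) :
    (Bplus J Q W t μ).mulVec (u t) = J.mulVec (leftVal u t) := by
  have h1 := h.eq_leftVal_add hJ hac hdb hu ht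
  have h2 : leftVal u t = u t
      - ((1 / 2 : ℂ) * ν.real {t}) • (generator J ρQ ρW μ t).mulVec (u t) :=
    eq_sub_of_add_eq h1.symm
  rw [h.bplus_eq hJ (openInterval_subset_openInterval hac hdb ht), Matrix.sub_mulVec,
    Matrix.smul_mulVec, ← Matrix.mulVec_mulVec, h2, Matrix.mulVec_sub, Matrix.mulVec_smul]

theorem bminus_mulVec (hJ : IsUnit J) (hac : a ≤ c) (hdb : d ≤ b)
    (hu : IsSolution J Q W μ c d u) {t : ℝ} (ht : t ∈ openInterval c d) :
    (Bminus J Q W t μ).mulVec (u t) = J.mulVec (rightVal u t) := by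
  have h1 := h.eq_leftVal_add hJ hac hdb hu ht
  have h2 : rightVal u t = u t
      + ((1 / 2 : ℂ) * ν.real {t}) • (generator J ρQ ρW μ t).mulVec (u t) := by
    rw [h.rightVal_eq_add hJ hac hdb hu ht, eq_sub_of_add_eq h1.symm, mul_smul]
    module
  rw [h.bminus_eq hJ (openInterval_subset_openInterval hac hdb ht), Matrix.add_mulVec,
    Matrix.smul_mulVec, ← Matrix.mulVec_mulVec, h2, Matrix.mulVec_add, Matrix.mulVec_smul]

/-- Averaging the integrals over `Iio t` and `Iic t` encodes balance: the left limit is p plus the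
first, the right limit p plus the second. The equation then follows from the masses of du on
intervals. -/
theorem isSolution_of_integral (hJ : IsUnit J) (hac : a ≤ c) (hdb : d ≤ b) {p : Fin n → ℂ}
    (hint : ∀ i, IntegrableOn (fun r => (generator J ρQ ρW μ r).mulVec (u r) i)
      (openInterval c d) ν)
    (hu : ∀ t ∈ openInterval c d, ∀ i, u t i = p i + (1 / 2) *
      ((∫ r in Iio t, (generator J ρQ ρW μ r).mulVec (u r) i ∂ν.restrict (openInterval c d))
        + ∫ r in Iic t, (generator J ρQ ρW μ r).mulVec (u r) i ∂ν.restrict (openInterval c d))) :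
    IsSolution J Q W μ c d u := by
  set φ : Fin n → ℝ → ℂ := fun i r => (generator J ρQ ρW μ r).mulVec (u r) i with hφ
  set m := ν.restrict (openInterval c d) with hm
  have hI := isOpen_openInterval c d
  set g : Fin n → ℝ → ℂ := fun i t => p i + (1 / 2) * ((∫ x in Iio t, φ i x ∂m)
    + ∫ x in Iic t, φ i x ∂m) with hg
  have hug : ∀ t ∈ openInterval c d, ∀ i, (fun r => u r i) =ᶠ[𝓝 t] g i := fun t ht i => by
    filter_upwards [hI.mem_nhds ht] with r hr using hu r hr i
  have hlim : ∀ i t, Tendsto (g i) (𝓝[<] t) (𝓝 (p i + ∫ x in Iio t, φ i x ∂m)) := fun i t => by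
    have := (((tendsto_setIntegral_Iio_left (hint i) t).add
      (tendsto_setIntegral_Iic_left (hint i) t)).const_mul (1 / 2 : ℂ)).const_add (p i)
    convert this using 2
    ring
  have hlim' : ∀ i t, Tendsto (g i) (𝓝[>] t) (𝓝 (p i + ∫ x in Iic t, φ i x ∂m)) := fun i t => by
    have := (((tendsto_setIntegral_Iio_right (hint i) t).add
      (tendsto_setIntegral_Iic_right (hint i) t)).const_mul (1 / 2 : ℂ)).const_add (p i)
    convert this using 2
    ring
  have hleft : ∀ i, ∀ t ∈ openInterval c d,
      leftLim (fun r => u r i) t = p i + ∫ x in Iio t, φ i x ∂m := fun i t ht =>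
    leftLim_eq_of_tendsto ((hlim i t).congr' ((hug t ht i).symm.filter_mono nhdsWithin_le_nhds))
  have hright : ∀ i, ∀ t ∈ openInterval c d,
      rightLim (fun r => u r i) t = p i + ∫ x in Iic t, φ i x ∂m := fun i t ht =>
    rightLim_eq_of_tendsto ((hlim' i t).congr' ((hug t ht i).symm.filter_mono nhdsWithin_le_nhds))
  have hbv : ∀ i, BoundedVariationOn (fun r => u r i) (openInterval c d) := fun i => by
    have := (boundedVariationOn_setIntegral (hint i) (p i)).mono (subset_univ (openInterval c d))
    rwa [BoundedVariationOn, eVariationOn.congr fun t ht => hu t ht i]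
  refine ⟨fun i => (hbv i).locallyBoundedVariationOn, fun t ht i => ?_, fun s hs t ht E hE hEst => ?_⟩
  · rw [hleft i t ht, hright i t ht, hu t ht i]
    ring
  · have hsub := openInterval_subset_openInterval hac hdb
    have hIcc := Icc_subset_openInterval hs ht
    refine (h.equation_iff hJ (hsub hs) (hsub ht) (fun i => (hbv i).mono hIcc) hE hEst).2
      fun i => ?_
    refine stieltjes_eq_setIntegral ((hbv i).mono hIcc)
      ((hint i).mono_set (Ioo_subset_Icc_self.trans hIcc)) (fun β hβ => ?_) hE hEst
    rw [hleft i β (hIcc ⟨hβ.1.le, hβ.2⟩), hright i s hs, add_sub_add_left_eq_sub,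
      ← setIntegral_sdiff measurableSet_Iic (hint i).integrableOn (Iic_subset_Iio.2 hβ.1),
      Measure.restrict_restrict (measurableSet_Iio.diff measurableSet_Iic)]
    congr 2
    ext r
    have := @hIcc r
    simp only [mem_inter_iff, Set.mem_sdiff, mem_Iio, mem_Iic, mem_Ioo, not_le]
    constructor
    · rintro ⟨⟨h1, h2⟩, h3⟩
      exact ⟨h2, h1⟩
    · rintro ⟨h1, h2⟩
      exact ⟨⟨h2, h1⟩, this ⟨h1.le, h2.le.trans hβ.2⟩⟩

end IsCoefficientDensity

end DensityForm

/-! ### Volterra equations with respect to a measure with atoms -/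

section Volterra

open scoped ENNReal

/-- The iterated integrals `1, F, …` of a measure over `t_k < ⋯ < t_1 < t`. -/
noncomputable def iteratedMass (m : Measure ℝ) : ℕ → ℝ → ℝ≥0∞
  | 0, _ => 1
  | k + 1, t => ∫⁻ r in Iio t, iteratedMass m k r ∂m

variable {m : Measure ℝ}

theorem iteratedMass_mono (k : ℕ) : Monotone (iteratedMass m k) := by
  cases k with
  | zero => exact fun _ _ _ => le_rfl
  | succ k => exact fun s t hst => lintegral_mono_set (Iio_subset_Iio hst)

theorem measurable_iteratedMass (k : ℕ) : Measurable (iteratedMass m k) :=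
  (iteratedMass_mono k).measurable

/-- For an atomless measure this is an equality, by the power rule. Atoms only help, since the
simplices t_k < ⋯ < t_1 are strict and omit all diagonals. -/
theorem succ_mul_iteratedMass_le [SFinite m] (k : ℕ) (t : ℝ) :
    (k + 1 : ℝ≥0∞) * iteratedMass m (k + 1) t ≤ m (Iio t) * iteratedMass m k t := by
  induction k generalizing t with
  | zero => simp [iteratedMass]
  | succ k ih =>
    have hH := measurable_iteratedMass (m := m) k
    have hF : Measurable fun y => m (Iio y) :=
      Monotone.measurable fun x y hxy => measure_mono (Iio_subset_Iio hxy)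
    have hG : Measurable fun y => m (Ioo y t) :=
      Antitone.measurable fun x y hxy => measure_mono (Ioo_subset_Ioo_left hxy)
    -- Tonelli in the two outermost variables y < x < t: integrating over x first leaves the factor
    -- m(y, t).
    have swap : ∫⁻ y in Iio t, iteratedMass m k y * m (Ioo y t) ∂m = iteratedMass m (k + 2) t := by
      have h1 : ∫⁻ y in Iio t, iteratedMass m k y * m (Ioo y t) ∂m
          = ∫⁻ y, ∫⁻ x in Iio t, (Ioi y).indicator (fun _ => iteratedMass m k y) x ∂m ∂m := by
        rw [← lintegral_indicator measurableSet_Iio]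
        refine lintegral_congr fun y => ?_
        rw [lintegral_indicator_const measurableSet_Ioi, Measure.restrict_apply measurableSet_Ioi,
          Ioi_inter_Iio]
        by_cases hy : y < t
        · simp [hy]
        · simp [hy]
      have h2 : ∀ x y : ℝ, (Ioi y).indicator (fun _ => iteratedMass m k y) x
          = (Iio x).indicator (iteratedMass m k) y := fun x y => by
        simp [indicator_apply]
      rw [h1, lintegral_lintegral_swap]
      · simp_rw [h2, lintegral_indicator measurableSet_Iio]
        rfl
      · have : Measurable fun q : ℝ × ℝ => {q : ℝ × ℝ | q.1 < q.2}.indicator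
            (fun q => iteratedMass m k q.1) q :=
          (hH.comp measurable_fst).indicator (measurableSet_lt measurable_fst measurable_snd)
        exact this.aemeasurable
    -- The only loss is the atom at y.
    have hsplit : ∀ y < t, m (Iio y) + m (Ioo y t) ≤ m (Iio t) := fun y hy => by
      rw [← measure_union (disjoint_left.2 fun x hx hx' => (mem_Iio.1 hx).not_gt hx'.1)
        measurableSet_Ioo]
      exact measure_mono (union_subset (Iio_subset_Iio hy.le) Ioo_subset_Iio_self)
    calc ((k + 1 : ℕ) + 1 : ℝ≥0∞) * iteratedMass m (k + 2) t
        = (∫⁻ y in Iio t, (k + 1 : ℝ≥0∞) * iteratedMass m (k + 1) y ∂m)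
          + ∫⁻ y in Iio t, iteratedMass m k y * m (Ioo y t) ∂m := by
          rw [swap, lintegral_const_mul _ (measurable_iteratedMass _), add_mul, one_mul]
          push_cast
          rfl
      _ ≤ (∫⁻ y in Iio t, m (Iio y) * iteratedMass m k y ∂m)
          + ∫⁻ y in Iio t, iteratedMass m k y * m (Ioo y t) ∂m := by
          exact add_le_add_left (lintegral_mono fun y => ih y) _
      _ = ∫⁻ y in Iio t, (m (Iio y) + m (Ioo y t)) * iteratedMass m k y ∂m := by
          rw [← lintegral_add_left (f := fun y => m (Iio y) * iteratedMass m k y) (hF.mul hH)]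
          refine lintegral_congr fun y => ?_
          ring
      _ ≤ ∫⁻ y in Iio t, m (Iio t) * iteratedMass m k y ∂m := by
          refine setLIntegral_mono (hH.const_mul _) fun y hy => ?_
          gcongr
          exact hsplit y hy
      _ = m (Iio t) * iteratedMass m (k + 1) t := by
          rw [lintegral_const_mul _ hH]
          rfl

theorem factorial_mul_iteratedMass_le [SFinite m] (k : ℕ) (t : ℝ) :
    (k.factorial : ℝ≥0∞) * iteratedMass m k t ≤ m univ ^ k := by
  induction k with
  | zero => simp [iteratedMass]
  | succ k ih =>
    calc ((k + 1).factorial : ℝ≥0∞) * iteratedMass m (k + 1) t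
        = k.factorial * ((k + 1) * iteratedMass m (k + 1) t) := by
          rw [Nat.factorial_succ]
          push_cast
          ring
      _ ≤ k.factorial * (m (Iio t) * iteratedMass m k t) := by
          exact mul_le_mul' le_rfl (succ_mul_iteratedMass_le k t)
      _ = m (Iio t) * (k.factorial * iteratedMass m k t) := by ring
      _ ≤ m univ * m univ ^ k := by
          gcongr
          exact subset_univ _
      _ = m univ ^ (k + 1) := by ring

variable {n : ℕ}

theorem measurable_setIntegral_Iio {g : ℝ → ℂ} [SFinite m] (hg : Measurable g) :
    Measurable fun t => ∫ r in Iio t, g r ∂m := by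
  have h1 : StronglyMeasurable fun q : ℝ × ℝ =>
      {q : ℝ × ℝ | q.2 < q.1}.indicator (fun q => g q.2) q :=
    ((hg.comp measurable_snd).indicator
      (measurableSet_lt measurable_snd measurable_fst)).stronglyMeasurable
  have h2 := (h1.integral_prod_right' (ν := m)).measurable
  convert h2 using 2 with t
  rw [← integral_indicator measurableSet_Iio]
  rfl

/-- The terms of the Neumann series of the equation `v(t) = p + ∫_{(-∞, t)} K v dm`. -/
noncomputable def neumannTerm (m : Measure ℝ) (K : ℝ → Matrix (Fin n) (Fin n) ℂ) (p : Fin n → ℂ) :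
    ℕ → ℝ → Fin n → ℂ
  | 0, _ => p
  | k + 1, t => fun i => ∫ r in Iio t, (K r).mulVec (neumannTerm m K p k r) i ∂m

/-- The k-th Neumann term is at most a constant times the k-th iterated mass of the measure |K| m,
hence at most a constant times M^k / k! with M its total mass. So the series converges uniformly,
without any smallness of K. -/
theorem exists_volterra_solution [IsFiniteMeasure m] {K : ℝ → Matrix (Fin n) (Fin n) ℂ}
    (hKm : ∀ i j, Measurable fun t => K t i j) (hK : ∀ i j, Integrable (fun t => K t i j) m)
    (p : Fin n → ℂ) :
    ∃ v : ℝ → Fin n → ℂ, (∀ i, Measurable fun t => v t i) ∧ (∃ C, ∀ t i, ‖v t i‖ ≤ C) ∧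
      ∀ t i, v t i = p i + ∫ r in Iio t, (K r).mulVec (v r) i ∂m := by
  set w := neumannTerm m K p with hw
  set κ : ℝ → ℝ≥0∞ := fun r => ∑ i, ∑ j, ‖K r i j‖ₑ with hκ
  have hκm : Measurable κ :=
    Finset.measurable_fun_sum _ fun i _ => Finset.measurable_fun_sum _ fun j _ => (hKm i j).enorm
  have hκi : ∫⁻ r, κ r ∂m ≠ ∞ := by
    simp only [hκ]
    rw [lintegral_finsetSum _ fun i _ => Finset.measurable_fun_sum _ fun j _ => (hKm i j).enorm]
    refine (ENNReal.sum_lt_top.2 fun i _ => ?_).ne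
    rw [lintegral_finsetSum _ fun j _ => (hKm i j).enorm]
    exact ENNReal.sum_lt_top.2 fun j _ => (hK i j).2
  set mm := m.withDensity κ with hmm
  have hmmf : IsFiniteMeasure mm := isFiniteMeasure_withDensity hκi
  have hmul : ∀ (r : ℝ) (x : Fin n → ℂ) (c : ℝ≥0∞), (∀ j, ‖x j‖ₑ ≤ c) →
      ∀ i, ‖(K r).mulVec x i‖ₑ ≤ κ r * c := by
    intro r x c hx i
    calc ‖(K r).mulVec x i‖ₑ ≤ ∑ j, ‖K r i j * x j‖ₑ := by
          rw [Matrix.mulVec, dotProduct]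
          exact enorm_sum_le _ _
      _ ≤ ∑ j, ‖K r i j‖ₑ * c := by
          refine Finset.sum_le_sum fun j _ => ?_
          rw [enorm_mul]
          gcongr
          exact hx j
      _ = (∑ j, ‖K r i j‖ₑ) * c := by rw [Finset.sum_mul]
      _ ≤ κ r * c := by
          gcongr
          exact Finset.single_le_sum (f := fun i => ∑ j, ‖K r i j‖ₑ) (fun _ _ => zero_le)
            (Finset.mem_univ i)
  have hmulm : ∀ {x : ℝ → Fin n → ℂ}, (∀ i, Measurable fun t => x t i) → ∀ i,
      Measurable fun r => (K r).mulVec (x r) i := fun hx i => by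
    simp only [Matrix.mulVec, dotProduct]
    exact Finset.measurable_fun_sum _ fun j _ => (hKm i j).mul (hx j)
  have hwm : ∀ k i, Measurable fun t => w k t i := by
    intro k
    induction k with
    | zero => exact fun i => measurable_const
    | succ k ih => exact fun i => measurable_setIntegral_Iio (hmulm ih i)
  set B : ℝ≥0∞ := ∑ i, ‖p i‖ₑ with hB
  have hBf : B ≠ ∞ := (ENNReal.sum_lt_top.2 fun i _ => enorm_lt_top).ne
  have hwb : ∀ k t i, ‖w k t i‖ₑ ≤ B * iteratedMass mm k t := by
    intro k
    induction k with
    | zero =>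
      intro t i
      simp only [iteratedMass, mul_one]
      exact Finset.single_le_sum (f := fun i => ‖p i‖ₑ) (fun _ _ => zero_le) (Finset.mem_univ i)
    | succ k ih =>
      intro t i
      calc ‖w (k + 1) t i‖ₑ ≤ ∫⁻ r in Iio t, ‖(K r).mulVec (w k r) i‖ₑ ∂m :=
            enorm_integral_le_lintegral_enorm _
        _ ≤ ∫⁻ r in Iio t, κ r * (B * iteratedMass mm k r) ∂m :=
            lintegral_mono fun r => hmul r _ _ (ih r) i
        _ = ∫⁻ r in Iio t, B * iteratedMass mm k r ∂mm := by
            rw [hmm, setLIntegral_withDensity_eq_setLIntegral_mul _ hκm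
              ((measurable_iteratedMass k).const_mul B) measurableSet_Iio]
            rfl
        _ = B * iteratedMass mm (k + 1) t := by
            rw [lintegral_const_mul _ (measurable_iteratedMass k)]
            rfl
  set b : ℕ → ℝ := fun k => B.toReal * ((mm univ).toReal ^ k / k.factorial) with hb
  have hbs : Summable b := (Real.summable_pow_div_factorial _).mul_left _
  have hwr : ∀ k t i, ‖w k t i‖ ≤ b k := by
    intro k t i
    have hk : (k.factorial : ℝ≥0∞) ≠ 0 := by exact_mod_cast k.factorial_ne_zero
    have h1 : iteratedMass mm k t ≤ mm univ ^ k / k.factorial := by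
      rw [ENNReal.le_div_iff_mul_le (Or.inl hk) (Or.inl (ENNReal.natCast_ne_top _)), mul_comm]
      exact factorial_mul_iteratedMass_le k t
    have h2 : ‖w k t i‖ₑ ≤ B * (mm univ ^ k / k.factorial) := (hwb k t i).trans (by gcongr)
    have h3 : B * (mm univ ^ k / k.factorial) ≠ ∞ :=
      ENNReal.mul_ne_top hBf (ENNReal.div_ne_top (ENNReal.pow_ne_top (measure_ne_top _ _)) hk)
    have h4 := ENNReal.toReal_mono h3 h2
    simpa [hb] using h4
  have hws : ∀ t i, Summable fun k => w k t i := fun t i =>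
    Summable.of_norm_bounded hbs fun k => hwr k t i
  set v : ℝ → Fin n → ℂ := fun t i => ∑' k, w k t i with hv
  refine ⟨v, fun i => ?_, ⟨∑' k, b k, fun t i => ?_⟩, fun t i => ?_⟩
  · refine measurable_of_tendsto_metrizable
      (f := fun N t => ∑ k ∈ Finset.range N, w k t i)
      (fun N => Finset.measurable_fun_sum _ fun k _ => hwm k i) (tendsto_pi_nhds.2 fun t => ?_)
    exact (hws t i).hasSum.tendsto_sum_nat
  · exact tsum_of_norm_bounded hbs.hasSum fun k => hwr k t i
  · set κr : ℝ → ℝ := fun r => ∑ i, ∑ j, ‖K r i j‖ with hκr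
    have hκri : Integrable κr m :=
      integrable_finsetSum _ fun i _ => integrable_finsetSum _ fun j _ => (hK i j).norm
    have hbound : ∀ k r, ‖(K r).mulVec (w k r) i‖ ≤ κr r * b k := by
      intro k r
      have hb0 : 0 ≤ b k := (norm_nonneg _).trans (hwr k r i)
      calc ‖(K r).mulVec (w k r) i‖ ≤ ∑ j, ‖K r i j * w k r j‖ := by
            rw [Matrix.mulVec, dotProduct]
            exact norm_sum_le _ _
        _ ≤ ∑ j, ‖K r i j‖ * b k := by
            refine Finset.sum_le_sum fun j _ => ?_
            rw [norm_mul]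
            gcongr
            exact hwr k r j
        _ = (∑ j, ‖K r i j‖) * b k := by rw [Finset.sum_mul]
        _ ≤ κr r * b k := by
            gcongr
            exact Finset.single_le_sum (f := fun i => ∑ j, ‖K r i j‖)
              (fun _ _ => Finset.sum_nonneg fun _ _ => norm_nonneg _) (Finset.mem_univ i)
    have hint : ∀ k, Integrable (fun r => (K r).mulVec (w k r) i) (m.restrict (Iio t)) :=
      fun k => ((hκri.mul_const (b k)).mono' (hmulm (hwm k) i).aestronglyMeasurable
        (Eventually.of_forall (hbound k))).restrict
    have hsum : Summable fun k => ∫ r in Iio t, ‖(K r).mulVec (w k r) i‖ ∂m := by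
      refine Summable.of_nonneg_of_le (fun k => integral_nonneg fun _ => norm_nonneg _)
        (fun k => ?_) (hbs.mul_left (∫ r in Iio t, κr r ∂m))
      rw [← integral_mul_const]
      exact integral_mono (hint k).norm (hκri.restrict.mul_const _) (hbound k)
    -- Sum and integral are interchanged, after which the series without its zeroth term is the
    -- integral of the full series.
    have key := hasSum_integral_of_summable_integral_norm hint hsum
    have hpt : ∀ r, ∑' k, (K r).mulVec (w k r) i = (K r).mulVec (v r) i := by
      intro r
      simp only [Matrix.mulVec, dotProduct, hv]
      rw [Summable.tsum_finsetSum fun j _ => (hws r j).mul_left _]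
      simp_rw [tsum_mul_left]
    simp_rw [hpt] at key
    rw [← key.tsum_eq]
    exact (hws t i).tsum_eq_zero_add

end Volterra

/-! ### Solutions on an interval without bad points -/

section Existence

open scoped ENNReal

variable {n : ℕ}

theorem norm_mulVec_le (M : Matrix (Fin n) (Fin n) ℂ) (x : Fin n → ℂ) :
    ‖M.mulVec x‖ ≤ (∑ i, ∑ j, ‖M i j‖) * ‖x‖ := by
  have h0 : 0 ≤ ∑ i, ∑ j, ‖M i j‖ :=
    Finset.sum_nonneg fun _ _ => Finset.sum_nonneg fun _ _ => norm_nonneg _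
  refine (pi_norm_le_iff_of_nonneg (mul_nonneg h0 (norm_nonneg x))).2 fun i => ?_
  calc ‖M.mulVec x i‖ ≤ ∑ j, ‖M i j * x j‖ := by
        rw [Matrix.mulVec, dotProduct]
        exact norm_sum_le _ _
    _ ≤ ∑ j, ‖M i j‖ * ‖x‖ := by
        refine Finset.sum_le_sum fun j _ => ?_
        rw [norm_mul]
        gcongr
        exact norm_le_pi_norm x j
    _ = (∑ j, ‖M i j‖) * ‖x‖ := by rw [Finset.sum_mul]
    _ ≤ _ := by
        exact mul_le_mul_of_nonneg_right (Finset.single_le_sum (f := fun i => ∑ j, ‖M i j‖)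
          (fun _ _ => Finset.sum_nonneg fun _ _ => norm_nonneg _) (Finset.mem_univ i))
          (norm_nonneg x)

/-- A column y of the inverse satisfies y = x + M y with x a unit vector, so ‖y‖ ≤ 1 + ½‖y‖. -/
theorem norm_inv_one_sub_apply_le {M : Matrix (Fin n) (Fin n) ℂ} (hM : ∑ i, ∑ j, ‖M i j‖ ≤ 1 / 2)
    (hdet : (1 - M).det ≠ 0) (i j : Fin n) : ‖(1 - M)⁻¹ i j‖ ≤ 2 := by
  set x : Fin n → ℂ := Pi.single j 1 with hx
  set y := (1 - M)⁻¹.mulVec x with hy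
  have hxn : ‖x‖ ≤ 1 := (pi_norm_le_iff_of_nonneg zero_le_one).2 fun k => by
    rcases eq_or_ne k j with h | h <;> simp [hx, h]
  have h1 : y = x + M.mulVec y := by
    have : (1 - M).mulVec y = x := by
      rw [hy, Matrix.mulVec_mulVec, Matrix.mul_nonsing_inv _ (isUnit_iff_ne_zero.2 hdet),
        Matrix.one_mulVec]
    rw [Matrix.sub_mulVec, Matrix.one_mulVec] at this
    rw [← this, sub_add_cancel]
  have h2 : ‖y‖ ≤ ‖x‖ + 1 / 2 * ‖y‖ := by
    calc ‖y‖ = ‖x + M.mulVec y‖ := by rw [← h1]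
      _ ≤ ‖x‖ + ‖M.mulVec y‖ := norm_add_le _ _
      _ ≤ _ := by
        gcongr
        exact (norm_mulVec_le M y).trans (by gcongr)
  have h3 : (1 - M)⁻¹ i j = y i := by simp [hy, hx, Matrix.mulVec_single]
  rw [h3]
  linarith [norm_le_pi_norm y i]

theorem countable_setOf_measure_singleton_ne_zero (ν : Measure ℝ) [IsFiniteMeasure ν] :
    {t : ℝ | ν {t} ≠ 0}.Countable := by
  have := Measure.countable_meas_pos_of_disjoint_iUnion (μ := ν) (As := fun t : ℝ => {t})
    (fun t => measurableSet_singleton t) (fun s t hst => by simpa using hst)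
  simpa [pos_iff_ne_zero] using this

/-- Each such t has mass at least 1 for the finite measure g⁺ν. -/
theorem finite_setOf_one_le_mul_measure_singleton (ν : Measure ℝ) [IsFiniteMeasure ν] {g : ℝ → ℝ}
    (hg : Integrable g ν) : {t : ℝ | 1 ≤ ν.real {t} * g t}.Finite := by
  have hfin : IsFiniteMeasure (ν.withDensity fun t => ENNReal.ofReal (g t)) :=
    isFiniteMeasure_withDensity_ofReal hg.2
  refine (Measure.finite_const_le_meas_of_disjoint_iUnion
    (ν.withDensity fun t => ENNReal.ofReal (g t)) one_pos (As := fun t : ℝ => {t})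
    (fun t => measurableSet_singleton t) (fun s t hst => by simpa using hst)
    (measure_ne_top _ _)).subset fun t ht => ?_
  rw [Set.mem_ofPred_eq] at ht ⊢
  rw [withDensity_apply _ (measurableSet_singleton t), lintegral_singleton]
  rw [← ENNReal.ofReal_one]
  refine (ENNReal.ofReal_le_ofReal ht).trans ?_
  rw [ENNReal.ofReal_mul measureReal_nonneg, ofReal_measureReal, mul_comm]

theorem setIntegral_Iic_restrict {ν : Measure ℝ} [IsFiniteMeasure ν] {I : Set ℝ} {φ : ℝ → ℂ}
    (hφ : IntegrableOn φ I ν) {t : ℝ} (ht : t ∈ I) :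
    ∫ r in Iic t, φ r ∂ν.restrict I
      = (∫ r in Iio t, φ r ∂ν.restrict I) + ν.real {t} * φ t := by
  have hφ' : Integrable φ (ν.restrict I) := hφ
  rw [← Iio_union_right, setIntegral_union (by simp) (measurableSet_singleton t)
    hφ'.integrableOn hφ'.integrableOn, integral_singleton,
    measureReal_restrict_apply (measurableSet_singleton t),
    inter_eq_self_of_subset_left (singleton_subset_iff.2 ht), Complex.real_smul]

variable {a b c d : EReal} {J : Matrix (Fin n) (Fin n) ℂ} {Q W : ℝ → Matrix (Fin n) (Fin n) ℂ}
  {ν : Measure ℝ} {ρQ ρW : ℝ → Matrix (Fin n) (Fin n) ℂ} {μ : ℂ}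

/-- The left limit v = u⁻ is taken as the unknown: with M = ½ν{t}A one has u = (1 - M)⁻¹ v, and v
solves the Volterra equation with kernel A(1 - M)⁻¹. Invertibility of 1 - M is that of B₊ = J(1 -
M). -/
theorem IsCoefficientDensity.exists_isSolution (h : IsCoefficientDensity a b Q W ν ρQ ρW)
    (hJ : IsUnit J) (hac : a ≤ c) (hdb : d ≤ b) (hcd : c < d)
    (hB : ∀ t ∈ openInterval c d, (Bplus J Q W t μ).det ≠ 0) (p : Fin n → ℂ) :
    ∃ u : ℝ → Fin n → ℂ, IsSolution J Q W μ c d u ∧ (∀ i, Measurable fun t => u t i) ∧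
      (∃ C, ∀ t ∈ openInterval c d, ∀ i, ‖u t i‖ ≤ C) ∧ Tendsto u (downTo c) (𝓝 p) ∧
      ∃ q, Tendsto u (upTo d) (𝓝 q) := by
  have hν := h.finite
  set I := openInterval c d with hI
  have hIm : MeasurableSet I := measurableSet_openInterval c d
  set A := generator J ρQ ρW μ with hA
  have hAm : ∀ i j, Measurable fun t => A t i j := fun i j => h.measurable_generator i j
  have hAi : ∀ i j, Integrable (fun t => A t i j) ν := fun i j => h.integrable_generator i j
  set M : ℝ → Matrix (Fin n) (Fin n) ℂ := fun t => ((1 / 2 : ℂ) * ν.real {t}) • A t with hM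
  have hdet : ∀ t ∈ I, (1 - M t).det ≠ 0 := by
    intro t ht h0
    refine hB t ht ?_
    rw [h.bplus_eq hJ (openInterval_subset_openInterval hac hdb ht)]
    have : J - ((1 / 2 : ℂ) * ν.real {t}) • (J * generator J ρQ ρW μ t) = J * (1 - M t) := by
      rw [mul_sub, mul_one, hM, Matrix.mul_smul]
    rw [this, Matrix.det_mul, h0, mul_zero]
  set T : ℝ → Matrix (Fin n) (Fin n) ℂ := fun t => (1 - M t)⁻¹ with hT
  have hTm : ∀ i j, Measurable fun t => T t i j := by
    intro i j
    -- T is the identity off the countably many atoms of ν.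
    refine (measurable_const (a := (1 : Matrix (Fin n) (Fin n) ℂ) i j)).measurable_of_countable_ne
      ((countable_setOf_measure_singleton_ne_zero ν).mono fun t ht => ?_)
    rw [Set.mem_ofPred_eq] at ht ⊢
    contrapose! ht
    simp [hT, hM, measureReal_def, ht]
  obtain ⟨C, hC⟩ : ∃ C, ∀ t ∈ I, ∀ i j, ‖T t i j‖ ≤ C := by
    set S := {t : ℝ | 1 ≤ ν.real {t} * ∑ i, ∑ j, ‖A t i j‖} with hS
    have hSf : S.Finite := finite_setOf_one_le_mul_measure_singleton ν
      (integrable_finsetSum _ fun i _ => integrable_finsetSum _ fun j _ => (hAi i j).norm)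
    obtain ⟨C, hC⟩ := (hSf.image fun t => ∑ i, ∑ j, ‖T t i j‖).bddAbove
    refine ⟨max 2 C, fun t ht i j => ?_⟩
    by_cases htS : t ∈ S
    · refine le_trans ?_ ((hC (mem_image_of_mem _ htS)).trans (le_max_right _ _))
      exact (Finset.single_le_sum (f := fun j => ‖T t i j‖) (fun _ _ => norm_nonneg _)
        (Finset.mem_univ j)).trans (Finset.single_le_sum (f := fun i => ∑ j, ‖T t i j‖)
        (fun _ _ => Finset.sum_nonneg fun _ _ => norm_nonneg _) (Finset.mem_univ i))
    · refine (norm_inv_one_sub_apply_le ?_ (hdet t ht) i j).trans (le_max_left _ _)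
      have h1 : ν.real {t} * ∑ i, ∑ j, ‖A t i j‖ < 1 := not_le.1 htS
      have h2 : ∑ i, ∑ j, ‖M t i j‖ = 1 / 2 * (ν.real {t} * ∑ i, ∑ j, ‖A t i j‖) := by
        simp_rw [← mul_assoc, Finset.mul_sum]
        refine Finset.sum_congr rfl fun i _ => Finset.sum_congr rfl fun j _ => ?_
        simp only [hM, Matrix.smul_apply, smul_eq_mul, norm_mul, Complex.norm_real,
          Real.norm_of_nonneg measureReal_nonneg]
        norm_num
      rw [h2]
      linarith
  set m := ν.restrict I with hm
  set K : ℝ → Matrix (Fin n) (Fin n) ℂ := fun t => A t * T t with hK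
  have hKm : ∀ i j, Measurable fun t => K t i j := fun i j => by
    simp only [hK, Matrix.mul_apply]
    exact Finset.measurable_fun_sum _ fun k _ => (hAm i k).mul (hTm k j)
  have hKi : ∀ i j, Integrable (fun t => K t i j) m := fun i j => by
    simp only [hK, Matrix.mul_apply]
    refine integrable_finsetSum _ fun k _ => (hAi i k).restrict.mul_bdd (c := C)
      (hTm k j).aestronglyMeasurable ?_
    filter_upwards [ae_restrict_mem hIm] with t ht using hC t ht k j
  obtain ⟨v, hvm, ⟨D, hD⟩, hv⟩ := exists_volterra_solution hKm hKi p
  set u : ℝ → Fin n → ℂ := fun t => (T t).mulVec (v t) with hu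
  have hAu : ∀ t, (A t).mulVec (u t) = (K t).mulVec (v t) := fun t => by
    simp only [hu, hK, Matrix.mulVec_mulVec]
  have hint : ∀ i, IntegrableOn (fun r => (A r).mulVec (u r) i) I ν := fun i => by
    simp_rw [hAu]
    simp only [Matrix.mulVec, dotProduct]
    exact integrable_finsetSum _ fun j _ => (hKi i j).mul_bdd (c := D)
      (hvm j).aestronglyMeasurable (Eventually.of_forall fun t => hD t j)
  have huv : ∀ t ∈ I, u t = v t + (M t).mulVec (u t) := fun t ht => by
    have h1 : (1 - M t).mulVec (u t) = v t := by
      rw [hu, Matrix.mulVec_mulVec, hT,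
        Matrix.mul_nonsing_inv _ (isUnit_iff_ne_zero.2 (hdet t ht)), Matrix.one_mulVec]
    rw [Matrix.sub_mulVec, Matrix.one_mulVec] at h1
    rw [← h1, sub_add_cancel]
  have huI : ∀ t ∈ I, ∀ i, u t i = p i + (1 / 2) *
      ((∫ r in Iio t, (A r).mulVec (u r) i ∂m) + ∫ r in Iic t, (A r).mulVec (u r) i ∂m) := by
    intro t ht i
    have h1 := setIntegral_Iic_restrict (hint i) ht
    have h2 := congrFun (huv t ht) i
    rw [Pi.add_apply, hv t i] at h2
    simp_rw [← hAu] at h2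
    rw [h2, h1]
    simp only [hM, Matrix.smul_mulVec, Pi.smul_apply, smul_eq_mul]
    ring
  refine ⟨u, h.isSolution_of_integral hJ hac hdb hint huI, fun i => ?_, ⟨∑ _j : Fin n, C * D, ?_⟩,
    ?_, fun i => p i + ∫ r in I, (A r).mulVec (u r) i ∂ν, ?_⟩
  · simp only [hu, Matrix.mulVec, dotProduct]
    exact Finset.measurable_fun_sum _ fun j _ => (hTm i j).mul (hvm j)
  · intro t ht i
    simp only [hu, Matrix.mulVec, dotProduct]
    refine (norm_sum_le _ _).trans (Finset.sum_le_sum fun j _ => ?_)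
    rw [norm_mul]
    exact mul_le_mul (hC t ht i j) (hD t j) (norm_nonneg _) ((norm_nonneg _).trans (hC t ht i j))
  · refine tendsto_pi_nhds.2 fun i => ?_
    have h1 := (((tendsto_setIntegral_downTo hcd (hint i) (T := Iio) (fun _ => measurableSet_Iio)
      fun _ => Iio_subset_Iic_self).add (tendsto_setIntegral_downTo hcd (hint i) (T := Iic)
      (fun _ => measurableSet_Iic) fun _ => Subset.rfl)).const_mul (1 / 2 : ℂ)).const_add (p i)
    rw [add_zero, mul_zero, add_zero] at h1
    refine h1.congr' ?_
    filter_upwards [eventually_mem_downTo hcd] with t ht using (huI t ht i).symm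
  · refine tendsto_pi_nhds.2 fun i => ?_
    have h1 := (((tendsto_setIntegral_upTo hcd (hint i) (T := Iio) (fun _ => measurableSet_Iio)
      fun _ => Subset.rfl).add (tendsto_setIntegral_upTo hcd (hint i) (T := Iic)
      (fun _ => measurableSet_Iic) fun _ => Iio_subset_Iic_self)).const_mul
      (1 / 2 : ℂ)).const_add (p i)
    have h2 : p i + ∫ r in I, (A r).mulVec (u r) i ∂ν = p i + 1 / 2 *
        ((∫ r in I, (A r).mulVec (u r) i ∂ν) + ∫ r in I, (A r).mulVec (u r) i ∂ν) := by ring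
    rw [h2]
    refine h1.congr' ?_
    filter_upwards [eventually_mem_upTo hcd] with t ht using (huI t ht i).symm

end Existence

/-! ### Integration by parts for balanced primitives -/

section ProductRule

variable {m : Measure ℝ} [SFinite m] {f g : ℝ → ℂ}

theorem integral_mul_integral_eq_integral_indicator {S : Set (ℝ × ℝ)} (hS : MeasurableSet S)
    (hf : Integrable f m) (hg : Integrable g m) :
    (Integrable (fun y => (∫ x in {x | (x, y) ∈ S}, f x ∂m) * g y) m ∧
      ∫ p in S, f p.1 * g p.2 ∂m.prod m = ∫ y, (∫ x in {x | (x, y) ∈ S}, f x ∂m) * g y ∂m) ∧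
    (Integrable (fun x => f x * ∫ y in {y | (x, y) ∈ S}, g y ∂m) m ∧
      ∫ p in S, f p.1 * g p.2 ∂m.prod m = ∫ x, f x * ∫ y in {y | (x, y) ∈ S}, g y ∂m ∂m) := by
  have hi : Integrable (S.indicator fun p => f p.1 * g p.2) (m.prod m) :=
    (hf.mul_prod hg).indicator hS
  have h1 : ∀ y, ∫ x, S.indicator (fun p => f p.1 * g p.2) (x, y) ∂m
      = (∫ x in {x | (x, y) ∈ S}, f x ∂m) * g y := fun y => by
    rw [← integral_mul_const, ← integral_indicator
      (show MeasurableSet {x | (x, y) ∈ S} from measurable_prodMk_right hS)]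
    rfl
  have h2 : ∀ x, ∫ y, S.indicator (fun p => f p.1 * g p.2) (x, y) ∂m
      = f x * ∫ y in {y | (x, y) ∈ S}, g y ∂m := fun x => by
    rw [← integral_const_mul, ← integral_indicator
      (show MeasurableSet {y | (x, y) ∈ S} from measurable_prodMk_left hS)]
    rfl
  have h3 := hi.integral_prod_right
  have h4 := hi.integral_prod_left
  simp_rw [h1] at h3
  simp_rw [h2] at h4
  rw [← integral_indicator hS]
  refine ⟨⟨h3, ?_⟩, h4, ?_⟩
  · simp_rw [integral_prod_symm _ hi, h1]
  · simp_rw [integral_prod _ hi, h2]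

/-- The product of two integrals is an integral over the plane, which is cut once along x ≤ y and
once along x < y. Averaging the two cuts shares the diagonal equally, so that balanced primitives
occur and no correction term from atoms remains. -/
theorem integral_mul_integral_eq (hf : Integrable f m) (hg : Integrable g m) (p q : ℂ) :
    (p + ∫ r, f r ∂m) * (q + ∫ r, g r ∂m) = p * q + ∫ r,
      ((p + 1 / 2 * ((∫ x in Iio r, f x ∂m) + ∫ x in Iic r, f x ∂m)) * g r
        + f r * (q + 1 / 2 * ((∫ x in Iio r, g x ∂m) + ∫ x in Iic r, g x ∂m))) ∂m ∧
    Integrable (fun r =>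
      (p + 1 / 2 * ((∫ x in Iio r, f x ∂m) + ∫ x in Iic r, f x ∂m)) * g r
        + f r * (q + 1 / 2 * ((∫ x in Iio r, g x ∂m) + ∫ x in Iic r, g x ∂m))) m := by
  have hle : MeasurableSet {p : ℝ × ℝ | p.1 ≤ p.2} := measurableSet_le measurable_fst measurable_snd
  have hlt : MeasurableSet {p : ℝ × ℝ | p.1 < p.2} := measurableSet_lt measurable_fst measurable_snd
  obtain ⟨⟨a1, b1⟩, -⟩ := integral_mul_integral_eq_integral_indicator hle hf hg
  obtain ⟨⟨a2, b2⟩, -⟩ := integral_mul_integral_eq_integral_indicator hlt hf hg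
  obtain ⟨-, a3, b3⟩ := integral_mul_integral_eq_integral_indicator hle.compl hf hg
  obtain ⟨-, a4, b4⟩ := integral_mul_integral_eq_integral_indicator hlt.compl hf hg
  have e1 : ∀ y : ℝ, {x | (x, y) ∈ {p : ℝ × ℝ | p.1 ≤ p.2}} = Iic y := fun y => rfl
  have e2 : ∀ y : ℝ, {x | (x, y) ∈ {p : ℝ × ℝ | p.1 < p.2}} = Iio y := fun y => rfl
  have e3 : ∀ x : ℝ, {y | (x, y) ∈ {p : ℝ × ℝ | p.1 ≤ p.2}ᶜ} = Iio x := fun x => by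
    ext; simp
  have e4 : ∀ x : ℝ, {y | (x, y) ∈ {p : ℝ × ℝ | p.1 < p.2}ᶜ} = Iic x := fun x => by
    ext; simp
  simp_rw [e1] at a1 b1
  simp_rw [e2] at a2 b2
  simp_rw [e3] at a3 b3
  simp_rw [e4] at a4 b4
  have c1 := integral_add_compl hle (hf.mul_prod hg)
  have c2 := integral_add_compl hlt (hf.mul_prod hg)
  rw [integral_prod_mul] at c1 c2
  rw [b1, b3] at c1
  rw [b2, b4] at c2
  have heq : ∀ r, (p + 1 / 2 * ((∫ x in Iio r, f x ∂m) + ∫ x in Iic r, f x ∂m)) * g r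
        + f r * (q + 1 / 2 * ((∫ x in Iio r, g x ∂m) + ∫ x in Iic r, g x ∂m))
      = (p * g r + q * f r) + 1 / 2 * ((((∫ x in Iic r, f x ∂m) * g r)
        + f r * ∫ x in Iio r, g x ∂m) + (((∫ x in Iio r, f x ∂m) * g r)
        + f r * ∫ x in Iic r, g x ∂m)) := fun r => by ring
  simp_rw [heq]
  have i1 := (hg.const_mul p).add (hf.const_mul q)
  have i2 := ((a1.add a3).add (a2.add a4)).const_mul (1 / 2 : ℂ)
  refine ⟨?_, i1.add i2⟩
  have := integral_add i1 i2
  simp only [Pi.add_apply] at this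
  rw [this, integral_add (hg.const_mul p) (hf.const_mul q), integral_const_mul, integral_const_mul,
    integral_const_mul]
  have h3 := integral_add (a1.add a3) (a2.add a4)
  simp only [Pi.add_apply] at h3
  rw [h3, integral_add a1 a3, integral_add a2 a4, c1, c2]
  ring

end ProductRule

/-! ### Lagrange's identity -/

section Lagrange

variable {n : ℕ} {a b c d : EReal} {J : Matrix (Fin n) (Fin n) ℂ}
  {Q W : ℝ → Matrix (Fin n) (Fin n) ℂ}
  {ν : Measure ℝ} {ρQ ρW : ℝ → Matrix (Fin n) (Fin n) ℂ} {μ : ℂ} {u y : ℝ → Fin n → ℂ}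

/-- J A(μ) = -(ρQ - μ ρW), whose adjoint is the same expression with μ conjugated; skewness of J
supplies the sign. This is the infinitesimal form of Lagrange's identity. -/
theorem mul_generator_add (hJ : IsUnit J) (hJskew : J.conjTranspose = -J) {t : ℝ}
    (hQ : (ρQ t).IsHermitian) (hW : (ρW t).IsHermitian) :
    (generator J ρQ ρW (starRingEnd ℂ μ) t).conjTranspose * J = -(J * generator J ρQ ρW μ t) := by
  have h1 : (generator J ρQ ρW (starRingEnd ℂ μ) t).conjTranspose * J
      = -(J * generator J ρQ ρW (starRingEnd ℂ μ) t).conjTranspose := by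
    rw [Matrix.conjTranspose_mul, hJskew, mul_neg, neg_neg]
  rw [h1, mul_generator hJ, mul_generator hJ, Matrix.conjTranspose_neg, Matrix.conjTranspose_sub,
    Matrix.conjTranspose_smul, hQ.eq, hW.eq]
  simp

namespace IsCoefficientDensity

/-- Puts a solution on [s, t) into the form of the balanced primitives in
`integral_mul_integral_eq`. -/
theorem eq_leftVal_add_half (h : IsCoefficientDensity a b Q W ν ρQ ρW) (hJ : IsUnit J)
    (hac : a ≤ c) (hdb : d ≤ b)
    (hu : IsSolution J Q W μ c d u) {s t : ℝ} (hs : s ∈ openInterval c d)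
    (ht : t ∈ openInterval c d) {r : ℝ} (hr : r ∈ Ico s t) (i : Fin n) :
    u r i = leftVal u s i + 1 / 2 *
      ((∫ x in Iio r, (generator J ρQ ρW μ x).mulVec (u x) i ∂ν.restrict (Ico s t))
        + ∫ x in Iic r, (generator J ρQ ρW μ x).mulVec (u x) i ∂ν.restrict (Ico s t)) := by
  have hν := h.finite
  have hrI := Icc_subset_openInterval hs ht ⟨hr.1, hr.2.le⟩
  have h1 : Iio r ∩ Ico s t = Ico s r := by
    ext x
    simp only [mem_inter_iff, mem_Iio, mem_Ico]
    have := hr.2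
    constructor
    · rintro ⟨h1, h2, -⟩; exact ⟨h2, h1⟩
    · rintro ⟨h1, h2⟩; exact ⟨h2, h1, h2.trans this⟩
  have h2 : Iic r ∩ Ico s t = Ico s r ∪ {r} := by
    rw [← Iio_union_right, union_inter_distrib_right, h1,
      inter_eq_self_of_subset_left (singleton_subset_iff.2 hr)]
  have hint := h.integrableOn_Icc (μ := μ) hu hs ht i
  rw [Measure.restrict_restrict measurableSet_Iio, Measure.restrict_restrict measurableSet_Iic,
    h1, h2, setIntegral_union (by simp) (measurableSet_singleton r)
      (hint.mono_set fun x hx => ⟨hx.1, hx.2.le.trans hr.2.le⟩)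
      (hint.mono_set (singleton_subset_iff.2 ⟨hr.1, hr.2.le⟩)), integral_singleton]
  have h3 := h.leftVal_eq_add hJ hac hdb hu hs hrI hr.1 i
  have h4 := congrFun (h.eq_leftVal_add hJ hac hdb hu hrI) i
  rw [h4, Pi.add_apply, h3, Pi.smul_apply, smul_eq_mul, Complex.real_smul]
  ring

/-- By the product rule the increment over [s, t) is the integral of y* J A(μ) u + (A(μ̄) y)* J u,
whose integrand vanishes identically by `mul_generator_add`. -/
theorem dotProduct_leftVal_eq (h : IsCoefficientDensity a b Q W ν ρQ ρW) (hJ : IsUnit J)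
    (hJskew : J.conjTranspose = -J) (hac : a ≤ c) (hdb : d ≤ b)
    (hy : IsSolution J Q W (starRingEnd ℂ μ) c d y) (hu : IsSolution J Q W μ c d u) {s t : ℝ}
    (hs : s ∈ openInterval c d) (ht : t ∈ openInterval c d) :
    star (leftVal y t) ⬝ᵥ J.mulVec (leftVal u t) = star (leftVal y s) ⬝ᵥ J.mulVec (leftVal u s) := by
  wlog hst : s ≤ t generalizing s t
  · exact (this ht hs (le_of_not_ge hst)).symm
  have hν := h.finite
  set m := ν.restrict (Ico s t) with hm
  set f : Fin n → ℝ → ℂ := fun i r =>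
    starRingEnd ℂ ((generator J ρQ ρW (starRingEnd ℂ μ) r).mulVec (y r) i) with hf
  set g : Fin n → ℝ → ℂ := fun i r => (generator J ρQ ρW μ r).mulVec (u r) i with hg
  have hgi : ∀ i, Integrable (g i) m := fun i =>
    (h.integrableOn_Icc hu hs ht i).mono_set Ico_subset_Icc_self
  have hfi : ∀ i, Integrable (f i) m := fun i =>
    (RCLike.conjCLE (K := ℂ)).toContinuousLinearMap.integrable_comp
      ((h.integrableOn_Icc hy hs ht i).mono_set Ico_subset_Icc_self)
  have hut : ∀ i, leftVal u t i = leftVal u s i + ∫ r, g i r ∂m := fun i =>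
    h.leftVal_eq_add hJ hac hdb hu hs ht hst i
  have hyt : ∀ i, star (leftVal y t i) = star (leftVal y s i) + ∫ r, f i r ∂m := fun i => by
    rw [h.leftVal_eq_add hJ hac hdb hy hs ht hst i, star_add, hf, integral_conj]
    rfl
  have hur : ∀ r ∈ Ico s t, ∀ i, u r i = leftVal u s i
      + 1 / 2 * ((∫ x in Iio r, g i x ∂m) + ∫ x in Iic r, g i x ∂m) := fun r hr i =>
    h.eq_leftVal_add_half hJ hac hdb hu hs ht hr i
  have hyr : ∀ r ∈ Ico s t, ∀ i, star (y r i) = star (leftVal y s i)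
      + 1 / 2 * ((∫ x in Iio r, f i x ∂m) + ∫ x in Iic r, f i x ∂m) := fun r hr i => by
    rw [h.eq_leftVal_add_half hJ hac hdb hy hs ht hr i, hf, integral_conj, integral_conj]
    simp [hm]
  have key : ∀ i j, star (leftVal y t i) * leftVal u t j = star (leftVal y s i) * leftVal u s j
      + ∫ r, (star (y r i) * g j r + f i r * u r j) ∂m ∧
      Integrable (fun r => star (y r i) * g j r + f i r * u r j) m := fun i j => by
    obtain ⟨h1, h2⟩ := integral_mul_integral_eq (hfi i) (hgi j) (star (leftVal y s i))
      (leftVal u s j)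
    have hae : (fun r => (star (leftVal y s i)
        + 1 / 2 * ((∫ x in Iio r, f i x ∂m) + ∫ x in Iic r, f i x ∂m)) * g j r
        + f i r * (leftVal u s j + 1 / 2 * ((∫ x in Iio r, g j x ∂m) + ∫ x in Iic r, g j x ∂m)))
        =ᵐ[m] fun r => star (y r i) * g j r + f i r * u r j := by
      filter_upwards [ae_restrict_mem measurableSet_Ico] with r hr
      rw [← hyr r hr i, ← hur r hr j]
    refine ⟨?_, h2.congr hae⟩
    rw [← integral_congr_ae hae, hyt, hut, h1]
  have hbil : ∀ x z : Fin n → ℂ, star x ⬝ᵥ J.mulVec z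
      = ∑ i, ∑ j, J i j * (star (x i) * z j) := fun x z => by
    simp only [dotProduct, Matrix.mulVec, Finset.mul_sum, Pi.star_apply]
    exact Finset.sum_congr rfl fun i _ => Finset.sum_congr rfl fun j _ => by ring
  have hzero : ∀ r, ∑ i, ∑ j, J i j * (star (y r i) * g j r + f i r * u r j) = 0 := fun r => by
    have h1 : star (y r) ⬝ᵥ J.mulVec ((generator J ρQ ρW μ r).mulVec (u r))
        + star ((generator J ρQ ρW (starRingEnd ℂ μ) r).mulVec (y r)) ⬝ᵥ J.mulVec (u r) = 0 := by
      rw [Matrix.star_mulVec, ← Matrix.dotProduct_mulVec, Matrix.mulVec_mulVec,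
        Matrix.mulVec_mulVec, mul_generator_add hJ hJskew (h.left.isHermitian r)
        (h.right.isHermitian r), Matrix.neg_mulVec, dotProduct_neg, add_neg_cancel]
    rw [← h1, hbil, hbil, ← Finset.sum_add_distrib]
    simp_rw [← Finset.sum_add_distrib]
    exact Finset.sum_congr rfl fun i _ => Finset.sum_congr rfl fun j _ => mul_add _ _ _
  have hzero' : ∑ i, ∑ j, J i j * ∫ r, (star (y r i) * g j r + f i r * u r j) ∂m = 0 := by
    have h2 : ∀ i, ∑ j, J i j * ∫ r, (star (y r i) * g j r + f i r * u r j) ∂m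
        = ∫ r, ∑ j, J i j * (star (y r i) * g j r + f i r * u r j) ∂m := fun i => by
      rw [integral_finsetSum _ fun j _ => (key i j).2.const_mul (J i j)]
      simp_rw [integral_const_mul]
    rw [Finset.sum_congr rfl fun i _ => h2 i]
    refine (integral_finsetSum _ fun i _ =>
      integrable_finsetSum _ fun j _ => (key i j).2.const_mul (J i j)).symm.trans ?_
    simp_rw [hzero, integral_zero]
  rw [hbil, hbil]
  simp_rw [(key _ _).1, mul_add, Finset.sum_add_distrib]
  rw [hzero', add_zero]

end IsCoefficientDensity

end Lagrange

/-! ### Fundamental matrices and brackets on an interval without bad points -/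

section Interval

variable {n : ℕ} {a b c d : EReal} {J : Matrix (Fin n) (Fin n) ℂ}
  {Q W : ℝ → Matrix (Fin n) (Fin n) ℂ}
  {ν : Measure ℝ} {ρQ ρW : ℝ → Matrix (Fin n) (Fin n) ℂ} {μ : ℂ} {u u' : ℝ → Fin n → ℂ}
  {U : ℝ → Matrix (Fin n) (Fin n) ℂ}

/-- The bracket is built from left limits, whereas limits at the ends are given for u. Closed
neighbourhoods pass from u to its left limits, so both have the same limits at c and d. -/
theorem IsSolution.eventually_leftVal_mem (hu : IsSolution J Q W μ c d u) {c' d' : EReal}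
    (hc : c ≤ c') (hd : d' ≤ d) {S : Set (Fin n → ℂ)} (hS : IsClosed S)
    (h : ∀ t ∈ openInterval c' d', u t ∈ S) : ∀ t ∈ openInterval c' d', leftVal u t ∈ S := by
  intro t ht
  refine hS.mem_of_tendsto (hu.tendsto_leftVal (openInterval_subset_openInterval hc hd ht)) ?_
  filter_upwards [nhdsWithin_le_nhds ((isOpen_openInterval c' d').mem_nhds ht)] with r hr using h r hr

theorem IsSolution.tendsto_leftVal_downTo (hu : IsSolution J Q W μ c d u) (hcd : c < d)
    {p : Fin n → ℂ} (h : Tendsto u (downTo c) (𝓝 p)) : Tendsto (leftVal u) (downTo c) (𝓝 p) := by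
  refine (closed_nhds_basis p).tendsto_right_iff.2 fun S hS => ?_
  obtain ⟨e, he, heS⟩ := (eventually_downTo hcd).1 (h.eventually hS.1)
  exact (eventually_downTo hcd).2 ⟨e, he, hu.eventually_leftVal_mem le_rfl he.2.le hS.2 heS⟩

theorem IsSolution.tendsto_leftVal_upTo (hu : IsSolution J Q W μ c d u) (hcd : c < d)
    {p : Fin n → ℂ} (h : Tendsto u (upTo d) (𝓝 p)) : Tendsto (leftVal u) (upTo d) (𝓝 p) := by
  refine (closed_nhds_basis p).tendsto_right_iff.2 fun S hS => ?_
  obtain ⟨e, he, heS⟩ := (eventually_upTo hcd).1 (h.eventually hS.1)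
  exact (eventually_upTo hcd).2 ⟨e, he, hu.eventually_leftVal_mem he.1.le le_rfl hS.2 heS⟩

/-- The entrywise left limit of a matrix-valued function. -/
noncomputable def leftMat (U : ℝ → Matrix (Fin n) (Fin n) ℂ) (t : ℝ) : Matrix (Fin n) (Fin n) ℂ :=
  Matrix.of fun i l => leftLim (fun r => U r i l) t

/-- The columns of `U` are solutions. -/
def IsMatrixSolution (J : Matrix (Fin n) (Fin n) ℂ) (Q W : ℝ → Matrix (Fin n) (Fin n) ℂ) (μ : ℂ)
    (c d : EReal) (U : ℝ → Matrix (Fin n) (Fin n) ℂ) : Prop :=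
  ∀ l, IsSolution J Q W μ c d fun t i => U t i l

theorem tendsto_matrix_iff {α : Type*} {l : Filter α} {V : α → Matrix (Fin n) (Fin n) ℂ}
    {M : Matrix (Fin n) (Fin n) ℂ} :
    Tendsto V l (𝓝 M) ↔ ∀ k, Tendsto (fun t i => V t i k) l (𝓝 fun i => M i k) := by
  constructor
  · exact fun h k => tendsto_pi_nhds.2 fun i => tendsto_pi_nhds.1 (tendsto_pi_nhds.1 h i) k
  · exact fun h => tendsto_pi_nhds.2 fun i => tendsto_pi_nhds.2 fun k => tendsto_pi_nhds.1 (h k) i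

theorem tendsto_conjTranspose_mulVec {α : Type*} {l : Filter α}
    {V : α → Matrix (Fin n) (Fin n) ℂ} {M : Matrix (Fin n) (Fin n) ℂ} {w : α → Fin n → ℂ}
    {p : Fin n → ℂ} (hV : Tendsto V l (𝓝 M)) (hw : Tendsto w l (𝓝 p)) :
    Tendsto (fun t => (V t).conjTranspose.mulVec (J.mulVec (w t))) l
      (𝓝 (M.conjTranspose.mulVec (J.mulVec p))) := by
  have hV' : ∀ i j, Tendsto (fun t => V t i j) l (𝓝 (M i j)) := fun i j =>
    tendsto_pi_nhds.1 (tendsto_pi_nhds.1 hV i) j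
  have hw' := fun i => tendsto_pi_nhds.1 hw i
  refine tendsto_pi_nhds.2 fun i => ?_
  simp only [Matrix.mulVec, dotProduct, Matrix.conjTranspose_apply]
  exact tendsto_finsetSum _ fun j _ => ((continuous_star.tendsto _).comp (hV' j i)).mul
    (tendsto_finsetSum _ fun k _ => (hw' k).const_mul _)
theorem tendsto_conjTranspose_mul {α : Type*} {l : Filter α}
    {V Z : α → Matrix (Fin n) (Fin n) ℂ} {M P : Matrix (Fin n) (Fin n) ℂ}
    (hV : Tendsto V l (𝓝 M)) (hZ : Tendsto Z l (𝓝 P)) :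
    Tendsto (fun t => (V t).conjTranspose * (J * Z t)) l (𝓝 (M.conjTranspose * (J * P))) := by
  refine tendsto_pi_nhds.2 fun i => tendsto_pi_nhds.2 fun k => ?_
  exact tendsto_pi_nhds.1 (tendsto_conjTranspose_mulVec (J := J) hV
    (tendsto_pi_nhds.2 fun i => tendsto_pi_nhds.1 (tendsto_pi_nhds.1 hZ i) k)) i

theorem IsMatrixSolution.tendsto_leftMat_downTo (hU : IsMatrixSolution J Q W μ c d U) (hcd : c < d)
    {M : Matrix (Fin n) (Fin n) ℂ} (h : Tendsto U (downTo c) (𝓝 M)) :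
    Tendsto (leftMat U) (downTo c) (𝓝 M) :=
  tendsto_matrix_iff.2 fun l => (hU l).tendsto_leftVal_downTo hcd (tendsto_matrix_iff.1 h l)

theorem IsMatrixSolution.tendsto_leftMat_upTo (hU : IsMatrixSolution J Q W μ c d U) (hcd : c < d)
    {M : Matrix (Fin n) (Fin n) ℂ} (h : Tendsto U (upTo d) (𝓝 M)) :
    Tendsto (leftMat U) (upTo d) (𝓝 M) :=
  tendsto_matrix_iff.2 fun l => (hU l).tendsto_leftVal_upTo hcd (tendsto_matrix_iff.1 h l)

theorem leftMat_eq_of_tendsto {t : ℝ} {M : Matrix (Fin n) (Fin n) ℂ}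
    (h : Tendsto U (𝓝[<] t) (𝓝 M)) : leftMat U t = M := by
  ext i l
  exact leftLim_eq_of_tendsto (tendsto_pi_nhds.1 (tendsto_pi_nhds.1 h i) l)

/-- The Lagrange bracket of the columns of `U` with `u`. -/
noncomputable def bracket (J : Matrix (Fin n) (Fin n) ℂ) (U : ℝ → Matrix (Fin n) (Fin n) ℂ)
    (u : ℝ → Fin n → ℂ) (t : ℝ) : Fin n → ℂ :=
  (leftMat U t).conjTranspose.mulVec (J.mulVec (leftVal u t))

theorem isUnit_of_conjTranspose_mul_mul {V Z : Matrix (Fin n) (Fin n) ℂ} (hJ : IsUnit J)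
    (h : V.conjTranspose * (J * Z) = J) : IsUnit V := by
  rw [Matrix.isUnit_iff_isUnit_det, isUnit_iff_ne_zero] at hJ ⊢
  intro h0
  apply hJ
  rw [← h, Matrix.det_mul, Matrix.det_conjTranspose, h0, star_zero, zero_mul]

theorem mulVec_injective_of_det_ne_zero {M : Matrix (Fin n) (Fin n) ℂ} (hM : M.det ≠ 0) :
    Injective M.mulVec :=
  Matrix.mulVec_injective_of_isUnit ((Matrix.isUnit_iff_isUnit_det M).2 (isUnit_iff_ne_zero.2 hM))

namespace IsCoefficientDensity

theorem conjTranspose_bplus (h : IsCoefficientDensity a b Q W ν ρQ ρW)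
    (hJskew : J.conjTranspose = -J) {t : ℝ} (ht : t ∈ openInterval a b) (μ : ℂ) :
    (Bplus J Q W t (starRingEnd ℂ μ)).conjTranspose = -Bminus J Q W t μ := by
  rw [Bplus, Bminus, h.jump_left ht, h.jump_right ht]
  simp only [Matrix.conjTranspose_add, Matrix.conjTranspose_sub, Matrix.conjTranspose_smul,
    (h.left.isHermitian t).eq, (h.right.isHermitian t).eq, hJskew]
  simp
  abel

theorem conjTranspose_bminus (h : IsCoefficientDensity a b Q W ν ρQ ρW)
    (hJskew : J.conjTranspose = -J) {t : ℝ} (ht : t ∈ openInterval a b) (μ : ℂ) :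
    (Bminus J Q W t (starRingEnd ℂ μ)).conjTranspose = -Bplus J Q W t μ := by
  rw [Bplus, Bminus, h.jump_left ht, h.jump_right ht]
  simp only [Matrix.conjTranspose_sub, Matrix.conjTranspose_smul,
    (h.left.isHermitian t).eq, (h.right.isHermitian t).eq, hJskew]
  simp
  abel

theorem bracket_eq (h : IsCoefficientDensity a b Q W ν ρQ ρW) (hJ : IsUnit J)
    (hJskew : J.conjTranspose = -J) (hac : a ≤ c) (hdb : d ≤ b)
    (hU : IsMatrixSolution J Q W (starRingEnd ℂ μ) c d U) (hu : IsSolution J Q W μ c d u)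
    {s t : ℝ} (hs : s ∈ openInterval c d) (ht : t ∈ openInterval c d) :
    bracket J U u t = bracket J U u s :=
  funext fun l => h.dotProduct_leftVal_eq hJ hJskew hac hdb (hU l) hu hs ht

theorem bracket_eq_of_tendsto_downTo (h : IsCoefficientDensity a b Q W ν ρQ ρW) (hJ : IsUnit J)
    (hJskew : J.conjTranspose = -J) (hac : a ≤ c) (hdb : d ≤ b) (hcd : c < d)
    (hU : IsMatrixSolution J Q W (starRingEnd ℂ μ) c d U) (hu : IsSolution J Q W μ c d u)
    {M : Matrix (Fin n) (Fin n) ℂ} {p : Fin n → ℂ} (hM : Tendsto U (downTo c) (𝓝 M))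
    (hp : Tendsto u (downTo c) (𝓝 p)) {t : ℝ} (ht : t ∈ openInterval c d) :
    bracket J U u t = M.conjTranspose.mulVec (J.mulVec p) := by
  have := downTo_neBot hcd
  have h1 : Tendsto (bracket J U u) (downTo c) (𝓝 (M.conjTranspose.mulVec (J.mulVec p))) :=
    tendsto_conjTranspose_mulVec (hU.tendsto_leftMat_downTo hcd hM) (hu.tendsto_leftVal_downTo hcd hp)
  refine tendsto_nhds_unique (tendsto_const_nhds.congr' ?_) h1
  filter_upwards [eventually_mem_downTo hcd] with s hs using
    h.bracket_eq hJ hJskew hac hdb hU hu hs ht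

theorem bracket_eq_of_tendsto_upTo (h : IsCoefficientDensity a b Q W ν ρQ ρW) (hJ : IsUnit J)
    (hJskew : J.conjTranspose = -J) (hac : a ≤ c) (hdb : d ≤ b) (hcd : c < d)
    (hU : IsMatrixSolution J Q W (starRingEnd ℂ μ) c d U) (hu : IsSolution J Q W μ c d u)
    {M : Matrix (Fin n) (Fin n) ℂ} {p : Fin n → ℂ} (hM : Tendsto U (upTo d) (𝓝 M))
    (hp : Tendsto u (upTo d) (𝓝 p)) {t : ℝ} (ht : t ∈ openInterval c d) :
    bracket J U u t = M.conjTranspose.mulVec (J.mulVec p) := by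
  have := upTo_neBot hcd
  have h1 : Tendsto (bracket J U u) (upTo d) (𝓝 (M.conjTranspose.mulVec (J.mulVec p))) :=
    tendsto_conjTranspose_mulVec (hU.tendsto_leftMat_upTo hcd hM) (hu.tendsto_leftVal_upTo hcd hp)
  refine tendsto_nhds_unique (tendsto_const_nhds.congr' ?_) h1
  filter_upwards [eventually_mem_upTo hcd] with s hs using
    h.bracket_eq hJ hJskew hac hdb hU hu hs ht

theorem exists_isMatrixSolution (h : IsCoefficientDensity a b Q W ν ρQ ρW) (hJ : IsUnit J)
    (hac : a ≤ c) (hdb : d ≤ b) (hcd : c < d)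
    (hB : ∀ t ∈ openInterval c d, (Bplus J Q W t μ).det ≠ 0) :
    ∃ U, IsMatrixSolution J Q W μ c d U ∧ Tendsto U (downTo c) (𝓝 1) ∧
      ∃ M, Tendsto U (upTo d) (𝓝 M) := by
  choose u hu _ _ h0 q hq using fun l : Fin n => h.exists_isSolution hJ hac hdb hcd hB
    fun i => (1 : Matrix (Fin n) (Fin n) ℂ) i l
  exact ⟨fun t => Matrix.of fun i l => u l t i, hu, tendsto_matrix_iff.2 h0,
    Matrix.of fun i l => q l i, tendsto_matrix_iff.2 hq⟩

/-- The brackets are constant and tend to 1* J 1 at the left end. -/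
theorem matrix_bracket_eq (h : IsCoefficientDensity a b Q W ν ρQ ρW) (hJ : IsUnit J)
    (hJskew : J.conjTranspose = -J) (hac : a ≤ c) (hdb : d ≤ b) (hcd : c < d)
    {Z : ℝ → Matrix (Fin n) (Fin n) ℂ}
    (hU : IsMatrixSolution J Q W (starRingEnd ℂ μ) c d U) (hZ : IsMatrixSolution J Q W μ c d Z)
    (hU1 : Tendsto U (downTo c) (𝓝 1)) (hZ1 : Tendsto Z (downTo c) (𝓝 1)) {t : ℝ}
    (ht : t ∈ openInterval c d) : (leftMat U t).conjTranspose * (J * leftMat Z t) = J := by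
  ext i l
  have h1 := congrFun (h.bracket_eq_of_tendsto_downTo hJ hJskew hac hdb hcd hU (hZ l) hU1
    (tendsto_matrix_iff.1 hZ1 l) ht) i
  rw [Matrix.conjTranspose_one, Matrix.one_mulVec] at h1
  have h2 : J.mulVec (fun i => (1 : Matrix (Fin n) (Fin n) ℂ) i l) i = J i l := by
    simp [Matrix.mulVec, dotProduct, Matrix.one_apply]
  rw [← h2, ← h1]
  rfl

/-- Away from bad points B₊ u = J u⁻ can be solved for u. -/
theorem eqOn_of_leftVal_eq (h : IsCoefficientDensity a b Q W ν ρQ ρW) (hJ : IsUnit J)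
    (hac : a ≤ c) (hdb : d ≤ b) (hB : ∀ t ∈ openInterval c d, (Bplus J Q W t μ).det ≠ 0)
    (hu : IsSolution J Q W μ c d u) (hu' : IsSolution J Q W μ c d u')
    (heq : ∀ t ∈ openInterval c d, leftVal u' t = leftVal u t) : EqOn u' u (openInterval c d) := by
  intro t ht
  refine mulVec_injective_of_det_ne_zero (hB t ht) ?_
  rw [h.bplus_mulVec hJ hac hdb hu ht, h.bplus_mulVec hJ hac hdb hu' ht, heq t ht]

/-- On an interval without bad points a fundamental matrix is invertible, and it has an invertible
limit at the right endpoint. -/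
theorem isUnit_leftMat (h : IsCoefficientDensity a b Q W ν ρQ ρW) (hJ : IsUnit J)
    (hJskew : J.conjTranspose = -J) (hac : a ≤ c) (hdb : d ≤ b) (hcd : c < d)
    (hB : ∀ t ∈ openInterval c d, (Bplus J Q W t μ).det ≠ 0)
    (hB' : ∀ t ∈ openInterval c d, (Bplus J Q W t (starRingEnd ℂ μ)).det ≠ 0)
    (hU : IsMatrixSolution J Q W (starRingEnd ℂ μ) c d U) (hU1 : Tendsto U (downTo c) (𝓝 1)) :
    (∀ t ∈ openInterval c d, IsUnit (leftMat U t)) ∧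
      ∃ M, IsUnit M ∧ Tendsto U (upTo d) (𝓝 M) := by
  -- Z pairs with U for invertibility. Nothing is known yet about U at d, so U is compared with a
  -- solution matrix Y constructed with a limit there: U* J Z = J = Y* J Z forces equal left limits,
  -- hence Y = U.
  obtain ⟨Z, hZ, hZ1, Zd, hZd⟩ := h.exists_isMatrixSolution hJ hac hdb hcd hB
  obtain ⟨Y, hY, hY1, Yd, hYd⟩ := h.exists_isMatrixSolution hJ hac hdb hcd hB'
  have hUZ := fun t ht => h.matrix_bracket_eq hJ hJskew hac hdb hcd hU hZ hU1 hZ1 (t := t) ht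
  have hYZ := fun t ht => h.matrix_bracket_eq hJ hJskew hac hdb hcd hY hZ hY1 hZ1 (t := t) ht
  refine ⟨fun t ht => isUnit_of_conjTranspose_mul_mul hJ (hUZ t ht), Yd, ?_, ?_⟩
  · refine isUnit_of_conjTranspose_mul_mul hJ (Z := Zd) ?_
    have := upTo_neBot hcd
    have h1 : Tendsto (fun t => (leftMat Y t).conjTranspose * (J * leftMat Z t)) (upTo d)
        (𝓝 (Yd.conjTranspose * (J * Zd))) :=
      tendsto_conjTranspose_mul (hY.tendsto_leftMat_upTo hcd hYd) (hZ.tendsto_leftMat_upTo hcd hZd)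
    refine tendsto_nhds_unique h1 (tendsto_const_nhds.congr' ?_)
    filter_upwards [eventually_mem_upTo hcd] with s hs using (hYZ s hs).symm
  · have hleft : ∀ t ∈ openInterval c d, leftMat Y t = leftMat U t := fun t ht => by
      have hu : IsUnit (J * leftMat Z t) := by
        have := hJ
        rw [← hUZ t ht, Matrix.isUnit_iff_isUnit_det, Matrix.det_mul] at this
        exact (Matrix.isUnit_iff_isUnit_det _).2 (isUnit_of_mul_isUnit_right this)
      exact Matrix.conjTranspose_injective (hu.mul_left_injective
        ((hYZ t ht).trans (hUZ t ht).symm))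
    refine hYd.congr' ?_
    filter_upwards [eventually_mem_upTo hcd] with s hs
    ext i l
    exact congrFun (h.eqOn_of_leftVal_eq hJ hac hdb hB' (hU l) (hY l) (fun t ht => funext fun i =>
      congrFun (congrFun (hleft t ht) i) l) hs) i

theorem eqOn_of_bracket_eq (h : IsCoefficientDensity a b Q W ν ρQ ρW) (hJ : IsUnit J)
    (hJskew : J.conjTranspose = -J) (hac : a ≤ c) (hdb : d ≤ b) (hcd : c < d)
    (hB : ∀ t ∈ openInterval c d, (Bplus J Q W t μ).det ≠ 0)
    (hB' : ∀ t ∈ openInterval c d, (Bplus J Q W t (starRingEnd ℂ μ)).det ≠ 0)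
    (hU : IsMatrixSolution J Q W (starRingEnd ℂ μ) c d U) (hU1 : Tendsto U (downTo c) (𝓝 1))
    (hu : IsSolution J Q W μ c d u) (hu' : IsSolution J Q W μ c d u')
    (heq : ∀ t ∈ openInterval c d, bracket J U u' t = bracket J U u t) :
    EqOn u' u (openInterval c d) := by
  refine h.eqOn_of_leftVal_eq hJ hac hdb hB hu hu' fun t ht => ?_
  refine Matrix.mulVec_injective_of_isUnit hJ (Matrix.mulVec_injective_of_isUnit
    ((Matrix.isUnit_conjTranspose _).2 ((h.isUnit_leftMat hJ hJskew hac hdb hcd hB hB' hU hU1).1 t ht))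
    (heq t ht))

theorem eq_zero_of_bracket_eq_zero (h : IsCoefficientDensity a b Q W ν ρQ ρW) (hJ : IsUnit J)
    (hJskew : J.conjTranspose = -J) (hac : a ≤ c) (hdb : d ≤ b) (hcd : c < d)
    (hB : ∀ t ∈ openInterval c d, (Bplus J Q W t μ).det ≠ 0)
    (hB' : ∀ t ∈ openInterval c d, (Bplus J Q W t (starRingEnd ℂ μ)).det ≠ 0)
    (hU : IsMatrixSolution J Q W (starRingEnd ℂ μ) c d U) (hU1 : Tendsto U (downTo c) (𝓝 1))
    (hu : IsSolution J Q W μ c d u) {s : ℝ} (hs : s ∈ openInterval c d)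
    (h0 : bracket J U u s = 0) {t : ℝ} (ht : t ∈ openInterval c d) : u t = 0 := by
  have h1 : leftVal u t = 0 := by
    refine Matrix.mulVec_injective_of_isUnit hJ (Matrix.mulVec_injective_of_isUnit
      ((Matrix.isUnit_conjTranspose _).2
        ((h.isUnit_leftMat hJ hJskew hac hdb hcd hB hB' hU hU1).1 t ht)) ?_)
    rw [Matrix.mulVec_zero, Matrix.mulVec_zero, ← h0]
    exact h.bracket_eq hJ hJskew hac hdb hU hu hs ht
  refine mulVec_injective_of_det_ne_zero (hB t ht) ?_
  rw [h.bplus_mulVec hJ hac hdb hu ht, h1, Matrix.mulVec_zero, Matrix.mulVec_zero]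

end IsCoefficientDensity

end Interval

/-! ### Combinatorics of the partition -/

section Partition

variable {N : ℕ} {a b : EReal} {x : Fin N → ℝ}

@[simp] theorem leftEnd_zero : leftEnd a x 0 = a := rfl

@[simp] theorem leftEnd_succ (j : Fin N) : leftEnd a x j.succ = x j := rfl

@[simp] theorem rightEnd_castSucc (j : Fin N) : rightEnd b x j.castSucc = x j := by
  simp [rightEnd]

@[simp] theorem rightEnd_last : rightEnd b x (Fin.last N) = b := by
  simp [rightEnd]

theorem le_leftEnd (hx : ∀ j, x j ∈ openInterval a b) (k : Fin (N + 1)) : a ≤ leftEnd a x k := by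
  cases k using Fin.cases with
  | zero => exact le_rfl
  | succ j => exact (hx j).1.le

theorem rightEnd_le (hx : ∀ j, x j ∈ openInterval a b) (k : Fin (N + 1)) : rightEnd b x k ≤ b := by
  cases k using Fin.lastCases with
  | last => simp
  | cast j => simpa using (hx j).2.le

theorem leftEnd_lt_rightEnd (hab : a < b) (hx : ∀ j, x j ∈ openInterval a b) (hxm : StrictMono x)
    (k : Fin (N + 1)) : leftEnd a x k < rightEnd b x k := by
  cases k using Fin.lastCases with
  | last =>
    rw [rightEnd_last]
    generalize Fin.last N = k
    cases k using Fin.cases with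
    | zero => exact hab
    | succ j => exact (hx j).2
  | cast j =>
    rw [rightEnd_castSucc]
    generalize hk : j.castSucc = k
    cases k using Fin.cases with
    | zero => exact (hx j).1
    | succ i =>
      rw [leftEnd_succ]
      exact_mod_cast hxm (by rw [Fin.lt_def]; have := congrArg Fin.val hk; simp at this; omega)

theorem rightEnd_le_leftEnd (hxm : StrictMono x) {k k' : Fin (N + 1)} (hk : k < k') :
    rightEnd b x k ≤ leftEnd a x k' := by
  cases k using Fin.lastCases with
  | last => exact absurd hk (Fin.le_last k').not_gt
  | cast j =>
    cases k' using Fin.cases with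
    | zero => exact absurd hk (Fin.zero_le _).not_gt
    | succ i =>
      rw [rightEnd_castSucc, leftEnd_succ]
      exact_mod_cast hxm.monotone (Fin.castSucc_lt_succ_iff.1 hk)

theorem eq_of_mem_openInterval (hxm : StrictMono x) {k k' : Fin (N + 1)} {t : ℝ}
    (hk : t ∈ openInterval (leftEnd a x k) (rightEnd b x k))
    (hk' : t ∈ openInterval (leftEnd a x k') (rightEnd b x k')) : k = k' := by
  rcases lt_trichotomy k k' with h | h | h
  · exact absurd (hk.2.trans_le (rightEnd_le_leftEnd (a := a) hxm h)) hk'.1.not_gt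
  · exact h
  · exact absurd (hk'.2.trans_le (rightEnd_le_leftEnd (a := a) hxm h)) hk.1.not_gt

theorem notMem_openInterval (hxm : StrictMono x) (j : Fin N) (k : Fin (N + 1)) :
    x j ∉ openInterval (leftEnd a x k) (rightEnd b x k) := by
  intro h
  rcases lt_or_ge j.castSucc k with hk | hk
  · have := rightEnd_le_leftEnd (a := a) (b := b) hxm hk
    rw [rightEnd_castSucc] at this
    exact h.1.not_ge this
  · have := rightEnd_le_leftEnd (a := a) (b := b) hxm (hk.trans_lt Fin.castSucc_lt_succ)
    rw [leftEnd_succ] at this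
    exact h.2.not_ge this

theorem exists_mem_openInterval {t : ℝ} (ht : t ∈ openInterval a b) (htx : t ∉ range x) :
    ∃ k, t ∈ openInterval (leftEnd a x k) (rightEnd b x k) := by
  classical
  set S : Finset (Fin (N + 1)) := {k | leftEnd a x k < t} with hS
  have hne : S.Nonempty := ⟨0, by simpa [hS] using ht.1⟩
  -- The interval containing t is the last one whose left end lies below t.
  obtain ⟨k, hk, hmax⟩ := S.exists_max_image id hne
  refine ⟨k, by simpa [hS] using hk, ?_⟩
  cases k using Fin.lastCases with
  | last => simpa using ht.2
  | cast j =>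
    rw [rightEnd_castSucc]
    by_contra hlt
    have h1 : x j < t := lt_of_le_of_ne (by exact_mod_cast not_lt.1 hlt) fun h => htx ⟨j, h⟩
    have h2 := hmax j.succ (by simpa [hS] using h1)
    exact absurd h2 (not_le.2 Fin.castSucc_lt_succ)

end Partition

/-! ### The kernels of the adjoint block matrices -/

section Blocks

variable {n N : ℕ} {J : Matrix (Fin n) (Fin n) ℂ} {Q W : ℝ → Matrix (Fin n) (Fin n) ℂ} {lam : ℂ}
  {x : Fin N → ℝ} {U : Fin (N + 1) → ℝ → Matrix (Fin n) (Fin n) ℂ}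

/-- The vectors `B₋(x_j, λ) v_j`, indexed by the interval to the right of `x_j`. -/
noncomputable def incoming (J : Matrix (Fin n) (Fin n) ℂ) (Q W : ℝ → Matrix (Fin n) (Fin n) ℂ)
    (lam : ℂ) (x : Fin N → ℝ) (v : Fin N × Fin n → ℂ) : Fin (N + 1) → Fin n → ℂ :=
  Fin.cons (α := fun _ => Fin n → ℂ) 0 fun j => (Bminus J Q W (x j) lam).mulVec fun i => v (j, i)

/-- The vectors `U_{j-1}(x_j)* B₊(x_j, λ) v_j`, indexed by the interval to the left of `x_j`. -/
noncomputable def outgoing (J : Matrix (Fin n) (Fin n) ℂ) (Q W : ℝ → Matrix (Fin n) (Fin n) ℂ)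
    (lam : ℂ) (x : Fin N → ℝ) (U : Fin (N + 1) → ℝ → Matrix (Fin n) (Fin n) ℂ)
    (v : Fin N × Fin n → ℂ) : Fin (N + 1) → Fin n → ℂ :=
  Fin.snoc (α := fun _ => Fin n → ℂ)
    (fun j => (transfer x U j).conjTranspose.mulVec
      ((Bplus J Q W (x j) lam).mulVec fun i => v (j, i))) 0

variable {v : Fin N × Fin n → ℂ}

@[simp] theorem incoming_zero : incoming J Q W lam x v 0 = 0 := rfl

@[simp] theorem incoming_succ (j : Fin N) : incoming J Q W lam x v j.succ
    = (Bminus J Q W (x j) lam).mulVec fun i => v (j, i) := rfl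

@[simp] theorem outgoing_castSucc (j : Fin N) : outgoing J Q W lam x U v j.castSucc
    = (transfer x U j).conjTranspose.mulVec
      ((Bplus J Q W (x j) lam).mulVec fun i => v (j, i)) := by
  simp [outgoing]

@[simp] theorem outgoing_last : outgoing J Q W lam x U v (Fin.last N) = 0 := by
  simp [outgoing]

theorem incoming_eq_sum (k : Fin (N + 1)) : incoming J Q W lam x v k
    = ∑ j : Fin N, if k = j.succ then (Bminus J Q W (x j) lam).mulVec fun i => v (j, i) else 0 := by
  cases k using Fin.cases with
  | zero => simp [(Fin.succ_ne_zero _).symm]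
  | succ j => simp [Fin.succ_inj]

theorem outgoing_eq_sum (k : Fin (N + 1)) : outgoing J Q W lam x U v k
    = ∑ j : Fin N, if k = j.castSucc then (transfer x U j).conjTranspose.mulVec
      ((Bplus J Q W (x j) lam).mulVec fun i => v (j, i)) else 0 := by
  cases k using Fin.lastCases with
  | last => simp [(Fin.castSucc_ne_last _).symm]
  | cast j => simp [Fin.castSucc_inj]

/-- Block column k meets at most two block rows. Taking adjoints turns -B₋(λ̄)U into U* B₊(λ) and
B₊(λ̄) into -B₋(λ). The zero entries of `incoming` at the first and of `outgoing` at the last index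
stand for the row that is missing there. -/
theorem conjTranspose_blockB_mulVec
    (hplus : ∀ j, (Bplus J Q W (x j) (starRingEnd ℂ lam)).conjTranspose = -Bminus J Q W (x j) lam)
    (hminus : ∀ j, (Bminus J Q W (x j) (starRingEnd ℂ lam)).conjTranspose = -Bplus J Q W (x j) lam)
    (k : Fin (N + 1)) (l : Fin n) :
    (blockB J Q W (starRingEnd ℂ lam) x U).conjTranspose.mulVec v (k, l)
      = outgoing J Q W lam x U v k l - incoming J Q W lam x v k l := by
  rw [outgoing_eq_sum, incoming_eq_sum, Finset.sum_apply, Finset.sum_apply,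
    ← Finset.sum_sub_distrib, Matrix.mulVec, dotProduct, Fintype.sum_prod_type]
  refine Finset.sum_congr rfl fun j _ => ?_
  by_cases h1 : k = j.castSucc
  · have h2 : k ≠ j.succ := fun h => Fin.castSucc_lt_succ.ne (h1.symm.trans h)
    have h3 : (-(Bminus J Q W (x j) (starRingEnd ℂ lam) * transfer x U j)).conjTranspose.mulVec
        (fun i => v (j, i)) = (transfer x U j).conjTranspose.mulVec
          ((Bplus J Q W (x j) lam).mulVec fun i => v (j, i)) := by
      rw [Matrix.conjTranspose_neg, Matrix.conjTranspose_mul, hminus, mul_neg, neg_neg,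
        Matrix.mulVec_mulVec]
    rw [if_pos h1, if_neg h2, ← h3, Pi.zero_apply, sub_zero]
    simp only [Matrix.mulVec, dotProduct, Matrix.conjTranspose_apply, blockB, Matrix.of_apply,
      if_pos h1]
  · rw [if_neg h1, Pi.zero_apply, zero_sub]
    by_cases h2 : k = j.succ
    · have h3 : (Bplus J Q W (x j) (starRingEnd ℂ lam)).conjTranspose.mulVec (fun i => v (j, i))
          = -(Bminus J Q W (x j) lam).mulVec fun i => v (j, i) := by
        rw [hplus, Matrix.neg_mulVec]
      rw [if_pos h2, ← Pi.neg_apply, ← h3]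
      simp only [Matrix.mulVec, dotProduct, Matrix.conjTranspose_apply, blockB, Matrix.of_apply,
        if_neg h1, if_pos h2]
    · rw [if_neg h2]
      simp [blockB, h1, h2]

theorem mem_kerAdjoint_blockB_iff
    (hplus : ∀ j, (Bplus J Q W (x j) (starRingEnd ℂ lam)).conjTranspose = -Bminus J Q W (x j) lam)
    (hminus : ∀ j, (Bminus J Q W (x j) (starRingEnd ℂ lam)).conjTranspose = -Bplus J Q W (x j) lam) :
    v ∈ kerAdjoint (blockB J Q W (starRingEnd ℂ lam) x U) ↔
      ∀ k, outgoing J Q W lam x U v k = incoming J Q W lam x v k := by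
  rw [kerAdjoint, LinearMap.mem_ker, Matrix.mulVecLin_apply, funext_iff, Prod.forall]
  refine forall_congr' fun k => ?_
  rw [funext_iff]
  refine forall_congr' fun l => ?_
  rw [conjTranspose_blockB_mulVec hplus hminus, Pi.zero_apply, sub_eq_zero]

theorem mem_kerAdjoint_blockBm_iff
    (hplus : ∀ j, (Bplus J Q W (x j) (starRingEnd ℂ lam)).conjTranspose = -Bminus J Q W (x j) lam)
    (hminus : ∀ j, (Bminus J Q W (x j) (starRingEnd ℂ lam)).conjTranspose = -Bplus J Q W (x j) lam) :
    v ∈ kerAdjoint (blockBm J Q W (starRingEnd ℂ lam) x U) ↔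
      ∀ k, k ≠ 0 → k ≠ Fin.last N →
        outgoing J Q W lam x U v k = incoming J Q W lam x v k := by
  rw [kerAdjoint, LinearMap.mem_ker, Matrix.mulVecLin_apply, funext_iff, Prod.forall, Subtype.forall]
  refine forall_congr' fun k => ?_
  rw [← and_imp]
  refine forall_congr' fun _ => ?_
  rw [funext_iff]
  refine forall_congr' fun l => ?_
  rw [← sub_eq_zero (b := incoming J Q W lam x v k l), ← conjTranspose_blockB_mulVec hplus hminus]
  rfl

end Blocks

/-! ### From solutions on (a, b) to kernel vectors: brackets, uniqueness and supports -/

section Gluing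

variable {n N : ℕ} {a b : EReal} {J : Matrix (Fin n) (Fin n) ℂ}
  {Q W : ℝ → Matrix (Fin n) (Fin n) ℂ} {ν : Measure ℝ} {ρQ ρW : ℝ → Matrix (Fin n) (Fin n) ℂ}
  {lam : ℂ} {x : Fin N → ℝ} {U : Fin (N + 1) → ℝ → Matrix (Fin n) (Fin n) ℂ}

theorem vanishesAtEnds_of_compactlySupported {u : ℝ → Fin n → ℂ} (hab : a < b)
    (hc : CompactlySupported a b u) :
    VanishesAtEnds a b u := by
  obtain ⟨K, hK, hKI, hK0⟩ := hc
  rcases K.eq_empty_or_nonempty with rfl | hne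
  · constructor <;> refine tendsto_const_nhds.congr' ?_
    · filter_upwards [eventually_mem_downTo hab] with t ht using (hK0 t ht (notMem_empty t)).symm
    · filter_upwards [eventually_mem_upTo hab] with t ht using (hK0 t ht (notMem_empty t)).symm
  constructor <;> refine tendsto_const_nhds.congr' ?_
  · obtain ⟨e, he, hmin⟩ := hK.exists_isLeast hne
    refine (eventually_downTo hab).2 ⟨e, hKI he, fun t ht => (hK0 t ?_ fun htK => ?_).symm⟩
    · exact ⟨ht.1, ht.2.trans (hKI he).2⟩
    · exact (hmin htK).not_gt (by exact_mod_cast ht.2)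
  · obtain ⟨e, he, hmax⟩ := hK.exists_isGreatest hne
    refine (eventually_upTo hab).2 ⟨e, hKI he, fun t ht => (hK0 t ?_ fun htK => ?_).symm⟩
    · exact ⟨(hKI he).1.trans ht.1, ht.2⟩
    · exact (hmax htK).not_gt (by exact_mod_cast ht.1)

/-- A first order system with densities, on an interval which is partitioned by points among which
are all the bad points. -/
structure IsPartitionedSystem (a b : EReal) (J : Matrix (Fin n) (Fin n) ℂ)
    (Q W : ℝ → Matrix (Fin n) (Fin n) ℂ) (ν : Measure ℝ) (ρQ ρW : ℝ → Matrix (Fin n) (Fin n) ℂ)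
    (lam : ℂ) (x : Fin N → ℝ) : Prop where
  density : IsCoefficientDensity a b Q W ν ρQ ρW
  isUnit : IsUnit J
  skew : J.conjTranspose = -J
  pos : 0 < N
  strictMono : StrictMono x
  mem : ∀ j, x j ∈ openInterval a b
  bad : badPoints J Q W a b lam ⊆ range x

namespace IsPartitionedSystem

variable (h : IsPartitionedSystem a b J Q W ν ρQ ρW lam x)
include h

theorem lt : a < b := (h.mem ⟨0, h.pos⟩).1.trans (h.mem ⟨0, h.pos⟩).2

theorem leftEnd_lt (k : Fin (N + 1)) : leftEnd a x k < rightEnd b x k :=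
  leftEnd_lt_rightEnd h.lt h.mem h.strictMono k

theorem mem_of_mem {k : Fin (N + 1)} {t : ℝ}
    (ht : t ∈ openInterval (leftEnd a x k) (rightEnd b x k)) : t ∈ openInterval a b :=
  openInterval_subset_openInterval (le_leftEnd h.mem k) (rightEnd_le h.mem k) ht

theorem bplus_conj (j : Fin N) :
    (Bplus J Q W (x j) (starRingEnd ℂ lam)).conjTranspose = -Bminus J Q W (x j) lam :=
  h.density.conjTranspose_bplus h.skew (h.mem j) lam

theorem bminus_conj (j : Fin N) :
    (Bminus J Q W (x j) (starRingEnd ℂ lam)).conjTranspose = -Bplus J Q W (x j) lam :=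
  h.density.conjTranspose_bminus h.skew (h.mem j) lam

/-- Off Ξ_λ both B₊(λ) and B₋(λ) are invertible, and -B₋(λ) is the adjoint of B₊(λ̄). So the
condition at λ alone also permits solving at the conjugate parameter. -/
theorem det_ne_zero {k : Fin (N + 1)} {t : ℝ}
    (ht : t ∈ openInterval (leftEnd a x k) (rightEnd b x k)) :
    (Bplus J Q W t lam).det ≠ 0 ∧ (Bplus J Q W t (starRingEnd ℂ lam)).det ≠ 0 := by
  have h1 : (Bplus J Q W t lam).det * (Bminus J Q W t lam).det ≠ 0 := fun h0 => by
    obtain ⟨j, rfl⟩ := h.bad ⟨h.mem_of_mem ht, h0⟩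
    exact notMem_openInterval h.strictMono j k ht
  refine ⟨left_ne_zero_of_mul h1, fun h0 => right_ne_zero_of_mul h1 ?_⟩
  have h2 := congrArg Matrix.det (h.density.conjTranspose_bplus h.skew (h.mem_of_mem ht) lam)
  rw [Matrix.det_conjTranspose, h0, star_zero, Matrix.det_neg] at h2
  exact (mul_eq_zero.1 h2.symm).resolve_left (pow_ne_zero _ (by norm_num))

theorem exists_isFundamentalSystem :
    ∃ U, IsFundamentalSystem J Q W (starRingEnd ℂ lam) a b x U := by
  choose U hU hU1 _ _ using fun k : Fin (N + 1) => h.density.exists_isMatrixSolution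
    (μ := starRingEnd ℂ lam) h.isUnit (le_leftEnd h.mem k) (rightEnd_le h.mem k) (h.leftEnd_lt k)
    fun t ht => (h.det_ne_zero ht).2
  exact ⟨U, fun k => ⟨hU k, hU1 k⟩⟩

theorem zero_ne_last : (0 : Fin (N + 1)) ≠ Fin.last N := by
  have := h.pos
  rw [Ne, Fin.ext_iff]
  simp
  omega

variable (hU : IsFundamentalSystem J Q W (starRingEnd ℂ lam) a b x U)
include hU

/-- Shows that the entrywise `leftLim` in `transfer` is a genuine limit. -/
theorem isUnit_transfer (j : Fin N) : IsUnit (transfer x U j) ∧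
    Tendsto (U j.castSucc) (𝓝[<] x j) (𝓝 (transfer x U j)) := by
  obtain ⟨-, M, hM, hUM⟩ := h.density.isUnit_leftMat h.isUnit h.skew (le_leftEnd h.mem j.castSucc)
    (rightEnd_le h.mem j.castSucc) (h.leftEnd_lt _) (fun t ht => (h.det_ne_zero ht).1)
    (fun t ht => (h.det_ne_zero ht).2) (hU j.castSucc).1 (hU j.castSucc).2
  rw [rightEnd_castSucc, upTo_coe] at hUM
  have h1 : transfer x U j = M := leftMat_eq_of_tendsto hUM
  rw [h1]
  exact ⟨hM, hUM⟩

variable {u u' : ℝ → Fin n → ℂ}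

/-- At the left end U_k tends to 1, leaving J u⁺(x_k) = B₋(x_k, λ) u(x_k). -/
theorem bracket_eq_incoming (hu : IsSolution J Q W lam a b u) {k : Fin (N + 1)} (hk : k ≠ 0)
    {t : ℝ} (ht : t ∈ openInterval (leftEnd a x k) (rightEnd b x k)) :
    bracket J (U k) u t = incoming J Q W lam x (hat x u) k := by
  obtain ⟨j, rfl⟩ := Fin.exists_succ_eq.2 hk
  have h1 : Tendsto u (downTo (leftEnd a x j.succ)) (𝓝 (rightVal u (x j))) := by
    rw [leftEnd_succ, downTo_coe]
    exact hu.tendsto_rightVal (h.mem j)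
  rw [h.density.bracket_eq_of_tendsto_downTo h.isUnit h.skew (le_leftEnd h.mem _)
    (rightEnd_le h.mem _) (h.leftEnd_lt _) (hU j.succ).1
    (hu.mono (le_leftEnd h.mem _) (rightEnd_le h.mem _)) (hU j.succ).2 h1 ht,
    Matrix.conjTranspose_one, Matrix.one_mulVec, incoming_succ,
    ← h.density.bminus_mulVec h.isUnit le_rfl le_rfl hu (h.mem j)]
  rfl

/-- The same constant at the right end, where J u⁻ = B₊ u. -/
theorem bracket_eq_outgoing (hu : IsSolution J Q W lam a b u) {k : Fin (N + 1)}
    (hk : k ≠ Fin.last N) {t : ℝ} (ht : t ∈ openInterval (leftEnd a x k) (rightEnd b x k)) :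
    bracket J (U k) u t = outgoing J Q W lam x U (hat x u) k := by
  obtain ⟨j, rfl⟩ := Fin.exists_castSucc_eq.2 hk
  have h1 : Tendsto u (upTo (rightEnd b x j.castSucc)) (𝓝 (leftVal u (x j))) := by
    rw [rightEnd_castSucc, upTo_coe]
    exact hu.tendsto_leftVal (h.mem j)
  have h2 : Tendsto (U j.castSucc) (upTo (rightEnd b x j.castSucc)) (𝓝 (transfer x U j)) := by
    rw [rightEnd_castSucc, upTo_coe]
    exact (h.isUnit_transfer hU j).2
  rw [h.density.bracket_eq_of_tendsto_upTo h.isUnit h.skew (le_leftEnd h.mem _)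
    (rightEnd_le h.mem _) (h.leftEnd_lt _) (hU j.castSucc).1
    (hu.mono (le_leftEnd h.mem _) (rightEnd_le h.mem _)) h2 h1 ht, outgoing_castSucc,
    ← h.density.bplus_mulVec h.isUnit le_rfl le_rfl hu (h.mem j)]
  rfl

theorem bracket_zero_eq_zero (hu : IsSolution J Q W lam a b u) (h0 : Tendsto u (downTo a) (𝓝 0))
    {t : ℝ} (ht : t ∈ openInterval (leftEnd a x 0) (rightEnd b x 0)) :
    bracket J (U 0) u t = 0 := by
  rw [h.density.bracket_eq_of_tendsto_downTo h.isUnit h.skew (le_leftEnd h.mem _)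
    (rightEnd_le h.mem _) (h.leftEnd_lt _) (hU 0).1
    (hu.mono (le_leftEnd h.mem _) (rightEnd_le h.mem _)) (hU 0).2 h0 ht, Matrix.mulVec_zero,
    Matrix.mulVec_zero]

theorem bracket_last_eq_zero (hu : IsSolution J Q W lam a b u) (h0 : Tendsto u (upTo b) (𝓝 0))
    {t : ℝ} (ht : t ∈ openInterval (leftEnd a x (Fin.last N)) (rightEnd b x (Fin.last N))) :
    bracket J (U (Fin.last N)) u t = 0 := by
  -- Only the existence of a limit of U_N at b matters, for the bracket to inherit the limit 0 of u.
  obtain ⟨-, M, -, hUM⟩ := h.density.isUnit_leftMat h.isUnit h.skew (le_leftEnd h.mem (Fin.last N))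
    (rightEnd_le h.mem (Fin.last N)) (h.leftEnd_lt _) (fun t ht => (h.det_ne_zero ht).1)
    (fun t ht => (h.det_ne_zero ht).2) (hU (Fin.last N)).1 (hU (Fin.last N)).2
  have h1 : Tendsto u (upTo (rightEnd b x (Fin.last N))) (𝓝 0) := by rwa [rightEnd_last]
  rw [h.density.bracket_eq_of_tendsto_upTo h.isUnit h.skew (le_leftEnd h.mem _)
    (rightEnd_le h.mem _) (h.leftEnd_lt _) (hU _).1
    (hu.mono (le_leftEnd h.mem _) (rightEnd_le h.mem _)) hUM h1 ht, Matrix.mulVec_zero,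
    Matrix.mulVec_zero]

theorem outgoing_eq_incoming (hu : IsSolution J Q W lam a b u) {k : Fin (N + 1)} (hk : k ≠ 0)
    (hk' : k ≠ Fin.last N) :
    outgoing J Q W lam x U (hat x u) k = incoming J Q W lam x (hat x u) k := by
  obtain ⟨t, ht⟩ := openInterval_nonempty (h.leftEnd_lt k)
  rw [← h.bracket_eq_outgoing hU hu hk' ht, h.bracket_eq_incoming hU hu hk ht]

theorem hat_mem_kerAdjoint_blockBm (hu : IsSolution J Q W lam a b u) :
    hat x u ∈ kerAdjoint (blockBm J Q W (starRingEnd ℂ lam) x U) :=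
  (mem_kerAdjoint_blockBm_iff h.bplus_conj h.bminus_conj).2 fun _ hk hk' =>
    h.outgoing_eq_incoming hU hu hk hk'

theorem hat_mem_kerAdjoint_blockB (hu : IsSolution J Q W lam a b u) (h0 : VanishesAtEnds a b u) :
    hat x u ∈ kerAdjoint (blockB J Q W (starRingEnd ℂ lam) x U) := by
  refine (mem_kerAdjoint_blockB_iff h.bplus_conj h.bminus_conj).2 fun k => ?_
  rcases eq_or_ne k 0 with rfl | hk
  · obtain ⟨t, ht⟩ := openInterval_nonempty (h.leftEnd_lt 0)
    rw [← h.bracket_eq_outgoing hU hu h.zero_ne_last ht,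
      h.bracket_zero_eq_zero hU hu h0.1 ht, incoming_zero]
  rcases eq_or_ne k (Fin.last N) with rfl | hk'
  · obtain ⟨t, ht⟩ := openInterval_nonempty (h.leftEnd_lt (Fin.last N))
    rw [← h.bracket_eq_incoming hU hu hk ht, h.bracket_last_eq_zero hU hu h0.2 ht, outgoing_last]
  · exact h.outgoing_eq_incoming hU hu hk hk'

theorem eq_zero_of_bracket (hu : IsSolution J Q W lam a b u) {k : Fin (N + 1)}
    (h0 : ∀ t ∈ openInterval (leftEnd a x k) (rightEnd b x k), bracket J (U k) u t = 0) {t : ℝ}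
    (ht : t ∈ openInterval (leftEnd a x k) (rightEnd b x k)) : u t = 0 :=
  h.density.eq_zero_of_bracket_eq_zero h.isUnit h.skew (le_leftEnd h.mem _)
    (rightEnd_le h.mem _) (h.leftEnd_lt _) (fun _ ht => (h.det_ne_zero ht).1)
    (fun _ ht => (h.det_ne_zero ht).2) (hU k).1 (hU k).2
    (hu.mono (le_leftEnd h.mem _) (rightEnd_le h.mem _)) ht (h0 t ht) ht

theorem eqOn_of_hat_eq (hu : IsSolution J Q W lam a b u) (hu' : IsSolution J Q W lam a b u')
    (heq : hat x u' = hat x u) : EqOn u' u (openInterval a b) := by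
  intro t ht
  by_cases htx : t ∈ range x
  · obtain ⟨j, rfl⟩ := htx
    exact funext fun i => congrFun heq (j, i)
  obtain ⟨k, hk⟩ := exists_mem_openInterval ht htx
  refine h.density.eqOn_of_bracket_eq h.isUnit h.skew (le_leftEnd h.mem _)
    (rightEnd_le h.mem _) (h.leftEnd_lt _) (fun _ ht => (h.det_ne_zero ht).1)
    (fun _ ht => (h.det_ne_zero ht).2) (hU k).1 (hU k).2
    (hu.mono (le_leftEnd h.mem _) (rightEnd_le h.mem _))
    (hu'.mono (le_leftEnd h.mem _) (rightEnd_le h.mem _)) (fun s hs => ?_) hk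
  -- On the first interval the bracket is read off at its right end; on all others the left end is a
  -- partition point.
  rcases eq_or_ne k 0 with rfl | hk0
  · rw [h.bracket_eq_outgoing hU hu h.zero_ne_last hs,
      h.bracket_eq_outgoing hU hu' h.zero_ne_last hs, heq]
  · rw [h.bracket_eq_incoming hU hu hk0 hs, h.bracket_eq_incoming hU hu' hk0 hs, heq]

theorem vanishesAtEnds_of_hat_mem (hu : IsSolution J Q W lam a b u)
    (hv : hat x u ∈ kerAdjoint (blockB J Q W (starRingEnd ℂ lam) x U)) :
    VanishesAtEnds a b u := by
  rw [mem_kerAdjoint_blockB_iff h.bplus_conj h.bminus_conj] at hv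
  constructor
  · refine tendsto_const_nhds.congr' ?_
    have : ∀ᶠ t in downTo a, t ∈ openInterval (leftEnd a x 0) (rightEnd b x 0) :=
      eventually_mem_downTo (h.leftEnd_lt 0)
    filter_upwards [this] with t ht
    refine (h.eq_zero_of_bracket hU hu (fun s hs => ?_) ht).symm
    rw [h.bracket_eq_outgoing hU hu h.zero_ne_last hs, hv, incoming_zero]
  · refine tendsto_const_nhds.congr' ?_
    have := eventually_mem_upTo (h.leftEnd_lt (Fin.last N))
    rw [rightEnd_last] at this
    filter_upwards [this] with t ht
    refine (h.eq_zero_of_bracket hU hu (k := Fin.last N) (fun s hs => ?_)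
      (by rwa [rightEnd_last])).symm
    rw [h.bracket_eq_incoming hU hu h.zero_ne_last.symm hs, ← hv, outgoing_last]

/-- On the first and the last interval the bracket inherits the value 0 from a and b, and a
vanishing bracket forces u = 0 there. -/
theorem exists_le_of_ne_zero (hu : IsSolution J Q W lam a b u) (h0 : VanishesAtEnds a b u) {t : ℝ}
    (ht : t ∈ openInterval a b) (hut : u t ≠ 0) : ∃ i j, x i ≤ t ∧ t ≤ x j := by
  obtain ⟨M, rfl⟩ : ∃ M, N = M + 1 := ⟨N - 1, by have := h.pos; omega⟩
  refine ⟨0, Fin.last M, ?_, ?_⟩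
  · by_contra! hlt
    refine hut (h.eq_zero_of_bracket hU hu
      (fun s hs => h.bracket_zero_eq_zero hU hu h0.1 hs) ⟨ht.1, ?_⟩)
    rw [← Fin.castSucc_zero, rightEnd_castSucc]
    exact_mod_cast hlt
  · by_contra! hlt
    refine hut (h.eq_zero_of_bracket hU hu
      (fun s hs => h.bracket_last_eq_zero hU hu h0.2 hs) ⟨?_, by simpa using ht.2⟩)
    rw [← Fin.succ_last, leftEnd_succ]
    exact_mod_cast hlt

theorem compactlySupported (hu : IsSolution J Q W lam a b u) (h0 : VanishesAtEnds a b u) :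
    CompactlySupported a b u := by
  obtain ⟨M, rfl⟩ : ∃ M, N = M + 1 := ⟨N - 1, by have := h.pos; omega⟩
  refine ⟨Icc (x 0) (x (Fin.last M)), isCompact_Icc,
    Icc_subset_openInterval (h.mem _) (h.mem _), fun t ht htK => ?_⟩
  by_contra hut
  obtain ⟨i, j, hi, hj⟩ := h.exists_le_of_ne_zero hU hu h0 ht hut
  exact htK ⟨(h.strictMono.monotone (Fin.zero_le i)).trans hi,
    hj.trans (h.strictMono.monotone (Fin.le_last j))⟩

end IsPartitionedSystem

end Gluing

/-! ### From kernel vectors to solutions: gluing -/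

section GluedSolution

variable {n N : ℕ} {a b : EReal} {J : Matrix (Fin n) (Fin n) ℂ}
  {Q W : ℝ → Matrix (Fin n) (Fin n) ℂ} {ν : Measure ℝ} {ρQ ρW : ℝ → Matrix (Fin n) (Fin n) ℂ}
  {lam : ℂ} {x : Fin N → ℝ} {U : Fin (N + 1) → ℝ → Matrix (Fin n) (Fin n) ℂ}

/-- The function which is `w k` on the `k`-th interval of the partition and `v_j` at `x_j`. -/
noncomputable def glue (a b : EReal) (x : Fin N → ℝ) (w : Fin (N + 1) → ℝ → Fin n → ℂ)
    (v : Fin N × Fin n → ℂ) (t : ℝ) (i : Fin n) : ℂ :=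
  (∑ k, (openInterval (leftEnd a x k) (rightEnd b x k)).indicator (fun t => w k t i) t)
    + ∑ j, ({x j} : Set ℝ).indicator (fun _ => v (j, i)) t

variable {w : Fin (N + 1) → ℝ → Fin n → ℂ} {v : Fin N × Fin n → ℂ}

theorem glue_of_mem (hx : StrictMono x) {k : Fin (N + 1)} {t : ℝ}
    (ht : t ∈ openInterval (leftEnd a x k) (rightEnd b x k)) : glue a b x w v t = w k t := by
  ext i
  rw [glue, Finset.sum_eq_single k, indicator_of_mem ht, Finset.sum_eq_zero, add_zero]
  · refine fun j _ => indicator_of_notMem (fun h => ?_) _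
    rw [mem_singleton_iff.1 h] at ht
    exact notMem_openInterval hx j k ht
  · exact fun k' _ hk' => indicator_of_notMem (fun h => hk' (eq_of_mem_openInterval hx h ht)) _
  · simp

theorem glue_apply (hx : StrictMono x) (j : Fin N) :
    glue a b x w v (x j) = fun i => v (j, i) := by
  ext i
  rw [glue, Finset.sum_eq_zero, zero_add, Finset.sum_eq_single j,
    indicator_of_mem (mem_singleton (x j))]
  · exact fun j' _ hj' => indicator_of_notMem
      (fun h : x j ∈ ({x j'} : Set ℝ) => hj' (hx.injective (mem_singleton_iff.1 h)).symm) _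
  · simp
  · exact fun k _ => indicator_of_notMem (notMem_openInterval hx j k) _

theorem measurable_glue (hw : ∀ k i, Measurable fun t => w k t i) (i : Fin n) :
    Measurable fun t => glue a b x w v t i :=
  (Finset.measurable_fun_sum _ fun k _ => (hw k i).indicator (measurableSet_openInterval _ _)).add
    (Finset.measurable_fun_sum _ fun j _ =>
      measurable_const.indicator (measurableSet_singleton (x j)))

theorem exists_norm_glue_le (hw : ∀ k, ∃ C, ∀ t ∈ openInterval (leftEnd a x k) (rightEnd b x k),
    ∀ i, ‖w k t i‖ ≤ C) : ∃ C, ∀ t i, ‖glue a b x w v t i‖ ≤ C := by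
  choose C hC using hw
  refine ⟨(∑ k, |C k|) + ∑ j : Fin N, ‖v‖, fun t i => (norm_add_le _ _).trans (add_le_add ?_ ?_)⟩
  · refine (norm_sum_le _ _).trans (Finset.sum_le_sum fun k _ => ?_)
    by_cases ht : t ∈ openInterval (leftEnd a x k) (rightEnd b x k)
    · rw [indicator_of_mem ht]
      exact (hC k t ht i).trans (le_abs_self _)
    · rw [indicator_of_notMem ht, norm_zero]
      exact abs_nonneg _
  · refine (norm_sum_le _ _).trans (Finset.sum_le_sum fun j _ => ?_)
    exact (norm_indicator_le_norm_self _ _).trans (norm_le_pi_norm v (j, i))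

namespace IsPartitionedSystem

variable (h : IsPartitionedSystem a b J Q W ν ρQ ρW lam x)
include h

/-- On the k-th interval the left limit of u is a constant D k plus the integral of A u over the
part of (a, b) below t. The conditions at x_j say that q j and p j are the left and right limits
belonging to the value v_j, so all D k coincide and one integral equation holds on (a, b). -/
theorem isSolution_glue
    (hw : ∀ k, IsSolution J Q W lam (leftEnd a x k) (rightEnd b x k) (w k))
    (hwm : ∀ k i, Measurable fun t => w k t i)
    (hwC : ∀ k, ∃ C, ∀ t ∈ openInterval (leftEnd a x k) (rightEnd b x k), ∀ i, ‖w k t i‖ ≤ C)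
    {p q : Fin N → Fin n → ℂ}
    (hp : ∀ j, Tendsto (w j.succ) (downTo (x j)) (𝓝 (p j)))
    (hq : ∀ j, Tendsto (w j.castSucc) (upTo (x j)) (𝓝 (q j)))
    (hp' : ∀ j, J.mulVec (p j) = (Bminus J Q W (x j) lam).mulVec fun i => v (j, i))
    (hq' : ∀ j, J.mulVec (q j) = (Bplus J Q W (x j) lam).mulVec fun i => v (j, i)) :
    IsSolution J Q W lam a b (glue a b x w v) := by
  have hν := h.density.finite
  set u := glue a b x w v with hu
  set φ : Fin n → ℝ → ℂ := fun i r => (generator J ρQ ρW lam r).mulVec (u r) i with hφ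
  set m := ν.restrict (openInterval a b) with hm
  obtain ⟨C, hC⟩ := exists_norm_glue_le (v := v) hwC
  have hint : ∀ i, IntegrableOn (φ i) (openInterval a b) ν := fun i =>
    h.density.integrableOn_generator_mulVec (measurableSet_openInterval a b) (C := C)
      (fun j => (measurable_glue hwm j).aestronglyMeasurable) (fun j t _ => hC t j) i
  have hintm : ∀ i, Integrable (φ i) m := hint
  have hIic : ∀ t ∈ openInterval a b, ∀ i, ∫ r in Iic t, φ i r ∂m
      = (∫ r in Iio t, φ i r ∂m) + ν.real {t} * φ i t := fun t ht i =>
    setIntegral_Iic_restrict (hint i) ht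
  have hstep : ∀ k, ∀ s ∈ openInterval (leftEnd a x k) (rightEnd b x k),
      ∀ t ∈ openInterval (leftEnd a x k) (rightEnd b x k), s ≤ t → ∀ i,
      leftVal (w k) t i - ∫ r in Iio t, φ i r ∂m = leftVal (w k) s i - ∫ r in Iio s, φ i r ∂m := by
    intro k s hs t ht hst i
    have hsub : Ico s t ⊆ openInterval (leftEnd a x k) (rightEnd b x k) :=
      Ico_subset_Icc_self.trans (Icc_subset_openInterval hs ht)
    have h1 : ∫ r in Ico s t, φ i r ∂m = ∫ r in Ico s t,
        (generator J ρQ ρW lam r).mulVec (w k r) i ∂ν := by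
      rw [hm, Measure.restrict_restrict measurableSet_Ico,
        inter_eq_self_of_subset_left (hsub.trans fun _ => h.mem_of_mem)]
      refine setIntegral_congr_fun measurableSet_Ico fun r hr => ?_
      simp only [hφ, hu, glue_of_mem h.strictMono (hsub hr)]
    rw [h.density.leftVal_eq_add h.isUnit (le_leftEnd h.mem k) (rightEnd_le h.mem k) (hw k) hs ht
      hst i, ← h1, ← Iio_union_Ico_eq_Iio hst, setIntegral_union ?_ measurableSet_Ico
      (hintm i).integrableOn (hintm i).integrableOn]
    · ring
    · exact (Iio_disjoint_Ici le_rfl).mono_right Ico_subset_Ici_self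
  have hD : ∀ k, ∃ D : Fin n → ℂ, ∀ t ∈ openInterval (leftEnd a x k) (rightEnd b x k), ∀ i,
      leftVal (w k) t i = D i + ∫ r in Iio t, φ i r ∂m := fun k => by
    obtain ⟨s, hs⟩ := openInterval_nonempty (h.leftEnd_lt k)
    refine ⟨fun i => leftVal (w k) s i - ∫ r in Iio s, φ i r ∂m, fun t ht i => ?_⟩
    rw [← sub_eq_iff_eq_add]
    rcases le_total s t with hst | hst
    · exact hstep k s hs t ht hst i
    · exact (hstep k t ht s hs hst i).symm
  choose D hD using hD
  have hqD : ∀ j i, q j i = D j.castSucc i + ∫ r in Iio (x j), φ i r ∂m := fun j i => by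
    have hlt := h.leftEnd_lt j.castSucc
    have hwj := hw j.castSucc
    have hDj := hD j.castSucc
    rw [rightEnd_castSucc] at hlt hwj hDj
    have := upTo_neBot hlt
    refine tendsto_nhds_unique (tendsto_pi_nhds.1 (hwj.tendsto_leftVal_upTo hlt (hq j)) i) ?_
    refine Tendsto.congr' (f₁ := fun t => D j.castSucc i + ∫ r in Iio t, φ i r ∂m) ?_ ?_
    · filter_upwards [eventually_mem_upTo hlt] with t ht using (hDj t ht i).symm
    · rw [upTo_coe]
      exact (tendsto_setIntegral_Iio_left (hintm i) (x j)).const_add _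
  have hpD : ∀ j i, p j i = D j.succ i + ∫ r in Iic (x j), φ i r ∂m := fun j i => by
    have hlt := h.leftEnd_lt j.succ
    have hwj := hw j.succ
    have hDj := hD j.succ
    rw [leftEnd_succ] at hlt hwj hDj
    have := downTo_neBot hlt
    refine tendsto_nhds_unique (tendsto_pi_nhds.1 (hwj.tendsto_leftVal_downTo hlt (hp j)) i) ?_
    refine Tendsto.congr' (f₁ := fun t => D j.succ i + ∫ r in Iio t, φ i r ∂m) ?_ ?_
    · filter_upwards [eventually_mem_downTo hlt] with t ht using (hDj t ht i).symm
    · rw [downTo_coe]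
      exact (tendsto_setIntegral_Iio_right (hintm i) (x j)).const_add _
  have hJinj := Matrix.mulVec_injective_of_isUnit h.isUnit
  have hux : ∀ j, u (x j) = fun i => v (j, i) := fun j => glue_apply h.strictMono j
  have hpx : ∀ j, p j = u (x j)
      + ((1 / 2 : ℂ) * ν.real {x j}) • (generator J ρQ ρW lam (x j)).mulVec (u (x j)) := fun j => by
    refine hJinj ?_
    rw [hp', h.density.bminus_eq h.isUnit (h.mem j), ← hux, Matrix.add_mulVec, Matrix.mulVec_add,
      Matrix.mulVec_smul, Matrix.smul_mulVec, Matrix.mulVec_mulVec]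
  have hqx : ∀ j, q j = u (x j)
      - ((1 / 2 : ℂ) * ν.real {x j}) • (generator J ρQ ρW lam (x j)).mulVec (u (x j)) := fun j => by
    refine hJinj ?_
    rw [hq', h.density.bplus_eq h.isUnit (h.mem j), ← hux, Matrix.sub_mulVec, Matrix.mulVec_sub,
      Matrix.mulVec_smul, Matrix.smul_mulVec, Matrix.mulVec_mulVec]
  -- p j - q j is the atom ν{x_j}A u(x_j), which is also what the integral gains in passing from
  -- `Iio` to `Iic`.
  have hDeq : ∀ k, D k = D 0 := fun k => by
    induction k using Fin.induction with
    | zero => rfl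
    | succ j ih =>
      rw [← ih]
      ext i
      have h1 := hpD j i
      have h2 := hqD j i
      rw [hpx, hIic _ (h.mem j)] at h1
      rw [hqx] at h2
      simp only [Pi.add_apply, Pi.sub_apply, Pi.smul_apply, smul_eq_mul] at h1 h2
      simp only [hφ] at h1 h2
      linear_combination h2 - h1
  refine h.density.isSolution_of_integral h.isUnit le_rfl le_rfl (p := D 0) hint fun t ht i => ?_
  have hgoal : u t i = D 0 i + (1 / 2) * ((∫ r in Iio t, φ i r ∂m) + ∫ r in Iic t, φ i r ∂m) := by
    rw [hIic t ht]
    by_cases htx : t ∈ range x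
    · obtain ⟨j, rfl⟩ := htx
      have h2 := hqD j i
      rw [hqx, hDeq] at h2
      simp only [Pi.sub_apply, Pi.smul_apply, smul_eq_mul] at h2
      simp only [hφ] at h2 ⊢
      linear_combination h2
    · obtain ⟨k, hk⟩ := exists_mem_openInterval ht htx
      have h1 := congrFun (h.density.eq_leftVal_add h.isUnit (le_leftEnd h.mem k)
        (rightEnd_le h.mem k) (hw k) hk) i
      have h2 : u t = w k t := glue_of_mem h.strictMono hk
      rw [← h2, Pi.add_apply, hD k t hk, hDeq] at h1
      rw [h1]
      simp only [hφ, Pi.smul_apply, smul_eq_mul]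
      ring
  exact hgoal

variable (hU : IsFundamentalSystem J Q W (starRingEnd ℂ lam) a b x U)
include hU

/-- Each piece starts with the right limit that v prescribes at its left end. The bracket transports
this to the right end, where the kernel condition identifies it with the left limit that v
prescribes there. -/
theorem exists_isSolution_hat_eq
    (hv : v ∈ kerAdjoint (blockBm J Q W (starRingEnd ℂ lam) x U)) :
    ∃ u, IsSolution J Q W lam a b u ∧ hat x u = v := by
  rw [mem_kerAdjoint_blockBm_iff h.bplus_conj h.bminus_conj] at hv
  -- The value the bracket is to have on each interval. No vector is prescribed at a, so on the
  -- first interval it is taken from the right end x₁ instead.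
  set s : Fin (N + 1) → Fin n → ℂ := fun k =>
    if k = 0 then outgoing J Q W lam x U v 0 else incoming J Q W lam x v k with hs
  have hJJ : ∀ z : Fin n → ℂ, J.mulVec (J⁻¹.mulVec z) = z := fun z => by
    rw [Matrix.mulVec_mulVec, Matrix.mul_nonsing_inv _ ((Matrix.isUnit_iff_isUnit_det J).1 h.isUnit),
      Matrix.one_mulVec]
  choose w hw hwm hwC hp q hq using fun k : Fin (N + 1) => h.density.exists_isSolution
    (μ := lam) h.isUnit (le_leftEnd h.mem k) (rightEnd_le h.mem k) (h.leftEnd_lt k)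
    (fun t ht => (h.det_ne_zero ht).1) (J⁻¹.mulVec (s k))
  refine ⟨glue a b x w v, h.isSolution_glue hw hwm hwC (p := fun j => J⁻¹.mulVec (s j.succ))
    (q := fun j => q j.castSucc) (fun j => hp j.succ) (fun j => ?_) (fun j => ?_) (fun j => ?_), ?_⟩
  · rw [← rightEnd_castSucc (b := b) (x := x) j]
    exact hq j.castSucc
  · rw [hJJ, hs]
    simp [Fin.succ_ne_zero]
  · obtain ⟨t, ht⟩ := openInterval_nonempty (h.leftEnd_lt j.castSucc)
    obtain ⟨hT, hT'⟩ := h.isUnit_transfer hU j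
    rw [← upTo_coe, ← rightEnd_castSucc (b := b) (x := x) j] at hT'
    have h1 := h.density.bracket_eq_of_tendsto_downTo h.isUnit h.skew (le_leftEnd h.mem _)
      (rightEnd_le h.mem _) (h.leftEnd_lt _) (hU j.castSucc).1 (hw _) (hU j.castSucc).2 (hp _) ht
    rw [h.density.bracket_eq_of_tendsto_upTo h.isUnit h.skew (le_leftEnd h.mem _)
      (rightEnd_le h.mem _) (h.leftEnd_lt _) (hU j.castSucc).1 (hw _) hT' (hq _) ht,
      Matrix.conjTranspose_one, Matrix.one_mulVec, hJJ] at h1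
    -- Constancy of the bracket has given U(x_j)* J q_j = s, and U(x_j)* may be cancelled.
    refine Matrix.mulVec_injective_of_isUnit ((Matrix.isUnit_conjTranspose _).2 hT) ?_
    rw [h1, ← outgoing_castSucc]
    by_cases hj : j.castSucc = 0
    · simp only [hs, hj, if_true]
    · simp only [hs, if_neg hj]
      exact (hv _ hj (Fin.castSucc_ne_last j)).symm
  · ext ⟨j, i⟩
    exact congrFun (glue_apply h.strictMono j) i

end IsPartitionedSystem

end GluedSolution

end FirstOrderSystem

theorem theoremT (n N : ℕ) (hN : 1 ≤ N) (a b : EReal)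
    (J : Matrix (Fin n) (Fin n) ℂ) (hJ : IsUnit J) (hJskew : J.conjTranspose = -J)
    (Q W : ℝ → Matrix (Fin n) (Fin n) ℂ)
    (hQ : FirstOrderSystem.IsAntiderivative a b Q)
    (hW : FirstOrderSystem.IsAntiderivative a b W)
    (hQherm : FirstOrderSystem.HermitianDeriv a b Q)
    (hWnonneg : FirstOrderSystem.NonnegDeriv a b W)
    (ha : FirstOrderSystem.RegularLeft a b Q W)
    (hb : FirstOrderSystem.RegularRight a b Q W)
    (x : Fin N → ℝ) (hx : StrictMono x)
    (hxI : ∀ j, x j ∈ FirstOrderSystem.openInterval a b)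
    (hbad : FirstOrderSystem.badPoints J Q W a b 0 ⊆ Set.range x)
    (lam : ℂ)
    (hlam : FirstOrderSystem.badPoints J Q W a b lam ⊆ Set.range x) :
    (∃ U : Fin (N + 1) → ℝ → Matrix (Fin n) (Fin n) ℂ,
      FirstOrderSystem.IsFundamentalSystem J Q W (starRingEnd ℂ lam) a b x U) ∧
    ∀ U : Fin (N + 1) → ℝ → Matrix (Fin n) (Fin n) ℂ,
      FirstOrderSystem.IsFundamentalSystem J Q W (starRingEnd ℂ lam) a b x U →
      -- solutions give elements of the kernels
      (∀ u : ℝ → Fin n → ℂ, FirstOrderSystem.IsSolution J Q W lam a b u →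
        FirstOrderSystem.hat x u ∈ FirstOrderSystem.kerAdjoint
          (FirstOrderSystem.blockBm J Q W (starRingEnd ℂ lam) x U)) ∧
      (∀ u : ℝ → Fin n → ℂ, FirstOrderSystem.IsSolution J Q W lam a b u →
        FirstOrderSystem.VanishesAtEnds a b u →
        FirstOrderSystem.hat x u ∈ FirstOrderSystem.kerAdjoint
          (FirstOrderSystem.blockB J Q W (starRingEnd ℂ lam) x U)) ∧
      FirstOrderSystem.kerAdjoint (FirstOrderSystem.blockB J Q W (starRingEnd ℂ lam) x U) ≤
        FirstOrderSystem.kerAdjoint (FirstOrderSystem.blockBm J Q W (starRingEnd ℂ lam) x U) ∧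
      -- elements of the kernels come from unique solutions
      (∀ v ∈ FirstOrderSystem.kerAdjoint
          (FirstOrderSystem.blockBm J Q W (starRingEnd ℂ lam) x U),
        ∃ u : ℝ → Fin n → ℂ, FirstOrderSystem.IsSolution J Q W lam a b u ∧
          FirstOrderSystem.hat x u = v ∧
          (∀ u' : ℝ → Fin n → ℂ, FirstOrderSystem.IsSolution J Q W lam a b u' →
            FirstOrderSystem.hat x u' = v →
            Set.EqOn u' u (FirstOrderSystem.openInterval a b)) ∧
          (v ∈ FirstOrderSystem.kerAdjoint
              (FirstOrderSystem.blockB J Q W (starRingEnd ℂ lam) x U) →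
            FirstOrderSystem.VanishesAtEnds a b u)) ∧
      -- the solutions vanishing at the ends are the compactly supported ones
      (∀ u : ℝ → Fin n → ℂ, FirstOrderSystem.IsSolution J Q W lam a b u →
        (FirstOrderSystem.VanishesAtEnds a b u ↔
          FirstOrderSystem.CompactlySupported a b u) ∧
        (FirstOrderSystem.VanishesAtEnds a b u →
          ∀ t ∈ FirstOrderSystem.openInterval a b, u t ≠ 0 →
            ∃ i j, x i ≤ t ∧ t ≤ x j)) := by
  obtain ⟨ν, ρQ, ρW, hρ⟩ := FirstOrderSystem.exists_isCoefficientDensity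
    ((hxI ⟨0, hN⟩).1.trans (hxI ⟨0, hN⟩).2) hQ hW hQherm hWnonneg.hermitianDeriv ha hb
  have h : FirstOrderSystem.IsPartitionedSystem a b J Q W ν ρQ ρW lam x :=
    ⟨hρ, hJ, hJskew, hN, hx, hxI, hlam⟩
  refine ⟨h.exists_isFundamentalSystem, fun U hU =>
    ⟨fun u hu => h.hat_mem_kerAdjoint_blockBm hU hu,
      fun u hu h0 => h.hat_mem_kerAdjoint_blockB hU hu h0, fun v hv => ?_, fun v hv => ?_,
      fun u hu => ⟨⟨h.compactlySupported hU hu,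
        FirstOrderSystem.vanishesAtEnds_of_compactlySupported h.lt⟩,
        fun h0 t ht hut => h.exists_le_of_ne_zero hU hu h0 ht hut⟩⟩⟩
  · rw [FirstOrderSystem.mem_kerAdjoint_blockB_iff h.bplus_conj h.bminus_conj] at hv
    exact (FirstOrderSystem.mem_kerAdjoint_blockBm_iff h.bplus_conj h.bminus_conj).2
      fun k _ _ => hv k
  · obtain ⟨u, hu, rfl⟩ := h.exists_isSolution_hat_eq hU hv
    exact ⟨u, hu, rfl, fun u' hu' heq => h.eqOn_of_hat_eq hU hu hu' heq,
      h.vanishesAtEnds_of_hat_mem hU hu⟩
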